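/- Let $(\Omega,\mathcal F,(\mathcal F_t)_{t\ge0},\mathbb P)$ be a filtered probability space satisfying the usual conditions, with $\mathcal F_0$ $\mathbb P$-trivial. Let $T>0$, $X\ge0$, $\eta>0$, $\gamma\ge0$, $\widetilde\lambda>0$, and put $\lambda=\widetilde\lambda/\eta$ and $\nu=\sqrt{\widetilde\lambda\gamma/\eta}$. Let $S^0$ be a càdlàg semimartingale with $\mathbb E[(\sup_{0\le t\le T}|S^0_t|)^2]<\infty$, and let $S_0$ be its (a.s. constant) initial value. Let $\mathcal X(T,X)$ be the class of adapted processes $(x_t)_{0\le t\le T}$ with absolutely continuous paths, $x_0=X$, $x_T=0$ and $\mathbb E[\int_0^T\dot x_t^2\,dt]<\infty$. For $x\in\mathcal X(T,X)$ set $S^x_t=S^0_t+\eta\dot x_t+\gamma(x_t-x_0)$, $\mathcal C(x)=\int_0^TS^x_t\dot x_t\,dt$ and $$J(x)=\mathbb E\Big[\mathcal C(x)+\int_0^T\widetilde\lambda x_t(S^0_t+\gamma x_t)\,dt\Big].$$ Let $Y_t=-\frac1\eta(S^0_t-S_0)+\lambda\int_0^tS^0_s\,ds$. Stochastic integrals are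 taken over half-open intervals, $\int_t^T\xi_u\,dY_u=\int_0^T\xi_u\,dY_u-\int_0^t\xi_u\,dY_u$, and processes of conditional expectations given $\mathcal F_t$ are taken in their right-continuous versions. Then $J$ is well-defined and finite on $\mathcal X(T,X)$, and there is a strategy in $\mathcal X(T,X)$, unique up to indistinguishability, that minimizes $J$ over $\mathcal X(T,X)$. If $\nu>0$, let $K_t=\mathbb E\big[\int_t^T\sinh(\nu(T-u))\,dY_u\,\big|\,\mathcal F_t\big]$, $0\le t\le T$. The minimizer is $$x^*_t=\sinh(\nu(T-t))\Big[\frac X{\sinh(\nu T)}-\frac12\int_0^t\frac{K_s}{(\sinh(\nu(T-s)))^2}\,ds\Big]$$ and the minimal value is $$J(x^*)=\frac\gamma2X^2-XS_0+\eta\bigg(\nu X^2\coth(\nu T)+\frac X{\sinh(\nu T)}\mathbb E\Big[\int_0^T\sinh(\nu(T-u))\,dY_u\Big]-\frac14\mathbb E\Big[\int_0^T\Big(\frac{K_t}{\sinh(\nu(T-t))}\Big)^2dt\Big]\bigg).$$ If $\nu=0$ (that is, $\gamma=0$), let $K_t=\mathbb E\big[\int_t^T(T-u)\,dY_u\,\big|\,\mathcal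 F_t\big]$. The minimizer is $$x^0_t=\frac{T-t}T\Big(X-\frac12\int_0^t\frac T{(T-s)^2}K_s\,ds\Big)$$ and the minimal value is $$J(x^0)=-XS_0+\eta\bigg(\frac{X^2}T+\frac XT\mathbb E\Big[\int_0^T(T-u)\,dY_u\Big]-\frac14\mathbb E\Big[\int_0^T\Big(\frac{K_t}{T-t}\Big)^2dt\Big]\bigg).$$ -/

import Mathlib

open MeasureTheory ProbabilityTheory Filter Topology
open scoped NNReal ENNReal

namespace OptimalExecution

noncomputable section

variable {Ω : Type*} {mΩ : MeasurableSpace Ω}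

/-! ### Stochastic processes -/

/-- The usual conditions: the filtration is right-continuous and `𝓕 0` contains every subset of
every `P`-null set (so that in particular the probability space is complete). -/
structure UsualConditions (𝓕 : Filtration ℝ≥0 mΩ) (P : Measure Ω) : Prop where
  rightContinuous : 𝓕.IsRightContinuous
  complete : ∀ A : Set Ω, P A = 0 → MeasurableSet[𝓕 0] A

/-- `𝓕 0` is `P`-trivial. -/
def TrivialAtZero (𝓕 : Filtration ℝ≥0 mΩ) (P : Measure Ω) : Prop :=
  ∀ A : Set Ω, MeasurableSet[𝓕 0] A → P A = 0 ∨ P A = 1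

/-- Almost all paths are right-continuous with left limits. -/
def IsCadlag (P : Measure Ω) (Z : ℝ≥0 → Ω → ℝ) : Prop :=
  ∀ᵐ ω ∂P, ∀ t : ℝ≥0, ContinuousWithinAt (fun s => Z s ω) (Set.Ioi t) t ∧
    ∃ l : ℝ, Tendsto (fun s => Z s ω) (𝓝[<] t) (𝓝 l)

/-- Càdlàg local martingales (Mathlib's localization: stopped along a localizing sequence of
stopping times the process is a martingale). -/
structure IsLocalMartingale (𝓕 : Filtration ℝ≥0 mΩ) (P : Measure Ω) (M : ℝ≥0 → Ω → ℝ) :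
    Prop where
  adapted : StronglyAdapted 𝓕 M
  cadlag : IsCadlag P M
  local_martingale : Locally (fun N : ℝ≥0 → Ω → ℝ => Martingale N 𝓕 P) 𝓕 M P

/-- Adapted càdlàg processes with paths of finite variation on compact intervals. -/
structure IsFiniteVariation (𝓕 : Filtration ℝ≥0 mΩ) (P : Measure Ω) (A : ℝ≥0 → Ω → ℝ) :
    Prop where
  adapted : StronglyAdapted 𝓕 A
  cadlag : IsCadlag P A
  finite_variation : ∀ᵐ ω ∂P, LocallyBoundedVariationOn (fun t => A t ω) Set.univ

/-- Càdlàg semimartingales: `S = S₀ + M + A` with a local martingale `M` and an adapted process `A`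
of locally finite variation, both null at time `0`. -/
structure IsSemimartingale (𝓕 : Filtration ℝ≥0 mΩ) (P : Measure Ω) (S : ℝ≥0 → Ω → ℝ) :
    Prop where
  adapted : StronglyAdapted 𝓕 S
  cadlag : IsCadlag P S
  decomposition : ∃ M A : ℝ≥0 → Ω → ℝ,
    IsLocalMartingale 𝓕 P M ∧ IsFiniteVariation 𝓕 P A ∧
    (∀ ω, M 0 ω = 0) ∧ (∀ ω, A 0 ω = 0) ∧
    ∀ᵐ ω ∂P, ∀ t, S t ω = S 0 ω + M t ω + A t ω

/-- `H` is a version on `[0, T]` of the process `V`, with right-continuous paths. -/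
structure IsRightContVersion (P : Measure Ω) (T : ℝ≥0) (V H : ℝ≥0 → Ω → ℝ) : Prop where
  version : ∀ t ≤ T, H t =ᵐ[P] V t
  rightContinuous :
    ∀ᵐ ω ∂P, ∀ t < T, ContinuousWithinAt (fun s => H s ω) (Set.Ioi t) t

/-- The path of a process, as a function of a real time parameter (used only on `[0, ∞)`). -/
def path (Z : ℝ≥0 → Ω → ℝ) (ω : Ω) : ℝ → ℝ := fun t => Z t.toNNReal ω

/-! ### Stochastic integrals of deterministic continuous integrands -/

/-- `0 = π 0 ≤ π 1 ≤ ⋯ ≤ π n = t`. -/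
structure IsPartition (t : ℝ≥0) (n : ℕ) (π : ℕ → ℝ≥0) : Prop where
  mono : Monotone π
  start : π 0 = 0
  finish : π n = t

/-- The largest step `π (i + 1) - π i`, `i < n`. -/
def mesh (n : ℕ) (π : ℕ → ℝ≥0) : ℝ≥0 := (Finset.range n).sup fun i => π (i + 1) - π i

/-- The Itô (left-endpoint) sum `∑ ξ(π i) (Y_{π (i + 1)} - Y_{π i})`. -/
def itoSum (ξ : ℝ → ℝ) (Y : ℝ≥0 → Ω → ℝ) (n : ℕ) (π : ℕ → ℝ≥0) (ω : Ω) : ℝ :=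
  ∑ i ∈ Finset.range n, ξ (π i) * (Y (π (i + 1)) ω - Y (π i) ω)

/-- The random variable `I` is the stochastic integral `∫₀ᵗ ξ_u dY_u` (over `(0, t]`) of the
continuous deterministic function `ξ`: the Itô sums along every sequence of partitions of `[0, t]`
with mesh tending to zero converge to `I` in probability. This determines `I` up to a null set. -/
def IsStochIntegral (P : Measure Ω) (ξ : ℝ → ℝ) (Y : ℝ≥0 → Ω → ℝ) (t : ℝ≥0) (I : Ω → ℝ) : Prop :=
  ∀ (n : ℕ → ℕ) (π : ℕ → ℕ → ℝ≥0), (∀ k, IsPartition t (n k) (π k)) →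
    Tendsto (fun k => mesh (n k) (π k)) atTop (𝓝 0) →
    TendstoInMeasure P (fun k => itoSum ξ Y (n k) (π k)) atTop I

open Classical in
/-- The stochastic integral `∫₀ᵗ ξ_u dY_u` (`0` if it does not exist). -/
def stochIntegral (P : Measure Ω) (ξ : ℝ → ℝ) (Y : ℝ≥0 → Ω → ℝ) (t : ℝ≥0) : Ω → ℝ :=
  if h : ∃ I : Ω → ℝ, IsStochIntegral P ξ Y t I then h.choose else 0

/-- The process `t ↦ E[∫_t^T ξ_u dY_u | 𝓕 t]`, where `∫_t^T = ∫_0^T - ∫_0^t`. -/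
def condTail (𝓕 : Filtration ℝ≥0 mΩ) (P : Measure Ω) (ξ : ℝ → ℝ) (Y : ℝ≥0 → Ω → ℝ) (T : ℝ≥0) :
    ℝ≥0 → Ω → ℝ :=
  fun t => P[stochIntegral P ξ Y T - stochIntegral P ξ Y t | 𝓕 t]

/-! ### The liquidation problem -/

/-- The class `𝒳(T, X)` of admissible strategies: adapted, absolutely continuous on `[0, T]`, with
`x_0 = X`, `x_T = 0` and `E[∫_0^T ẋ_t² dt] < ∞`. -/
structure IsAdmissible (𝓕 : Filtration ℝ≥0 mΩ) (P : Measure Ω) (T : ℝ≥0) (X : ℝ)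
    (x : ℝ≥0 → Ω → ℝ) : Prop where
  adapted : ∀ t ≤ T, StronglyMeasurable[𝓕 t] (x t)
  absolutelyContinuous : ∀ᵐ ω ∂P, AbsolutelyContinuousOnInterval (path x ω) 0 T
  start : ∀ᵐ ω ∂P, x 0 ω = X
  finish : ∀ᵐ ω ∂P, x T ω = 0
  finite_energy :
    ∫⁻ ω, (∫⁻ t in Set.Ioo (0 : ℝ) T, ENNReal.ofReal (deriv (path x ω) t ^ 2)) ∂P < ⊤

/-- The set of admissible strategies. -/
def admissible (𝓕 : Filtration ℝ≥0 mΩ) (P : Measure Ω) (T : ℝ≥0) (X : ℝ) :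
    Set (ℝ≥0 → Ω → ℝ) :=
  {x | IsAdmissible 𝓕 P T X x}

/-- The transaction price `S^x_t = S⁰_t + η ẋ_t + γ (x_t - x_0)`. -/
def price (S : ℝ≥0 → Ω → ℝ) (η γ : ℝ) (x : ℝ≥0 → Ω → ℝ) (ω : Ω) (t : ℝ) : ℝ :=
  path S ω t + η * deriv (path x ω) t + γ * (path x ω t - x 0 ω)

/-- The integrand `S^x_t ẋ_t` of the execution costs. -/
def costRate (S : ℝ≥0 → Ω → ℝ) (η γ : ℝ) (x : ℝ≥0 → Ω → ℝ) (ω : Ω) (t : ℝ) : ℝ :=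
  price S η γ x ω t * deriv (path x ω) t

/-- The integrand `λ̃ x_t (S⁰_t + γ x_t)` of the risk term. -/
def riskRate (S : ℝ≥0 → Ω → ℝ) (γ lam : ℝ) (x : ℝ≥0 → Ω → ℝ) (ω : Ω) (t : ℝ) : ℝ :=
  lam * path x ω t * (path S ω t + γ * path x ω t)

/-- `𝒞(x) + ∫_0^T λ̃ x_t (S⁰_t + γ x_t) dt`, where `𝒞(x) = ∫_0^T S^x_t ẋ_t dt`. -/
def costPlusRisk (S : ℝ≥0 → Ω → ℝ) (T : ℝ≥0) (η γ lam : ℝ) (x : ℝ≥0 → Ω → ℝ) (ω : Ω) : ℝ :=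
  (∫ t in (0 : ℝ)..T, costRate S η γ x ω t) + ∫ t in (0 : ℝ)..T, riskRate S γ lam x ω t

/-- The cost functional `E[𝒞(x) + ∫_0^T λ̃ x_t (S⁰_t + γ x_t) dt]`. -/
def objective (P : Measure Ω) (S : ℝ≥0 → Ω → ℝ) (T : ℝ≥0) (η γ lam : ℝ) (x : ℝ≥0 → Ω → ℝ) : ℝ :=
  ∫ ω, costPlusRisk S T η γ lam x ω ∂P

/-- `Y_t = -(S⁰_t - S⁰_0) / η + λ ∫_0^t S⁰_s ds` with `λ = λ̃ / η`. -/
def driver (S : ℝ≥0 → Ω → ℝ) (η lam : ℝ) : ℝ≥0 → Ω → ℝ :=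
  fun t ω => -(1 / η) * (S t ω - S 0 ω) + lam / η * ∫ s in (0 : ℝ)..t, path S ω s

/-- The optimal strategy for `ν > 0`, where `H_s` stands for
`E[∫_s^T sinh (ν (T - u)) dY_u | 𝓕 s]`. -/
def optimalStrategy (T : ℝ≥0) (X ν : ℝ) (H : ℝ≥0 → Ω → ℝ) : ℝ≥0 → Ω → ℝ :=
  fun t ω => Real.sinh (ν * (T - t)) *
    (X / Real.sinh (ν * T) -
      1 / 2 * ∫ s in (0 : ℝ)..t, path H ω s / Real.sinh (ν * (T - s)) ^ 2)

/-- The optimal strategy for `ν = 0`, where `H_s` stands for `E[∫_s^T (T - u) dY_u | 𝓕 s]`. -/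
def optimalStrategyZero (T : ℝ≥0) (X : ℝ) (H : ℝ≥0 → Ω → ℝ) : ℝ≥0 → Ω → ℝ :=
  fun t ω => ((T : ℝ) - t) / T *
    (X - 1 / 2 * ∫ s in (0 : ℝ)..t, T / ((T : ℝ) - s) ^ 2 * path H ω s)

end

end OptimalExecution

/-! Path by path the problem is linear-quadratic, and it is solved by completing a square twice. Let
`c` be `sinh (ν (T - t))` or `T - t` and `d = -c'`, so that `c'' = ν² c` and `c T = 0`. Then `q = d
/ c` solves the Riccati equation `q' = q² - ν²`. With the `excess` `w = x' + x q` this gives `x'² +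
ν² x² = w² - (x² q)'`. Although `q` blows up at `T`, the boundary term vanishes there: `x T = 0`
gives `x(s)² ≤ (T - s) ∫_s^T x'²`, while `q` is of order `1 / (T - s)`. Hence `∫ (x'² + ν² x²) = ∫
w² + x(0)² q(0)` (`energy_identity`).

Integration by parts in the cost moves all randomness into a constant and the linear term `-∫ Y x'`
(`cost_eq`). A second integration by parts rewrites this term as a constant plus `∫ (R / c) w`,
where `R_t = ∫_t^T c dY` is the `remainder` (`linear_identity`). Since `c` is `C¹`, the stochastic
integral exists by Abel summation along almost every path, with no integration theory beyond
dominated convergence.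

After taking expectations, `w` is adapted, so `R` may be replaced by `K_t = E[R_t | 𝓕 t]`
(`integral_mul_eq_of_condExp`). The cost becomes the claimed value plus `η E ∫ (w + K / (2c))²`
(`objective_eq`). The optimum must therefore satisfy `w = -K / (2c)`. As `(x / c)' = w / c`, this
linear equation has the stated formula as its solution. Two strategies with equal start, end and
excess coincide, because their difference has zero energy (`eq_of_excess_eq`).

It remains to see that the candidate is admissible although `1 / c²` is singular at `T`. The
quotient `R / c` is bounded by a constant times `sup |Y|`, so `K / c` is square integrable. The
energy identity on `[0, s]` then bounds the energy uniformly in `s` and forces `x → 0` at `T`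
(`absolutelyContinuous_feedback`).

The right-continuous version of `K` is a regularized closed martingale minus the adapted integral
`∫_0^t c dY`. The regularization uses Doob's upcrossing and maximal inequalities on dyadic grids. -/

namespace OptimalExecution

noncomputable section

section

variable {Ω : Type*} {mΩ : MeasurableSpace Ω}

/-! ### Right-continuous versions of closed martingales -/

/-- The dyadic point `k / 2 ^ n`. -/
def dyadic (n k : ℕ) : ℝ≥0 := k / 2 ^ n

/-- The set of all nonnegative dyadic numbers. -/
def dyadicSet : Set ℝ≥0 := {q | ∃ n k, q = dyadic n k}

lemma dyadic_mem (n k : ℕ) : dyadic n k ∈ dyadicSet := ⟨n, k, rfl⟩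

lemma dyadic_strictMono (n : ℕ) : StrictMono (dyadic n) := by
  intro i j hij
  unfold dyadic
  gcongr

lemma dyadic_refine (n m k : ℕ) : dyadic (n + m) (k * 2 ^ m) = dyadic n k := by
  unfold dyadic
  push_cast
  rw [pow_add]
  field_simp

lemma exists_dyadic_eq {q : ℝ≥0} (hq : q ∈ dyadicSet) :
    ∃ n₀, ∀ n ≥ n₀, ∃ j, dyadic n j = q := by
  obtain ⟨n₀, k, rfl⟩ := hq
  refine ⟨n₀, fun n hn => ⟨k * 2 ^ (n - n₀), ?_⟩⟩
  obtain ⟨m, rfl⟩ := Nat.exists_eq_add_of_le hn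
  simp [dyadic_refine]

/-- The smallest dyadic number of level `n` that is larger than `t`. -/
def nextDyadic (t : ℝ≥0) (n : ℕ) : ℝ≥0 := dyadic n (⌊t * 2 ^ n⌋₊ + 1)

lemma lt_nextDyadic (t : ℝ≥0) (n : ℕ) : t < nextDyadic t n := by
  unfold nextDyadic dyadic
  rw [lt_div_iff₀ (by positivity)]
  push_cast
  exact Nat.lt_floor_add_one _

lemma nextDyadic_le (t : ℝ≥0) (n : ℕ) : nextDyadic t n ≤ t + (1 / 2) ^ n := by
  unfold nextDyadic dyadic
  rw [div_le_iff₀ (by positivity), add_mul, ← mul_pow]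
  push_cast
  have := Nat.floor_le (a := t * 2 ^ n) (by positivity)
  simpa using this

lemma tendsto_nextDyadic (t : ℝ≥0) : Tendsto (nextDyadic t) atTop (𝓝 t) := by
  refine tendsto_of_tendsto_of_tendsto_of_le_of_le tendsto_const_nhds ?_
    (fun n => (lt_nextDyadic t n).le) (nextDyadic_le t)
  have : Tendsto (fun n : ℕ => ((1 : ℝ≥0) / 2) ^ n) atTop (𝓝 0) :=
    tendsto_pow_atTop_nhds_zero_of_lt_one (by positivity)
      (by rw [div_lt_one (by norm_num)]; norm_num)
  simpa using this.const_add t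

lemma tendsto_nextDyadic_nhdsWithin (t : ℝ≥0) :
    Tendsto (nextDyadic t) atTop (𝓝[Set.Ioi t ∩ dyadicSet] t) :=
  tendsto_nhdsWithin_iff.2 ⟨tendsto_nextDyadic t,
    Eventually.of_forall fun n => ⟨lt_nextDyadic t n, dyadic_mem _ _⟩⟩

/-- The upcrossings are collected from right to left. Below any `u > t` there is a point with value
above `b`, and between it and `t` one with value below `a`. The induction hypothesis, applied at the
latter, supplies the earlier upcrossings. The level `n` only has to be fine enough for the chosen
points to lie on the grid. -/
lemma upcrossings_dyadic_unbounded {M : ℝ≥0 → Ω → ℝ} {ω : Ω} {a b : ℝ} (hab : a < b) {t : ℝ≥0}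
    (ha : ∃ᶠ s in 𝓝[Set.Ioi t ∩ dyadicSet] t, M s ω < a)
    (hb : ∃ᶠ s in 𝓝[Set.Ioi t ∩ dyadicSet] t, b < M s ω) (K : ℕ) :
    ∀ u ∈ dyadicSet, t < u → ∃ n₀, ∀ n ≥ n₀, ∃ j, dyadic n j = u ∧
      K ≤ upcrossingsBefore a b (fun k => M (dyadic n k)) j ω := by
  have key : ∀ (p : ℝ≥0 → Prop), (∃ᶠ s in 𝓝[Set.Ioi t ∩ dyadicSet] t, p s) → ∀ u > t,
      ∃ s ∈ dyadicSet, t < s ∧ s < u ∧ p s := by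
    intro p hp u hu
    have h1 : ∀ᶠ s in 𝓝[Set.Ioi t ∩ dyadicSet] t, s ∈ Set.Ioi t ∩ dyadicSet ∧ s < u :=
      eventually_mem_nhdsWithin.and (mem_nhdsWithin_of_mem_nhds (Iio_mem_nhds hu))
    obtain ⟨s, hs, h2, h3⟩ := (hp.and_eventually h1).exists
    exact ⟨s, h2.2, h2.1, h3, hs⟩
  induction K with
  | zero =>
    intro u hu _
    obtain ⟨n₀, h⟩ := exists_dyadic_eq hu
    exact ⟨n₀, fun n hn => (h n hn).imp fun j hj => ⟨hj, Nat.zero_le _⟩⟩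
  | succ K ih =>
    intro u hu htu
    obtain ⟨s₂, hs₂, hts₂, hsu, h2⟩ := key _ hb u htu
    obtain ⟨s₁, hs₁, hts₁, hss, h1⟩ := key _ ha s₂ hts₂
    obtain ⟨n₁, hn₁⟩ := ih s₁ hs₁ hts₁
    obtain ⟨n₂, hn₂⟩ := exists_dyadic_eq hs₂
    obtain ⟨n₃, hn₃⟩ := exists_dyadic_eq hu
    refine ⟨max n₁ (max n₂ n₃), fun n hn => ?_⟩
    obtain ⟨j₁, hj₁, hK⟩ := hn₁ n (le_trans (le_max_left _ _) hn)
    obtain ⟨j₂, hj₂⟩ := hn₂ n (le_trans (le_trans (le_max_left _ _) (le_max_right _ _)) hn)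
    obtain ⟨j, hj⟩ := hn₃ n (le_trans (le_trans (le_max_right _ _) (le_max_right _ _)) hn)
    have h12 : j₁ < j₂ := (dyadic_strictMono n).lt_iff_lt.1 (by rw [hj₁, hj₂]; exact hss)
    have h23 : j₂ < j := (dyadic_strictMono n).lt_iff_lt.1 (by rw [hj₂, hj]; exact hsu)
    refine ⟨j, hj, Nat.succ_le_of_lt (hK.trans_lt ?_)⟩
    refine (upcrossingsBefore_lt_of_exists_upcrossing (f := fun k => M (dyadic n k)) (ω := ω) hab
      le_rfl ?_ h12.le ?_).trans_le
      (upcrossingsBefore_mono (f := fun k => M (dyadic n k)) hab (Nat.succ_le_of_lt h23) ω)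
    · simpa [hj₁] using h1
    · simpa [hj₂] using h2

lemma liminf_upcrossings_eq_top {M : ℝ≥0 → Ω → ℝ} {ω : Ω} {a b : ℝ} (hab : a < b) {t : ℝ≥0}
    (ha : ∃ᶠ s in 𝓝[Set.Ioi t ∩ dyadicSet] t, M s ω < a)
    (hb : ∃ᶠ s in 𝓝[Set.Ioi t ∩ dyadicSet] t, b < M s ω) :
    liminf (fun n => upcrossings a b (fun k => M (dyadic n k)) ω) atTop = ⊤ := by
  refine ENNReal.eq_top_of_forall_nnreal_le fun r => ?_
  obtain ⟨K, hK⟩ := exists_nat_ge r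
  obtain ⟨n₀, h⟩ := upcrossings_dyadic_unbounded hab ha hb K _ (dyadic_mem 0 (⌊t * 2 ^ 0⌋₊ + 1))
    (lt_nextDyadic t 0)
  refine le_liminf_of_le (by isBoundedDefault) ?_
  filter_upwards [eventually_ge_atTop n₀] with n hn
  obtain ⟨j, -, hj⟩ := h n hn
  calc (r : ℝ≥0∞) ≤ (K : ℝ≥0∞) := by exact_mod_cast hK
    _ ≤ (upcrossingsBefore a b (fun k => M (dyadic n k)) j ω : ℝ≥0∞) := by exact_mod_cast hj
    _ ≤ _ := le_iSup (fun N => (upcrossingsBefore a b (fun k => M (dyadic n k)) N ω : ℝ≥0∞)) j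

/-- The filtration observed at the dyadic times of level `n`. -/
def dyadicFiltration (𝓕 : Filtration ℝ≥0 mΩ) (n : ℕ) : Filtration ℕ mΩ where
  seq k := 𝓕 (dyadic n k)
  mono' _ _ h := 𝓕.mono ((dyadic_strictMono n).monotone h)
  le' _ := 𝓕.le _

/-- The right limit along dyadic times of the martingale `P[I | 𝓕 t]`. -/
def rightLimitMartingale (P : Measure Ω) (𝓕 : Filtration ℝ≥0 mΩ) (I : Ω → ℝ) (t : ℝ≥0) (ω : Ω) :
    ℝ :=
  limsup (fun n => P[I | 𝓕 (nextDyadic t n)] ω) atTop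

/-- A limsup ignores finitely many terms, so it is measurable with respect to `𝓕 u` for every `u >
t`. Right-continuity of the filtration then lowers this to `𝓕 t`. -/
lemma measurable_rightLimitMartingale {P : Measure Ω} {𝓕 : Filtration ℝ≥0 mΩ}
    (h𝓕 : 𝓕.IsRightContinuous) (I : Ω → ℝ) (t : ℝ≥0) :
    Measurable[𝓕 t] (rightLimitMartingale P 𝓕 I t) := by
  have key : ∀ u > t, Measurable[𝓕 u] (rightLimitMartingale P 𝓕 I t) := by
    intro u hu
    obtain ⟨N, hN⟩ := eventually_atTop.1 ((tendsto_nextDyadic t).eventually (Iio_mem_nhds hu))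
    have : rightLimitMartingale P 𝓕 I t = fun ω =>
        limsup (fun n => P[I | 𝓕 (nextDyadic t (n + N))] ω) atTop := by
      funext ω
      exact (limsup_nat_add (fun n => P[I | 𝓕 (nextDyadic t n)] ω) N).symm
    rw [this]
    refine Measurable.limsup fun n => ?_
    exact (stronglyMeasurable_condExp.measurable).mono
      (𝓕.mono (hN (n + N) (Nat.le_add_left _ _)).le) le_rfl
  intro s hs
  refine Filtration.IsRightContinuous.measurableSet ?_
  rw [Filtration.rightCont_eq]
  simp only [MeasurableSpace.measurableSet_iInf]
  exact fun u hu => key u hu hs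

variable {P : Measure Ω} [IsProbabilityMeasure P] {𝓕 : Filtration ℝ≥0 mΩ}

lemma martingale_dyadic (I : Ω → ℝ) (n : ℕ) :
    Martingale (fun k => P[I | 𝓕 (dyadic n k)]) (dyadicFiltration 𝓕 n) P :=
  martingale_condExp I (dyadicFiltration 𝓕 n) P

/-- Doob's upcrossing inequality gives the bound `(E|I| + |a|) / (b - a)` at every dyadic level and
every horizon; Fatou's lemma passes it to the liminf over the levels. -/
lemma ae_liminf_upcrossings_lt_top {I : Ω → ℝ} (hI : Integrable I P) {a b : ℝ} (hab : a < b) :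
    ∀ᵐ ω ∂P, liminf (fun n => upcrossings a b (fun k => P[I | 𝓕 (dyadic n k)]) ω) atTop < ⊤ := by
  have hmeas : ∀ n, Measurable (upcrossings a b (fun k => P[I | 𝓕 (dyadic n k)])) := fun n =>
    (martingale_dyadic (P := P) (𝓕 := 𝓕) I n).stronglyAdapted.measurable_upcrossings hab
  refine ae_lt_top (.liminf hmeas) (ne_top_of_le_ne_top ?_ (lintegral_liminf_le hmeas))
  set C : ℝ≥0∞ := (∫⁻ ω, ‖I ω‖ₑ ∂P) + ‖a‖ₑ with hC
  have hCt : C ≠ ⊤ := ENNReal.add_ne_top.2 ⟨hI.2.ne, enorm_ne_top⟩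
  have hb : ∀ n, ∫⁻ ω, upcrossings a b (fun k => P[I | 𝓕 (dyadic n k)]) ω ∂P
      ≤ C / ENNReal.ofReal (b - a) := by
    intro n
    rw [ENNReal.le_div_iff_mul_le (by left; simpa using hab) (by left; exact ENNReal.ofReal_ne_top),
      mul_comm]
    refine ((martingale_dyadic (P := P) (𝓕 := 𝓕) I
      n).submartingale.mul_lintegral_upcrossings_le_lintegral_pos_part a b).trans ?_
    refine iSup_le fun N => ?_
    calc ∫⁻ ω, ENNReal.ofReal ((P[I | 𝓕 (dyadic n N)] ω - a)⁺) ∂P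
        ≤ ∫⁻ ω, (‖P[I | 𝓕 (dyadic n N)] ω‖ₑ + ‖a‖ₑ) ∂P := by
          refine lintegral_mono fun ω => ?_
          refine le_trans ?_ (enorm_sub_le (a := P[I | 𝓕 (dyadic n N)] ω) (b := a))
          rw [← ofReal_norm]
          exact ENNReal.ofReal_le_ofReal (by
            rw [Real.norm_eq_abs]; exact sup_le (le_abs_self _) (abs_nonneg _))
      _ = (∫⁻ ω, ‖P[I | 𝓕 (dyadic n N)] ω‖ₑ ∂P) + ‖a‖ₑ := by
          rw [lintegral_add_right _ measurable_const]; simp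
      _ ≤ C := by
          rw [hC]
          gcongr ?_ + _
          simpa [eLpNorm_one_eq_lintegral_enorm] using
            eLpNorm_condExp_le_eLpNorm (μ := P) (m := 𝓕 (dyadic n N)) I le_rfl
  refine ne_top_of_le_ne_top (b := C / ENNReal.ofReal (b - a)) ?_ ?_
  · exact ENNReal.div_ne_top hCt (by simpa using hab)
  · exact liminf_le_of_le (by isBoundedDefault) fun r hr => by
      obtain ⟨n, hn⟩ := hr.exists
      exact hn.trans (hb n)

/-- Doob's maximal inequality, applied to the absolute value written as the submartingale `M ⊔ -M`.
-/
lemma measure_dyadic_exceed_le {I : Ω → ℝ} (n m : ℕ) (ε : ℝ≥0) :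
    ε * P {ω | ∃ k ≤ m, (ε : ℝ) ≤ |P[I | 𝓕 (dyadic n k)] ω|} ≤ ∫⁻ ω, ‖I ω‖ₑ ∂P := by
  have hmart := martingale_dyadic (P := P) (𝓕 := 𝓕) I n
  have hsub := hmart.submartingale.sup hmart.neg.submartingale
  have hnn : (0 : ℕ → Ω → ℝ) ≤ (fun k => P[I | 𝓕 (dyadic n k)]) ⊔
      (-fun k => P[I | 𝓕 (dyadic n k)]) := fun k ω => by
    simpa [abs] using abs_nonneg (P[I | 𝓕 (dyadic n k)] ω)
  have h := maximal_ineq hsub hnn (ε := ε) m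
  have hset : {ω | ∃ k ≤ m, (ε : ℝ) ≤ |P[I | 𝓕 (dyadic n k)] ω|} =
      {ω | (ε : ℝ) ≤ (Finset.range (m + 1)).sup' Finset.nonempty_range_add_one fun k =>
        ((fun k => P[I | 𝓕 (dyadic n k)]) ⊔ (-fun k => P[I | 𝓕 (dyadic n k)])) k ω} := by
    ext ω
    simp only [Set.mem_ofPred_eq, Finset.le_sup'_iff, Finset.mem_range, Nat.lt_succ_iff]
    rfl
  rw [hset]
  refine h.trans ?_
  have hint : Integrable (fun ω => |P[I | 𝓕 (dyadic n m)] ω|) P := integrable_condExp.abs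
  calc _ ≤ ENNReal.ofReal (∫ ω, |P[I | 𝓕 (dyadic n m)] ω| ∂P) :=
        ENNReal.ofReal_le_ofReal (setIntegral_le_integral hint
          (Eventually.of_forall fun ω => abs_nonneg _))
    _ = ∫⁻ ω, ‖P[I | 𝓕 (dyadic n m)] ω‖ₑ ∂P := by
        rw [ofReal_integral_eq_lintegral_ofReal hint (Eventually.of_forall fun ω => abs_nonneg _)]
        refine lintegral_congr fun ω => ?_
        rw [← Real.norm_eq_abs, ofReal_norm]
    _ ≤ _ := by
        simpa [eLpNorm_one_eq_lintegral_enorm] using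
            eLpNorm_condExp_le_eLpNorm (μ := P) (m := 𝓕 (dyadic n m)) I le_rfl

/-- The grids `{k / 2 ^ n : k ≤ 4 ^ n}` increase to all dyadic numbers, and the maximal inequality
is uniform in the grid. Exceeding the level `K + 1` somewhere thus has probability at most `E|I| /
(K + 1)`. -/
lemma ae_bounded_dyadic {I : Ω → ℝ} (hI : Integrable I P) :
    ∀ᵐ ω ∂P, ∃ C : ℝ, ∀ q ∈ dyadicSet, |P[I | 𝓕 q] ω| ≤ C := by
  set A : ℕ → ℕ → Set Ω := fun K n =>
    {ω | ∃ k ≤ 4 ^ n, (((K + 1 : ℕ) : ℝ≥0) : ℝ) ≤ |P[I | 𝓕 (dyadic n k)] ω|} with hA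
  have hmono : ∀ K, Monotone (A K) := fun K => monotone_nat_of_le_succ fun n ω => by
    rintro ⟨k, hk, h⟩
    refine ⟨k * 2 ^ 1, ?_, by rwa [dyadic_refine]⟩
    rw [pow_succ]; omega
  have hAK : ∀ K : ℕ, P (⋃ n, A K n) ≤ (∫⁻ ω, ‖I ω‖ₑ ∂P) / ((K + 1 : ℕ) : ℝ≥0∞) := by
    intro K
    rw [(hmono K).measure_iUnion]
    refine iSup_le fun n => ?_
    rw [ENNReal.le_div_iff_mul_le (by left; simp) (by left; exact ENNReal.natCast_ne_top _),
      mul_comm]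
    exact_mod_cast measure_dyadic_exceed_le (P := P) (𝓕 := 𝓕) (I := I) n (4 ^ n)
      ((K + 1 : ℕ) : ℝ≥0)
  have hzero : P (⋂ K, ⋃ n, A K n) = 0 := by
    refine le_antisymm (ge_of_tendsto' (x := atTop)
      (f := fun K : ℕ => (∫⁻ ω, ‖I ω‖ₑ ∂P) / ((K + 1 : ℕ) : ℝ≥0∞)) ?_
      fun K => (measure_mono (Set.iInter_subset _ K)).trans (hAK K)) zero_le
    exact (ENNReal.Tendsto.const_div (ENNReal.tendsto_nat_nhds_top.comp (tendsto_add_atTop_nat 1))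
      (Or.inr hI.2.ne)).trans (by simp)
  have hae : ∀ᵐ ω ∂P, ω ∉ ⋂ K, ⋃ n, A K n := measure_eq_zero_iff_ae_notMem.1 hzero
  filter_upwards [hae] with ω hω
  simp only [Set.mem_iInter, Set.mem_iUnion, not_forall, not_exists] at hω
  obtain ⟨K, hK⟩ := hω
  refine ⟨((K + 1 : ℕ) : ℝ), fun q hq => ?_⟩
  by_contra! hlt
  obtain ⟨n₀, k, rfl⟩ := hq
  -- Refining by `k` further levels brings the index below the cap, since `k * 2 ^ k ≤ 4 ^ k`.
  refine hK (n₀ + k) ⟨k * 2 ^ k, ?_, ?_⟩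
  · calc k * 2 ^ k ≤ 2 ^ k * 2 ^ k := Nat.mul_le_mul_right _ Nat.lt_two_pow_self.le
      _ = 4 ^ k := by rw [← mul_pow]; norm_num
      _ ≤ 4 ^ (n₀ + k) := Nat.pow_le_pow_right (by norm_num) (by omega)
  · rw [dyadic_refine]; simpa using hlt.le

/-- A bounded function without a limit oscillates across some rational interval, which would produce
infinitely many upcrossings. Countably many rational pairs give one null set that serves all `t` at
once. -/
lemma ae_tendsto_dyadic_right {I : Ω → ℝ} (hI : Integrable I P) :
    ∀ᵐ ω ∂P, ∀ t : ℝ≥0, ∃ l : ℝ,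
      Tendsto (fun q => P[I | 𝓕 q] ω) (𝓝[Set.Ioi t ∩ dyadicSet] t) (𝓝 l) := by
  have h1 : ∀ᵐ ω ∂P, ∀ a b : ℚ, (a : ℝ) < b → liminf (fun n => upcrossings (a : ℝ) b
      (fun k => P[I | 𝓕 (dyadic n k)]) ω) atTop < ⊤ := by
    rw [ae_all_iff]; intro a; rw [ae_all_iff]; intro b
    by_cases hab : (a : ℝ) < b
    · filter_upwards [ae_liminf_upcrossings_lt_top (𝓕 := 𝓕) hI hab] with ω h _ using h
    · exact Eventually.of_forall fun ω h => absurd h hab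
  filter_upwards [h1, ae_bounded_dyadic (𝓕 := 𝓕) hI] with ω hup ⟨C, hC⟩ t
  have hev : ∀ᶠ q in 𝓝[Set.Ioi t ∩ dyadicSet] t, |P[I | 𝓕 q] ω| ≤ C := by
    filter_upwards [self_mem_nhdsWithin] with q hq using hC q hq.2
  refine tendsto_of_no_upcrossings (s := Set.range ((↑) : ℚ → ℝ)) Rat.denseRange_cast ?_
    ⟨C, ?_⟩ ⟨-C, ?_⟩
  · rintro _ ⟨a, rfl⟩ _ ⟨b, rfl⟩ hab ⟨ha, hb⟩
    exact (hup a b hab).ne (liminf_upcrossings_eq_top (M := fun q => P[I | 𝓕 q]) hab ha hb)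
  · exact eventually_map.2 (hev.mono fun q hq => (abs_le.1 hq).2)
  · exact eventually_map.2 (hev.mono fun q hq => (abs_le.1 hq).1)

lemma ae_tendsto_rightLimitMartingale {I : Ω → ℝ} (hI : Integrable I P) :
    ∀ᵐ ω ∂P, ∀ t : ℝ≥0, Tendsto (fun q => P[I | 𝓕 q] ω) (𝓝[Set.Ioi t ∩ dyadicSet] t)
      (𝓝 (rightLimitMartingale P 𝓕 I t ω)) := by
  filter_upwards [ae_tendsto_dyadic_right (𝓕 := 𝓕) hI] with ω h t
  obtain ⟨l, hl⟩ := h t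
  have : rightLimitMartingale P 𝓕 I t ω = l :=
    (hl.comp (tendsto_nextDyadic_nhdsWithin t)).limsup_eq
  rwa [this]

/-- Right limits are automatically right-continuous: if the dyadic values on `(t, u)` are `ε /
2`-close to the value at `t`, so are their limits at each `s` in `(t, u)`. -/
lemma ae_rightContinuous_rightLimitMartingale {I : Ω → ℝ} (hI : Integrable I P) :
    ∀ᵐ ω ∂P, ∀ t : ℝ≥0,
      ContinuousWithinAt (fun s => rightLimitMartingale P 𝓕 I s ω) (Set.Ioi t) t := by
  filter_upwards [ae_tendsto_rightLimitMartingale (𝓕 := 𝓕) hI] with ω h t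
  rw [ContinuousWithinAt, Metric.tendsto_nhds]
  intro ε hε
  have h1 := (Metric.tendsto_nhds.1 (h t)) (ε / 2) (by positivity)
  obtain ⟨u, hu, hsub⟩ : ∃ u > t, Set.Ioo t u ∩ dyadicSet ⊆
      {q | dist (P[I | 𝓕 q] ω) (rightLimitMartingale P 𝓕 I t ω) < ε / 2} := by
    rw [eventually_iff, nhdsWithin_inter', mem_inf_principal] at h1
    obtain ⟨u, hu, hs⟩ := (mem_nhdsGT_iff_exists_Ioo_subset).1 h1
    exact ⟨u, hu, fun q hq => hs hq.1 hq.2⟩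
  filter_upwards [Ioo_mem_nhdsGT hu] with s hs
  have hle : dist (rightLimitMartingale P 𝓕 I s ω) (rightLimitMartingale P 𝓕 I t ω) ≤ ε / 2 := by
    refine le_of_tendsto (((h s).comp (tendsto_nextDyadic_nhdsWithin s)).dist tendsto_const_nhds) ?_
    filter_upwards [(tendsto_nextDyadic s).eventually (Iio_mem_nhds hs.2)] with n hn
    exact (hsub ⟨⟨hs.1.trans (lt_nextDyadic s n), hn⟩, dyadic_mem _ _⟩).le
  linarith

/-- Conditional expectations of one integrable variable are uniformly integrable, so almost sure
convergence is convergence in `L¹`. The integrals over a set of `𝓕 t` do not depend on `n`, which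
identifies the limit. -/
lemma rightLimitMartingale_ae_eq (h𝓕 : 𝓕.IsRightContinuous) {I : Ω → ℝ} (hI : Integrable I P)
    (t : ℝ≥0) : rightLimitMartingale P 𝓕 I t =ᵐ[P] P[I | 𝓕 t] := by
  set N := rightLimitMartingale P 𝓕 I t with hN
  set f : ℕ → Ω → ℝ := fun n => P[I | 𝓕 (nextDyadic t n)] with hf
  have hmeas : Measurable[𝓕 t] N := measurable_rightLimitMartingale h𝓕 I t
  have hUI : UniformIntegrable f 1 P := hI.uniformIntegrable_condExp fun n => 𝓕.le _
  have hlim : ∀ᵐ ω ∂P, Tendsto (fun n => f n ω) atTop (𝓝 (N ω)) := by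
    filter_upwards [ae_tendsto_rightLimitMartingale (𝓕 := 𝓕) hI] with ω h
    exact (h t).comp (tendsto_nextDyadic_nhdsWithin t)
  have hNL : MemLp N 1 P := by
    obtain ⟨C, hC⟩ := hUI.2.2
    refine ⟨(hmeas.mono (𝓕.le t) le_rfl).aestronglyMeasurable, ?_⟩
    refine (Lp.eLpNorm_lim_le_liminf_eLpNorm (fun n => hUI.1 n) N hlim).trans_lt ?_
    refine lt_of_le_of_lt (liminf_le_of_le (by isBoundedDefault) fun r hr => ?_)
      (ENNReal.coe_lt_top (r := C))
    obtain ⟨n, hn⟩ := hr.exists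
    exact hn.trans (hC n)
  have hL1 := tendsto_Lp_finite_of_tendsto_ae le_rfl ENNReal.one_ne_top
    (fun n => hUI.1 n) hNL hUI.2.1 hlim
  refine ae_eq_condExp_of_forall_setIntegral_eq (𝓕.le t) hI
    (fun s _ _ => (memLp_one_iff_integrable.1 hNL).integrableOn) (fun s hs _ => ?_)
    hmeas.stronglyMeasurable.aestronglyMeasurable
  have h1 : Tendsto (fun n => ∫ ω in s, f n ω ∂P) atTop (𝓝 (∫ ω in s, N ω ∂P)) :=
    tendsto_setIntegral_of_L1' N (memLp_one_iff_integrable.1 hNL).aestronglyMeasurable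
      (Eventually.of_forall fun n => integrable_condExp) hL1 s
  refine tendsto_nhds_unique h1 (tendsto_const_nhds.congr fun n => ?_)
  exact (setIntegral_condExp (𝓕.le _) hI (𝓕.mono (lt_nextDyadic t n).le s hs)).symm

end

section

variable {Ω : Type*} {mΩ : MeasurableSpace Ω}

/-! ### Pathwise convergence of Itô sums -/

/-- The step function with value `y (π (i + 1))` on `(π i, π (i + 1)]`. -/
def rightStep (y : ℝ≥0 → ℝ) (n : ℕ) (π : ℕ → ℝ≥0) (u : ℝ) : ℝ :=
  ∑ i ∈ Finset.range n, (Set.Ioc (π i : ℝ) (π (i + 1))).indicator (fun _ => y (π (i + 1))) u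

lemma measurable_rightStep (y : ℝ≥0 → ℝ) (n : ℕ) (π : ℕ → ℝ≥0) : Measurable (rightStep y n π) :=
  Finset.measurable_fun_sum _ fun _ _ => measurable_const.indicator measurableSet_Ioc

lemma exists_partition_mem {t : ℝ≥0} {n : ℕ} {π : ℕ → ℝ≥0} (hπ : IsPartition t n π) {u : ℝ}
    (hu : u ∈ Set.Ioc (0 : ℝ) t) : ∃ i < n, u ∈ Set.Ioc (π i : ℝ) (π (i + 1)) := by
  classical
  have hex : ∃ j, u ≤ π j := ⟨n, by rw [hπ.finish]; exact hu.2⟩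
  have h0 : Nat.find hex ≠ 0 := by
    intro h
    have := Nat.find_spec hex
    rw [h, hπ.start] at this
    exact absurd hu.1 (not_lt.2 (by simpa using this))
  obtain ⟨i, hi⟩ := Nat.exists_eq_succ_of_ne_zero h0
  have hle : Nat.find hex ≤ n := Nat.find_min' hex (by rw [hπ.finish]; exact hu.2)
  refine ⟨i, by omega, ?_, ?_⟩
  · exact not_le.1 (Nat.find_min hex (by omega))
  · have := Nat.find_spec hex
    rwa [hi] at this

lemma rightStep_eq {n : ℕ} {π : ℕ → ℝ≥0} (hπ : Monotone π) (y : ℝ≥0 → ℝ) {u : ℝ} {i : ℕ}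
    (hi : i < n) (hu : u ∈ Set.Ioc (π i : ℝ) (π (i + 1))) :
    rightStep y n π u = y (π (i + 1)) := by
  unfold rightStep
  rw [Finset.sum_eq_single_of_mem i (Finset.mem_range.2 hi), Set.indicator_of_mem hu]
  intro j _ hji
  refine Set.indicator_of_notMem (fun hj => ?_) _
  rcases lt_or_gt_of_ne hji with h | h
  · have : (π (j + 1) : ℝ) ≤ π i := by exact_mod_cast hπ h
    linarith [hu.1, hj.2]
  · have : (π (i + 1) : ℝ) ≤ π j := by exact_mod_cast hπ h
    linarith [hu.2, hj.1]

lemma step_le_mesh {n : ℕ} {π : ℕ → ℝ≥0} {i : ℕ} (hi : i < n) : π (i + 1) - π i ≤ mesh n π :=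
  Finset.le_sup (f := fun i => π (i + 1) - π i) (Finset.mem_range.2 hi)

/-- The step function samples `y` at a point of `[u, u + mesh]`, hence right-continuity is enough.
-/
lemma tendsto_rightStep {y : ℝ≥0 → ℝ} {t : ℝ≥0} {n : ℕ → ℕ} {π : ℕ → ℕ → ℝ≥0}
    (hπ : ∀ k, IsPartition t (n k) (π k)) (hmesh : Tendsto (fun k => mesh (n k) (π k)) atTop (𝓝 0))
    {u : ℝ≥0} (hu0 : 0 < u) (hut : u ≤ t) (hy : ContinuousWithinAt y (Set.Ioi u) u) :
    Tendsto (fun k => rightStep y (n k) (π k) u) atTop (𝓝 (y u)) := by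
  have hex : ∀ k, ∃ v : ℝ≥0, u ≤ v ∧ v ≤ u + mesh (n k) (π k) ∧
      rightStep y (n k) (π k) u = y v := by
    intro k
    obtain ⟨i, hi, hmem⟩ := exists_partition_mem (hπ k) (u := u)
      ⟨by exact_mod_cast hu0, by exact_mod_cast hut⟩
    refine ⟨π k (i + 1), by exact_mod_cast hmem.2, ?_, rightStep_eq (hπ k).mono y hi hmem⟩
    have h1 := step_le_mesh (π := π k) hi
    have h2 : π k i ≤ u := by exact_mod_cast hmem.1.le
    calc π k (i + 1) ≤ π k i + (π k (i + 1) - π k i) := le_add_tsub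
      _ ≤ _ := add_le_add h2 h1
  choose v hv1 hv2 hv3 using hex
  simp_rw [hv3]
  have hvt : Tendsto v atTop (𝓝[≥] u) := by
    refine tendsto_nhdsWithin_iff.2 ⟨?_, Eventually.of_forall hv1⟩
    refine tendsto_of_tendsto_of_tendsto_of_le_of_le tendsto_const_nhds ?_ hv1 hv2
    simpa using hmesh.const_add u
  exact (continuousWithinAt_Ioi_iff_Ici.1 hy).tendsto.comp hvt

/-- Abel summation turns left-endpoint sums against `dy` into sums of `y` at right endpoints against
`dξ`. -/
lemma sum_mul_sub_eq (ξ y : ℕ → ℝ) (n : ℕ) :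
    ∑ i ∈ Finset.range n, ξ i * (y (i + 1) - y i) =
      ξ n * y n - ξ 0 * y 0 - ∑ i ∈ Finset.range n, y (i + 1) * (ξ (i + 1) - ξ i) := by
  induction n with
  | zero => simp
  | succ n ih => rw [Finset.sum_range_succ, ih, Finset.sum_range_succ]; ring

lemma integral_rightStep_mul {d : ℝ → ℝ} (hd : Continuous d) (y : ℝ≥0 → ℝ) {t : ℝ≥0} {n : ℕ}
    {π : ℕ → ℝ≥0} (hπ : IsPartition t n π) :
    ∫ u in (0 : ℝ)..t, rightStep y n π u * d u =
      ∑ i ∈ Finset.range n, y (π (i + 1)) * ∫ u in (π i : ℝ)..π (i + 1), d u := by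
  have hmono : Monotone fun i => (π i : ℝ) := fun i j h => by exact_mod_cast hπ.mono h
  have hbd : ∀ i < n, Set.EqOn (fun u => rightStep y n π u * d u)
      (fun u => y (π (i + 1)) * d u) (Set.uIoc (π i : ℝ) (π (i + 1))) := by
    intro i hi u hu
    rw [Set.uIoc_of_le (hmono (Nat.le_succ i))] at hu
    simp only [rightStep_eq hπ.mono y hi hu]
  have h := intervalIntegral.sum_integral_adjacent_intervals (μ := volume)
    (f := fun u => rightStep y n π u * d u) (a := fun i => (π i : ℝ)) (n := n) fun i hi =>
      (IntervalIntegrable.congr ((hbd i hi).symm)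
        ((hd.intervalIntegrable _ _).const_mul (y (π (i + 1)))))
  simp only [hπ.start, hπ.finish, NNReal.coe_zero] at h
  rw [← h]
  refine Finset.sum_congr rfl fun i hi => ?_
  rw [← intervalIntegral.integral_const_mul]
  exact intervalIntegral.integral_congr_ae (Eventually.of_forall fun u hu =>
    hbd i (Finset.mem_range.1 hi) hu)

/-- After Abel summation the Itô sum is exactly a boundary term plus the integral of a
right-endpoint step function against `d`. Dominated convergence finishes, for one fixed path. -/
lemma tendsto_itoSum {c d : ℝ → ℝ} (hc : ∀ t, HasDerivAt c (-d t) t) (hd : Continuous d)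
    {Y : ℝ≥0 → Ω → ℝ} {ω : Ω} {t : ℝ≥0} {K : ℝ} (hY0 : Y 0 ω = 0) (hbd : ∀ s ≤ t, |Y s ω| ≤ K)
    (hY : ∀ s < t, ContinuousWithinAt (fun s => Y s ω) (Set.Ioi s) s)
    {n : ℕ → ℕ} {π : ℕ → ℕ → ℝ≥0} (hπ : ∀ k, IsPartition t (n k) (π k))
    (hmesh : Tendsto (fun k => mesh (n k) (π k)) atTop (𝓝 0)) :
    Tendsto (fun k => itoSum c Y (n k) (π k) ω) atTop
      (𝓝 (c t * Y t ω + ∫ u in (0 : ℝ)..t, path Y ω u * d u)) := by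
  set y : ℝ≥0 → ℝ := fun s => Y s ω with hy
  have hsum : ∀ k, itoSum c Y (n k) (π k) ω =
      c t * Y t ω + ∫ u in (0 : ℝ)..t, rightStep y (n k) (π k) u * d u := by
    intro k
    have h := sum_mul_sub_eq (fun i => c (π k i)) (fun i => y (π k i)) (n k)
    unfold itoSum
    rw [integral_rightStep_mul hd y (hπ k)]
    simp only [(hπ k).start, (hπ k).finish, hy, hY0] at h ⊢
    rw [h, mul_zero, sub_zero, sub_eq_add_neg, ← Finset.sum_neg_distrib]
    congr 1
    refine Finset.sum_congr rfl fun i _ => ?_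
    have : ∫ u in (π k i : ℝ)..π k (i + 1), -d u = c (π k (i + 1)) - c (π k i) :=
      intervalIntegral.integral_eq_sub_of_hasDerivAt (fun u _ => hc u)
        (hd.neg.intervalIntegrable _ _)
    rw [intervalIntegral.integral_neg] at this
    rw [← this]; ring
  simp_rw [hsum]
  refine Tendsto.const_add _ ?_
  refine intervalIntegral.tendsto_integral_filter_of_dominated_convergence
    (fun u => K * |d u|) (Eventually.of_forall fun k =>
      ((measurable_rightStep y (n k) (π k)).mul hd.measurable).aestronglyMeasurable)
    (Eventually.of_forall fun k => Eventually.of_forall fun u hu => ?_)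
    ((continuous_const.mul hd.abs).intervalIntegrable _ _)
    -- The endpoint `t` is discarded because right-continuity is available only before `t`.
    ((by simp [ae_iff] : ∀ᵐ u : ℝ, u ≠ t).mono fun u hne hu => ?_)
  · rw [Set.uIoc_of_le t.coe_nonneg] at hu
    obtain ⟨i, hi, hmem⟩ := exists_partition_mem (hπ k) hu
    rw [rightStep_eq (hπ k).mono y hi hmem, norm_mul, Real.norm_eq_abs, Real.norm_eq_abs]
    refine mul_le_mul_of_nonneg_right (hbd _ ?_) (abs_nonneg _)
    rw [← (hπ k).finish]
    exact (hπ k).mono hi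
  · rw [Set.uIoc_of_le t.coe_nonneg] at hu
    refine Tendsto.mul_const _ ?_
    lift u to ℝ≥0 using hu.1.le
    have h1 : u < t := lt_of_le_of_ne (by exact_mod_cast hu.2) (by exact_mod_cast hne)
    simpa [path] using tendsto_rightStep (y := y) hπ hmesh (by exact_mod_cast hu.1) h1.le (hY u h1)

/-- Partitions with mesh tending to zero exist. -/
lemma exists_partitions (t : ℝ≥0) : ∃ (n : ℕ → ℕ) (π : ℕ → ℕ → ℝ≥0),
    (∀ k, IsPartition t (n k) (π k)) ∧ Tendsto (fun k => mesh (n k) (π k)) atTop (𝓝 0) := by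
  refine ⟨fun k => k + 1, fun k i => min (i * (t / (k + 1))) t, fun k => ⟨?_, by simp, ?_⟩, ?_⟩
  · intro i j hij
    dsimp only
    gcongr
  · refine min_eq_right (le_of_eq ?_)
    push_cast
    rw [mul_div_cancel₀ t (by positivity)]
  · have hlim : Tendsto (fun k : ℕ => t / ((k : ℝ≥0) + 1)) atTop (𝓝 0) := by
      rw [← NNReal.tendsto_coe]
      push_cast
      have := (tendsto_one_div_add_atTop_nhds_zero_nat (𝕜 := ℝ)).const_mul (t : ℝ)
      simpa [div_eq_mul_inv] using this
    refine tendsto_of_tendsto_of_tendsto_of_le_of_le tendsto_const_nhds hlim (fun _ => zero_le)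
      fun k => ?_
    refine Finset.sup_le fun i _ => ?_
    rw [tsub_le_iff_left]
    push_cast
    rw [add_mul, one_mul, ← min_add_add_right]
    exact min_le_min le_rfl le_self_add

variable {P : Measure Ω}

/-- The Itô integral of a `C¹` function against an adapted right-continuous bounded process, by
partial summation. -/
lemma isStochIntegral_of_paths [IsProbabilityMeasure P] {c d : ℝ → ℝ}
    (hc : ∀ t, HasDerivAt c (-d t) t) (hd : Continuous d)
    {Y : ℝ≥0 → Ω → ℝ} {t : ℝ≥0} (hmeas : ∀ s ≤ t, AEStronglyMeasurable (Y s) P)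
    (hY : ∀ᵐ ω ∂P, Y 0 ω = 0 ∧ (∃ K, ∀ s ≤ t, |Y s ω| ≤ K) ∧
      ∀ s < t, ContinuousWithinAt (fun s => Y s ω) (Set.Ioi s) s) :
    IsStochIntegral P c Y t (fun ω => c t * Y t ω + ∫ u in (0 : ℝ)..t, path Y ω u * d u) := by
  intro n π hπ hmesh
  refine tendstoInMeasure_of_tendsto_ae (fun k => ?_) ?_
  · have hle : ∀ i ≤ n k, π k i ≤ t := fun i hi => (hπ k).finish ▸ (hπ k).mono hi
    refine Finset.aestronglyMeasurable_fun_sum _ fun i hi => ?_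
    have hi' := Finset.mem_range.1 hi
    exact ((hmeas _ (hle _ hi')).sub (hmeas _ (hle _ hi'.le))).const_mul _
  · filter_upwards [hY] with ω ⟨h0, ⟨K, hK⟩, hr⟩
    exact tendsto_itoSum hc hd h0 hK hr hπ hmesh

lemma isStochIntegral_stochIntegral {ξ : ℝ → ℝ} {Y : ℝ≥0 → Ω → ℝ} {t : ℝ≥0} {I : Ω → ℝ}
    (h : IsStochIntegral P ξ Y t I) : IsStochIntegral P ξ Y t (stochIntegral P ξ Y t) := by
  have hex : ∃ I, IsStochIntegral P ξ Y t I := ⟨I, h⟩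
  rw [stochIntegral, dif_pos hex]
  exact hex.choose_spec

lemma stochIntegral_ae_eq {ξ : ℝ → ℝ} {Y : ℝ≥0 → Ω → ℝ} {t : ℝ≥0} {I : Ω → ℝ}
    (h : IsStochIntegral P ξ Y t I) : stochIntegral P ξ Y t =ᵐ[P] I := by
  obtain ⟨n, π, hπ, hmesh⟩ := exists_partitions t
  exact tendstoInMeasure_ae_unique (isStochIntegral_stochIntegral h n π hπ hmesh) (h n π hπ hmesh)

end

section

/-! ### Interval integrals and absolutely continuous functions -/

lemma absolutelyContinuousOnInterval_congr {f g : ℝ → ℝ} {a b : ℝ}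
    (hf : AbsolutelyContinuousOnInterval f a b) (h : Set.EqOn f g (Set.uIcc a b)) :
    AbsolutelyContinuousOnInterval g a b := by
  rw [absolutelyContinuousOnInterval_iff] at hf ⊢
  intro ε hε
  obtain ⟨δ, hδ, H⟩ := hf ε hε
  refine ⟨δ, hδ, fun E hE hlt => ?_⟩
  refine (Finset.sum_congr rfl fun i hi => ?_).trans_lt (H E hE hlt)
  rw [h (hE.1 i hi).1, h (hE.1 i hi).2]

lemma tendsto_intervalIntegral_left {f : ℝ → ℝ} {a b : ℝ} (hab : a < b)
    (hf : IntervalIntegrable f volume a b) :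
    Tendsto (fun s => ∫ t in a..s, f t) (𝓝[<] b) (𝓝 (∫ t in a..b, f t)) := by
  have h := intervalIntegral.continuousOn_primitive_interval
    (by rwa [Set.uIcc_of_le hab.le, integrableOn_Icc_iff_integrableOn_Ioc,
      ← intervalIntegrable_iff_integrableOn_Ioc_of_le hab.le] : IntegrableOn f (Set.uIcc a b) volume)
  rw [Set.uIcc_of_le hab.le] at h
  refine (h b (Set.right_mem_Icc.2 hab.le)).tendsto.mono_left ?_
  rw [← nhdsWithin_Ioo_eq_nhdsLT hab]
  exact nhdsWithin_mono _ Set.Ioo_subset_Icc_self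

lemma intervalIntegrable_of_forall_lt {f : ℝ → ℝ} {T C : ℝ} (hT : 0 < T) (hf0 : ∀ t, 0 ≤ f t)
    (hf : ∀ s ∈ Set.Ico 0 T, IntervalIntegrable f volume 0 s)
    (hC : ∀ s ∈ Set.Ico 0 T, ∫ t in (0 : ℝ)..s, f t ≤ C) : IntervalIntegrable f volume 0 T := by
  rw [intervalIntegrable_iff_integrableOn_Ioc_of_le hT.le]
  have hs : ∀ n : ℕ, T - T / (n + 1) ∈ Set.Ico 0 T := fun n => by
    have h1 : T / ((n : ℝ) + 1) ≤ T := div_le_self hT.le (by linarith [n.cast_nonneg (α := ℝ)])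
    have h2 : 0 < T / ((n : ℝ) + 1) := by positivity
    constructor <;> linarith
  refine integrableOn_Ioc_of_intervalIntegral_norm_bounded_right (l := atTop) (I := C)
    (b := fun n : ℕ => T - T / (n + 1)) (fun n => ?_) ?_ (Eventually.of_forall fun n => ?_)
  · exact (intervalIntegrable_iff_integrableOn_Ioc_of_le (hs n).1).1 (hf _ (hs n))
  · have := (tendsto_one_div_add_atTop_nhds_zero_nat (𝕜 := ℝ)).const_mul T
    simpa [div_eq_mul_inv] using this.const_sub T
  · rw [← intervalIntegral.integral_of_le (hs n).1]
    simp_rw [Real.norm_of_nonneg (hf0 _)]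
    exact hC _ (hs n)

lemma intervalIntegrable_sub_left {f : ℝ → ℝ} {s T : ℝ} (hs : s ∈ Set.Icc 0 T)
    (hf : IntervalIntegrable f volume 0 T) : IntervalIntegrable f volume 0 s :=
  hf.mono_set (by
    rw [Set.uIcc_of_le hs.1, Set.uIcc_of_le (hs.1.trans hs.2)]
    exact Set.Icc_subset_Icc_right hs.2)

lemma intervalIntegrable_sub_right {f : ℝ → ℝ} {s T : ℝ} (hs : s ∈ Set.Icc 0 T)
    (hf : IntervalIntegrable f volume 0 T) : IntervalIntegrable f volume s T :=
  hf.mono_set (by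
    rw [Set.uIcc_of_le hs.2, Set.uIcc_of_le (hs.1.trans hs.2)]
    exact Set.Icc_subset_Icc_left hs.1)

/-- Cauchy–Schwarz, read off from the nonnegative variance of `f` about its mean `I / (b - a)`. -/
lemma sq_integral_le {f : ℝ → ℝ} {a b : ℝ} (hab : a ≤ b) (hf : IntervalIntegrable f volume a b)
    (hf2 : IntervalIntegrable (fun t => f t ^ 2) volume a b) :
    (∫ t in a..b, f t) ^ 2 ≤ (b - a) * ∫ t in a..b, f t ^ 2 := by
  rcases hab.eq_or_lt with rfl | hab
  · simp
  set I := ∫ t in a..b, f t with hI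
  have hL : 0 < b - a := sub_pos.2 hab
  have h : 0 ≤ ∫ t in a..b, (f t - I / (b - a)) ^ 2 :=
    intervalIntegral.integral_nonneg hab.le fun _ _ => sq_nonneg _
  have heq : ∫ t in a..b, (f t - I / (b - a)) ^ 2 = (∫ t in a..b, f t ^ 2) - I ^ 2 / (b - a) := by
    have : ∀ t, (f t - I / (b - a)) ^ 2 = f t ^ 2 - 2 * (I / (b - a)) * f t + (I / (b - a)) ^ 2 :=
      fun t => by ring
    simp_rw [this]
    rw [intervalIntegral.integral_add (hf2.sub (hf.const_mul _)) (by simp),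
      intervalIntegral.integral_sub hf2 (hf.const_mul _), intervalIntegral.integral_const_mul,
      intervalIntegral.integral_const, ← hI, smul_eq_mul]
    field_simp
    ring
  rw [heq, sub_nonneg, div_le_iff₀ hL] at h
  linarith

lemma intervalIntegrable_of_sq {f : ℝ → ℝ} {a b : ℝ}
    (hm : AEStronglyMeasurable f (volume.restrict (Set.uIoc a b)))
    (hf2 : IntervalIntegrable (fun t => f t ^ 2) volume a b) : IntervalIntegrable f volume a b := by
  refine IntervalIntegrable.mono_fun' (g := fun t => 1 + f t ^ 2)
    (intervalIntegrable_const.add hf2) hm (Eventually.of_forall fun t => ?_)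
  simp only [Real.norm_eq_abs]
  rw [← sq_abs]
  nlinarith [sq_nonneg (|f t| - 1), abs_nonneg (f t)]

lemma intervalIntegrable_mul_of_sq {f g : ℝ → ℝ} {a b : ℝ}
    (hfm : AEStronglyMeasurable f (volume.restrict (Set.uIoc a b)))
    (hgm : AEStronglyMeasurable g (volume.restrict (Set.uIoc a b)))
    (hf : IntervalIntegrable (fun t => f t ^ 2) volume a b)
    (hg : IntervalIntegrable (fun t => g t ^ 2) volume a b) :
    IntervalIntegrable (fun t => f t * g t) volume a b := by
  refine IntervalIntegrable.mono_fun' (g := fun t => f t ^ 2 + g t ^ 2)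
    (hf.add hg) (hfm.mul hgm) (Eventually.of_forall fun t => ?_)
  simp only [Real.norm_eq_abs]
  refine abs_le.2 ⟨?_, ?_⟩ <;> nlinarith [sq_nonneg (f t + g t), sq_nonneg (f t - g t)]

lemma intervalIntegrable_bounded_mul {f g : ℝ → ℝ} {T K : ℝ} (hT : 0 ≤ T)
    (hfm : AEStronglyMeasurable f (volume.restrict (Set.uIoc 0 T)))
    (hK : ∀ t ∈ Set.Icc 0 T, |f t| ≤ K) (hg : IntervalIntegrable g volume 0 T) :
    IntervalIntegrable (fun t => f t * g t) volume 0 T := by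
  refine IntervalIntegrable.mono_fun' (g := fun t => K * |g t|)
    (hg.abs.const_mul K) (hfm.mul hg.def'.aestronglyMeasurable) ?_
  refine (ae_restrict_mem measurableSet_uIoc).mono fun t ht => ?_
  rw [Set.uIoc_of_le hT] at ht
  simp only [norm_mul, Real.norm_eq_abs]
  exact mul_le_mul_of_nonneg_right (hK t ⟨ht.1.le, ht.2⟩) (abs_nonneg _)

/-- An absolutely continuous function vanishing at the end of the interval. -/
lemma sq_le_of_finish {x : ℝ → ℝ} {T : ℝ} (hx : AbsolutelyContinuousOnInterval x 0 T) (hxT : x T = 0)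
    (hx2 : IntervalIntegrable (fun t => deriv x t ^ 2) volume 0 T) {s : ℝ} (hs : s ∈ Set.Icc 0 T) :
    x s ^ 2 ≤ (T - s) * ∫ t in s..T, deriv x t ^ 2 := by
  have hsub : Set.uIcc s T ⊆ Set.uIcc 0 T := by
    rw [Set.uIcc_of_le hs.2, Set.uIcc_of_le (hs.1.trans hs.2)]
    exact Set.Icc_subset_Icc_left hs.1
  have h1 := (hx.mono hsub).integral_deriv_eq_sub
  have h2 := sq_integral_le hs.2 (hx.mono hsub).intervalIntegrable_deriv (hx2.mono_set hsub)
  rw [h1, hxT] at h2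
  simpa using h2

/-! ### The linear-quadratic problem, path by path -/

/-- The data `c = sinh (ν (T - t))` (or `T - t`) and `d = -c'`. -/
structure IsRiccatiKernel (T ν : ℝ) (c d : ℝ → ℝ) : Prop where
  pos : 0 < T
  deriv_c : ∀ t, HasDerivAt c (-d t) t
  deriv_d : ∀ t, HasDerivAt d (-(ν ^ 2 * c t)) t
  c_finish : c T = 0
  d_lower : ∃ m > 0, ∀ t, m ≤ d t

namespace IsRiccatiKernel

variable {T ν : ℝ} {c d : ℝ → ℝ}

lemma continuous_c (h : IsRiccatiKernel T ν c d) : Continuous c :=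
  continuous_iff_continuousAt.2 fun t => (h.deriv_c t).continuousAt

lemma continuous_d (h : IsRiccatiKernel T ν c d) : Continuous d :=
  continuous_iff_continuousAt.2 fun t => (h.deriv_d t).continuousAt

lemma contDiff_c (h : IsRiccatiKernel T ν c d) : ContDiff ℝ 1 c := by
  rw [contDiff_one_iff_deriv]
  refine ⟨fun t => (h.deriv_c t).differentiableAt, ?_⟩
  rw [funext fun t => (h.deriv_c t).deriv]
  exact h.continuous_d.neg

lemma contDiff_d (h : IsRiccatiKernel T ν c d) : ContDiff ℝ 1 d := by
  rw [contDiff_one_iff_deriv]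
  refine ⟨fun t => (h.deriv_d t).differentiableAt, ?_⟩
  rw [funext fun t => (h.deriv_d t).deriv]
  exact (h.continuous_c.const_mul _).neg

lemma c_eq (h : IsRiccatiKernel T ν c d) (t : ℝ) : c t = ∫ u in t..T, d u := by
  have := intervalIntegral.integral_eq_sub_of_hasDerivAt (a := t) (b := T)
    (fun u _ => h.deriv_c u) (h.continuous_d.neg.intervalIntegrable _ _)
  rw [intervalIntegral.integral_neg, h.c_finish] at this
  linarith

/-- Since `c t = ∫_t^T d` and `d` lies between two positive constants on `[0, T]`, `c` is comparable
to `T - t`. Every estimate near the singular endpoint rests on this. -/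
lemma exists_bounds (h : IsRiccatiKernel T ν c d) : ∃ m > 0, ∃ D > 0, (∀ t, m ≤ d t) ∧
    (∀ t ∈ Set.Icc 0 T, d t ≤ D) ∧ (∀ t ∈ Set.Icc 0 T, m * (T - t) ≤ c t) ∧
    ∀ t ∈ Set.Icc 0 T, c t ≤ D * (T - t) := by
  obtain ⟨m, hm, hmd⟩ := h.d_lower
  obtain ⟨D, hD⟩ := isCompact_Icc.exists_bound_of_continuousOn (s := Set.Icc 0 T)
    h.continuous_d.continuousOn
  have hD' : ∀ t ∈ Set.Icc 0 T, d t ≤ D := fun t ht => (le_abs_self _).trans (hD t ht)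
  refine ⟨m, hm, D, ?_, hmd, hD', fun t ht => ?_, fun t ht => ?_⟩
  · exact hm.trans_le ((hmd 0).trans (hD' 0 ⟨le_rfl, h.pos.le⟩))
  · rw [h.c_eq t]
    have := intervalIntegral.integral_mono_on ht.2 (f := fun _ => m) (g := d) (μ := volume)
      (by simp) (h.continuous_d.intervalIntegrable _ _) (fun u _ => hmd u)
    simpa [mul_comm] using this
  · rw [h.c_eq t]
    have := intervalIntegral.integral_mono_on ht.2 (f := d) (g := fun _ => D) (μ := volume)
      (h.continuous_d.intervalIntegrable _ _) (by simp)
      (fun u hu => hD' u ⟨ht.1.trans hu.1, hu.2⟩)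
    simpa [mul_comm] using this

lemma d_pos (h : IsRiccatiKernel T ν c d) (t : ℝ) : 0 < d t := by
  obtain ⟨m, hm, hmd⟩ := h.d_lower
  exact hm.trans_le (hmd t)

lemma c_pos (h : IsRiccatiKernel T ν c d) {t : ℝ} (ht : t ∈ Set.Ico 0 T) : 0 < c t := by
  obtain ⟨m, hm, D, hD, -, -, h1, -⟩ := h.exists_bounds
  exact (mul_pos hm (sub_pos.2 ht.2)).trans_le (h1 t ⟨ht.1, ht.2.le⟩)

lemma c_nonneg (h : IsRiccatiKernel T ν c d) {t : ℝ} (ht : t ∈ Set.Icc 0 T) : 0 ≤ c t := by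
  obtain ⟨m, hm, D, hD, -, -, h1, -⟩ := h.exists_bounds
  exact (mul_nonneg hm.le (sub_nonneg.2 ht.2)).trans (h1 t ht)

lemma uIcc_subset {s : ℝ} (hs : s ∈ Set.Ico 0 T) : Set.uIcc 0 s ⊆ Set.Ico 0 T := by
  rw [Set.uIcc_of_le hs.1]
  exact fun t ht => ⟨ht.1, ht.2.trans_lt hs.2⟩

/-- The part of `x'` that is not explained by the linear feedback `-x d / c`. -/
def excess (c d x : ℝ → ℝ) (t : ℝ) : ℝ := deriv x t + x t * (d t / c t)

/-! ### The energy identity before the terminal time -/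

section

variable (h : IsRiccatiKernel T ν c d) {x : ℝ → ℝ} {s : ℝ} (hs : s ∈ Set.Ico 0 T)

include h hs

lemma continuousOn_div : ContinuousOn (fun t => d t / c t) (Set.uIcc 0 s) :=
  h.continuous_d.continuousOn.div h.continuous_c.continuousOn
    fun _ ht => (h.c_pos (uIcc_subset hs ht)).ne'

lemma intervalIntegrable_excess_sq_lt (hx : AbsolutelyContinuousOnInterval x 0 s)
    (hx2 : IntervalIntegrable (fun t => deriv x t ^ 2) volume 0 s) :
    IntervalIntegrable (fun t => excess c d x t ^ 2) volume 0 s := by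
  have hcont : ContinuousOn (fun t => x t * (d t / c t)) (Set.uIcc 0 s) :=
    hx.continuousOn.mul (h.continuousOn_div hs)
  have : (fun t => excess c d x t ^ 2) = fun t => deriv x t ^ 2 +
      (2 * (deriv x t * (x t * (d t / c t))) + (x t * (d t / c t)) ^ 2) := by
    funext t; unfold excess; ring
  rw [this]
  exact hx2.add (((hx.intervalIntegrable_deriv.mul_continuousOn hcont).const_mul 2).add
    (hcont.pow 2).intervalIntegrable)

/-- The Riccati equation `(d / c)' = (d / c)² - ν²` makes `excess² - (x² d / c)'` equal to `x'² + ν²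
x²`. On `[0, s]` with `s < T` the quotient is smooth, so the total derivative integrates to boundary
values. -/
lemma energy_identity_lt (hx : AbsolutelyContinuousOnInterval x 0 s)
    (hx2 : IntervalIntegrable (fun t => deriv x t ^ 2) volume 0 s) :
    ∫ t in (0 : ℝ)..s, (deriv x t ^ 2 + ν ^ 2 * x t ^ 2) =
      (∫ t in (0 : ℝ)..s, excess c d x t ^ 2) - x s ^ 2 * (d s / c s) + x 0 ^ 2 * (d 0 / c 0) := by
  have hq : AbsolutelyContinuousOnInterval (fun t => d t / c t) 0 s :=
    ContDiffOn.absolutelyContinuousOnInterval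
      (h.contDiff_d.contDiffOn.div h.contDiff_c.contDiffOn
        fun _ ht => (h.c_pos (uIcc_subset hs ht)).ne')
  have hF := (hx.mul hx).mul hq
  have h1 := hF.integral_deriv_eq_sub
  have h2 : ∫ t in (0 : ℝ)..s, (deriv x t ^ 2 + ν ^ 2 * x t ^ 2) =
      ∫ t in (0 : ℝ)..s, (excess c d x t ^ 2 - deriv (x * x * fun t => d t / c t) t) := by
    refine intervalIntegral.integral_congr_ae ?_
    filter_upwards [hx.ae_differentiableAt] with t ht hmem
    have hmem' := Set.uIoc_subset_uIcc hmem
    have hx' := (ht hmem').hasDerivAt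
    have hc := (h.c_pos (uIcc_subset hs hmem')).ne'
    have hd := ((hx'.mul hx').mul ((h.deriv_d t).div (h.deriv_c t) hc)).deriv
    have hd' : deriv (x * x * fun t => d t / c t) t = _ := hd
    rw [hd']
    simp only [excess, Pi.mul_apply, Pi.div_apply]
    field_simp
    ring
  rw [h2, intervalIntegral.integral_sub (h.intervalIntegrable_excess_sq_lt hs hx hx2)
    hF.intervalIntegrable_deriv, h1]
  simp only [Pi.mul_apply]
  ring

end

/-! ### The energy identity up to the terminal time -/

section

variable (h : IsRiccatiKernel T ν c d) {x : ℝ → ℝ} (hx : AbsolutelyContinuousOnInterval x 0 T)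
  (hxT : x T = 0) (hx2 : IntervalIntegrable (fun t => deriv x t ^ 2) volume 0 T)

include h hx

lemma absolutelyContinuous_sub {s : ℝ} (hs : s ∈ Set.Ico 0 T) :
    AbsolutelyContinuousOnInterval x 0 s :=
  hx.mono (by
    rw [Set.uIcc_of_le hs.1, Set.uIcc_of_le h.pos.le]
    exact Set.Icc_subset_Icc_right hs.2.le)

include hxT hx2

/-- The factor `T - s` in `sq_le_of_finish` cancels the blow-up of `d / c`, and what remains is a
multiple of the vanishing tail `∫_s^T x'²`. -/
lemma tendsto_boundary : Tendsto (fun s => x s ^ 2 * (d s / c s)) (𝓝[<] T) (𝓝 0) := by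
  obtain ⟨m, hm, D, hD, hmd, hdD, hmc, hcD⟩ := h.exists_bounds
  have hlim : Tendsto (fun s => (D / m) * ∫ t in s..T, deriv x t ^ 2) (𝓝[<] T) (𝓝 0) := by
    have h1 := (tendsto_intervalIntegral_left h.pos hx2).const_sub (∫ t in (0 : ℝ)..T, deriv x t ^ 2)
    rw [sub_self] at h1
    have h2 := h1.const_mul (D / m)
    rw [mul_zero] at h2
    refine h2.congr' ?_
    filter_upwards [Ioo_mem_nhdsLT h.pos] with s hs
    rw [intervalIntegral.integral_interval_sub_left hx2
      (intervalIntegrable_sub_left ⟨hs.1.le, hs.2.le⟩ hx2)]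
  refine tendsto_of_tendsto_of_tendsto_of_le_of_le' tendsto_const_nhds hlim ?_ ?_
  · filter_upwards [Ioo_mem_nhdsLT h.pos] with s hs
    exact mul_nonneg (sq_nonneg _) (div_nonneg (h.d_pos s).le (h.c_pos ⟨hs.1.le, hs.2⟩).le)
  · filter_upwards [Ioo_mem_nhdsLT h.pos] with s hs
    have hs' : s ∈ Set.Icc 0 T := ⟨hs.1.le, hs.2.le⟩
    have h1 := sq_le_of_finish hx hxT hx2 hs'
    have h0 : 0 ≤ ∫ t in s..T, deriv x t ^ 2 :=
      intervalIntegral.integral_nonneg hs.2.le fun _ _ => sq_nonneg _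
    have hTs : 0 < T - s := sub_pos.2 hs.2
    have h2 : d s / c s ≤ D / (m * (T - s)) :=
      div_le_div₀ hD.le (hdD s hs') (by positivity) (hmc s hs')
    calc x s ^ 2 * (d s / c s) ≤ ((T - s) * ∫ t in s..T, deriv x t ^ 2) * (D / (m * (T - s))) :=
          mul_le_mul h1 h2 (div_nonneg (h.d_pos s).le (h.c_pos ⟨hs.1.le, hs.2⟩).le) (by positivity)
      _ = _ := by field_simp

/-- The identity on `[0, s]` bounds `∫ excess²` by the energy plus a boundary term, and the latter
is at most `1` close to `T`. -/
lemma intervalIntegrable_excess_sq : IntervalIntegrable (fun t => excess c d x t ^ 2) volume 0 T := by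
  obtain ⟨m, hm, D, hD, hmd, hdD, hmc, hcD⟩ := h.exists_bounds
  obtain ⟨δ, hδ, hbd⟩ : ∃ s₀ ∈ Set.Ico 0 T, ∀ s ∈ Set.Ico s₀ T, x s ^ 2 * (d s / c s) ≤ 1 := by
    have := (h.tendsto_boundary hx hxT hx2).eventually (Iic_mem_nhds zero_lt_one)
    obtain ⟨l, hl, hsub⟩ := mem_nhdsLT_iff_exists_Ico_subset.1 this
    exact ⟨max l 0, ⟨le_max_right _ _, max_lt hl h.pos⟩, fun s hs =>
      hsub ⟨(le_max_left _ _).trans hs.1, hs.2⟩⟩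
  have hxsq : IntervalIntegrable (fun t => deriv x t ^ 2 + ν ^ 2 * x t ^ 2) volume 0 T :=
    hx2.add ((hx.continuousOn.pow 2).intervalIntegrable.const_mul _)
  have hmono : ∀ {f : ℝ → ℝ}, (∀ t, 0 ≤ f t) → ∀ {a b : ℝ}, 0 ≤ a → a ≤ b →
      IntervalIntegrable f volume 0 b → ∫ t in (0 : ℝ)..a, f t ≤ ∫ t in (0 : ℝ)..b, f t := by
    intro f hf a b ha hab hi
    exact intervalIntegral.integral_mono_interval le_rfl ha hab
      (Eventually.of_forall fun t => hf t) hi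
  have hint : ∀ s ∈ Set.Ico 0 T, IntervalIntegrable (fun t => excess c d x t ^ 2) volume 0 s :=
    fun s hs => h.intervalIntegrable_excess_sq_lt hs (h.absolutelyContinuous_sub hx hs)
      (intervalIntegrable_sub_left ⟨hs.1, hs.2.le⟩ hx2)
  refine intervalIntegrable_of_forall_lt (C := (∫ t in (0 : ℝ)..T,
    (deriv x t ^ 2 + ν ^ 2 * x t ^ 2)) + 1) h.pos (fun t => sq_nonneg _) hint fun s hs => ?_
  -- The boundary term is controlled only beyond `δ`, so a smaller `s` is first moved up to `δ`; the
  -- integrand is nonnegative.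
  have hr : max s δ ∈ Set.Ico 0 T := ⟨hs.1.trans (le_max_left _ _), max_lt hs.2 hδ.2⟩
  have h1 := hmono (f := fun t => excess c d x t ^ 2) (fun t => sq_nonneg _) hs.1
    (le_max_left s δ) (hint _ hr)
  have h2 := h.energy_identity_lt hr (h.absolutelyContinuous_sub hx hr)
    (intervalIntegrable_sub_left ⟨hr.1, hr.2.le⟩ hx2)
  have h3 := hmono (f := fun t => deriv x t ^ 2 + ν ^ 2 * x t ^ 2) (fun t => by positivity) hr.1
    hr.2.le hxsq
  have h4 := hbd (max s δ) ⟨le_max_right _ _, hr.2⟩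
  have h5 : 0 ≤ x 0 ^ 2 * (d 0 / c 0) :=
    mul_nonneg (sq_nonneg _) (div_nonneg (h.d_pos 0).le (h.c_pos ⟨le_rfl, h.pos⟩).le)
  linarith

lemma energy_identity :
    ∫ t in (0 : ℝ)..T, (deriv x t ^ 2 + ν ^ 2 * x t ^ 2) =
      (∫ t in (0 : ℝ)..T, excess c d x t ^ 2) + x 0 ^ 2 * (d 0 / c 0) := by
  have hxsq : IntervalIntegrable (fun t => deriv x t ^ 2 + ν ^ 2 * x t ^ 2) volume 0 T :=
    hx2.add ((hx.continuousOn.pow 2).intervalIntegrable.const_mul _)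
  have h1 := tendsto_intervalIntegral_left h.pos hxsq
  have h2 := ((tendsto_intervalIntegral_left h.pos (h.intervalIntegrable_excess_sq hx hxT hx2)).sub
    (h.tendsto_boundary hx hxT hx2)).add_const (x 0 ^ 2 * (d 0 / c 0))
  rw [sub_zero] at h2
  refine tendsto_nhds_unique h1 (h2.congr' ?_)
  filter_upwards [Ioo_mem_nhdsLT h.pos] with s hs
  have hs' : s ∈ Set.Ico 0 T := ⟨hs.1.le, hs.2⟩
  exact (h.energy_identity_lt hs' (h.absolutelyContinuous_sub hx hs')
    (intervalIntegrable_sub_left ⟨hs.1.le, hs.2.le⟩ hx2)).symm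

end

end IsRiccatiKernel

end

section

lemma continuous_absolutelyContinuous_const (a s t : ℝ) :
    AbsolutelyContinuousOnInterval (fun _ => a) s t :=
  ContDiffOn.absolutelyContinuousOnInterval contDiffOn_const

namespace IsRiccatiKernel

variable {T ν : ℝ} {c d : ℝ → ℝ}

/-- The path of `∫_t^T c dy`, after partial integration. -/
def remainder (T : ℝ) (c d y : ℝ → ℝ) (t : ℝ) : ℝ := -(c t * y t) + ∫ u in t..T, y u * d u

/-! ### The linear term of the cost -/

section

variable (h : IsRiccatiKernel T ν c d) {y : ℝ → ℝ} {K : ℝ}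
  (hy : AEStronglyMeasurable y (volume.restrict (Set.uIoc 0 T)))
  (hK : ∀ t ∈ Set.Icc 0 T, |y t| ≤ K)

include h hy hK

lemma intervalIntegrable_mul_d : IntervalIntegrable (fun t => y t * d t) volume 0 T :=
  intervalIntegrable_bounded_mul h.pos.le hy hK (h.continuous_d.intervalIntegrable _ _)

omit hy in
lemma abs_integral_mul_d_le {D : ℝ} (hD : ∀ t ∈ Set.Icc 0 T, d t ≤ D) {t : ℝ}
    (ht : t ∈ Set.Icc 0 T) : |∫ u in t..T, y u * d u| ≤ K * D * (T - t) := by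
  have h1 := intervalIntegral.norm_integral_le_of_norm_le_const (a := t) (b := T)
    (f := fun u => y u * d u) (C := K * D) fun u hu => by
      rw [Set.uIoc_of_le ht.2] at hu
      have hu' : u ∈ Set.Icc 0 T := ⟨ht.1.trans hu.1.le, hu.2⟩
      rw [norm_mul, Real.norm_eq_abs, Real.norm_eq_abs, abs_of_pos (h.d_pos u)]
      exact mul_le_mul (hK u hu') (hD u hu') (h.d_pos u).le ((abs_nonneg _).trans (hK u hu'))
  rwa [Real.norm_eq_abs, abs_of_nonneg (sub_nonneg.2 ht.2)] at h1

omit hy in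
-- Both parts of the remainder are at most a multiple of `K c`: the integral is at most `K D (T -
-- t)`, and `T - t ≤ c / m`. The singularity of `1 / c` is therefore harmless.
lemma abs_remainder_div_le {m D : ℝ} (hm : 0 < m) (hD : ∀ t ∈ Set.Icc 0 T, d t ≤ D)
    (hmc : ∀ t ∈ Set.Icc 0 T, m * (T - t) ≤ c t) {t : ℝ} (ht : t ∈ Set.Icc 0 T) :
    |remainder T c d y t / c t| ≤ (1 + D / m) * K := by
  have hK0 : 0 ≤ K := (abs_nonneg _).trans (hK t ht)
  have hD0 : 0 ≤ D := (h.d_pos t).le.trans (hD t ht)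
  rcases (h.c_nonneg ht).eq_or_lt with hc | hc
  -- Where `c` vanishes, the quotient is `0` by the convention on division.
  · rw [← hc, div_zero, abs_zero]; positivity
  rw [abs_div, abs_of_pos hc, div_le_iff₀ hc]
  have h1 := h.abs_integral_mul_d_le hK hD ht
  have h2 : |c t * y t| ≤ c t * K := by
    rw [abs_mul, abs_of_pos hc]
    exact mul_le_mul_of_nonneg_left (hK t ht) hc.le
  calc |remainder T c d y t| ≤ |-(c t * y t)| + |∫ u in t..T, y u * d u| := abs_add_le _ _
    _ ≤ c t * K + K * D * (T - t) := by rw [abs_neg]; exact add_le_add h2 h1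
    _ = c t * K + K * (D / m) * (m * (T - t)) := by field_simp
    _ ≤ c t * K + K * (D / m) * c t := by
        have := hmc t ht
        gcongr
    _ = _ := by ring

lemma aestronglyMeasurable_remainder_div :
    AEStronglyMeasurable (fun t => remainder T c d y t / c t)
      (volume.restrict (Set.uIoc 0 T)) := by
  have hi := h.intervalIntegrable_mul_d hy hK
  have hG : ContinuousOn (fun t => ∫ u in t..T, y u * d u) (Set.uIcc 0 T) := by
    refine intervalIntegral.continuousOn_primitive_interval_left ?_
    rwa [Set.uIcc_of_le h.pos.le, integrableOn_Icc_iff_integrableOn_Ioc,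
      ← intervalIntegrable_iff_integrableOn_Ioc_of_le h.pos.le]
  have hG' := (hG.aestronglyMeasurable (μ := volume) measurableSet_uIcc).mono_measure
    (Measure.restrict_mono Set.uIoc_subset_uIcc le_rfl)
  exact ((h.continuous_c.aestronglyMeasurable.mul hy).neg.add hG').mul
    h.continuous_c.measurable.inv.aestronglyMeasurable

variable {x : ℝ → ℝ} (hx : AbsolutelyContinuousOnInterval x 0 T)
  (hxT : x T = 0) (hx2 : IntervalIntegrable (fun t => deriv x t ^ 2) volume 0 T)

omit hy hK in
include hx in
lemma aestronglyMeasurable_excess :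
    AEStronglyMeasurable (excess c d x) (volume.restrict (Set.uIoc 0 T)) := by
  have h1 := (hx.continuousOn.aestronglyMeasurable (μ := volume) measurableSet_uIcc).mono_measure
    (Measure.restrict_mono Set.uIoc_subset_uIcc le_rfl)
  exact (measurable_deriv x).aestronglyMeasurable.add
    (h1.mul (h.continuous_d.measurable.div h.continuous_c.measurable).aestronglyMeasurable)

include hx hxT hx2

lemma intervalIntegrable_remainder_mul_excess :
    IntervalIntegrable (fun t => remainder T c d y t / c t * excess c d x t) volume 0 T := by
  obtain ⟨m, hm, D, hD, hmd, hdD, hmc, hcD⟩ := h.exists_bounds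
  exact intervalIntegrable_bounded_mul h.pos.le (h.aestronglyMeasurable_remainder_div hy hK)
    (fun t ht => h.abs_remainder_div_le hK hm hdD hmc ht)
    (intervalIntegrable_of_sq (h.aestronglyMeasurable_excess hx)
      (h.intervalIntegrable_excess_sq hx hxT hx2))

/-- With `G t = ∫_T^t y d` the remainder is `-c y - G`, and almost everywhere `-y x' = (remainder /
c) * excess + (x G / c)'`. At `T` the boundary term vanishes, as `G / c` stays bounded and `x → 0`.
At `0` it gives the constant. -/
lemma linear_identity :
    -∫ t in (0 : ℝ)..T, y t * deriv x t = x 0 / c 0 * (∫ t in (0 : ℝ)..T, y t * d t) +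
      ∫ t in (0 : ℝ)..T, remainder T c d y t / c t * excess c d x t := by
  obtain ⟨m, hm, D, hD, hmd, hdD, hmc, hcD⟩ := h.exists_bounds
  have hi := h.intervalIntegrable_mul_d hy hK
  have hre := h.intervalIntegrable_remainder_mul_excess hy hK hx hxT hx2
  have hyx : IntervalIntegrable (fun t => y t * deriv x t) volume 0 T :=
    intervalIntegrable_bounded_mul h.pos.le hy hK hx.intervalIntegrable_deriv
  set G : ℝ → ℝ := fun t => ∫ u in T..t, y u * d u with hG
  have hGac : AbsolutelyContinuousOnInterval G 0 T :=
    hi.absolutelyContinuousOnInterval_intervalIntegral (Set.right_mem_uIcc)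
  have hlt : ∀ s ∈ Set.Ico 0 T, -∫ t in (0 : ℝ)..s, y t * deriv x t =
      (∫ t in (0 : ℝ)..s, remainder T c d y t / c t * excess c d x t) +
        (x s * (c s)⁻¹ * G s - x 0 * (c 0)⁻¹ * G 0) := by
    intro s hs
    have hsI : s ∈ Set.Icc 0 T := ⟨hs.1, hs.2.le⟩
    have hcinv : AbsolutelyContinuousOnInterval (fun t => (c t)⁻¹) 0 s :=
      ContDiffOn.absolutelyContinuousOnInterval
        (h.contDiff_c.contDiffOn.inv fun _ ht => (h.c_pos (uIcc_subset hs ht)).ne')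
    have hF := ((h.absolutelyContinuous_sub hx hs).mul hcinv).mul
      (h.absolutelyContinuous_sub hGac hs)
    have h1 := hF.integral_deriv_eq_sub
    simp only [Pi.mul_apply] at h1
    rw [← h1, ← intervalIntegral.integral_neg, ← intervalIntegral.integral_add
      (intervalIntegrable_sub_left hsI hre) hF.intervalIntegrable_deriv]
    refine intervalIntegral.integral_congr_ae ?_
    filter_upwards [hx.ae_differentiableAt, hi.ae_hasDerivAt_integral] with t ht hGt hmem
    have hmem' := Set.uIoc_subset_uIcc hmem
    have hmemT : t ∈ Set.uIcc 0 T := by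
      rw [Set.uIcc_of_le h.pos.le]
      exact ⟨(uIcc_subset hs hmem').1, (uIcc_subset hs hmem').2.le⟩
    have hx' := (ht hmemT).hasDerivAt
    have hc := (h.c_pos (uIcc_subset hs hmem')).ne'
    have hG' : HasDerivAt G (y t * d t) t := hGt hmemT T Set.right_mem_uIcc
    have hd : deriv ((x * fun t => (c t)⁻¹) * G) t = _ :=
      ((hx'.mul ((h.deriv_c t).inv hc)).mul hG').deriv
    have hsym : ∫ u in t..T, y u * d u = -G t := intervalIntegral.integral_symm _ _
    rw [hd]
    simp only [excess, remainder, hsym, Pi.mul_apply, Pi.inv_apply]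
    field_simp
    ring
  have hbdry : Tendsto (fun s => x s * (c s)⁻¹ * G s) (𝓝[<] T) (𝓝 0) := by
    have hxlim : Tendsto (fun s => |x s| * (K * (D / m))) (𝓝[<] T) (𝓝 0) := by
      have h1 : Tendsto x (𝓝[<] T) (𝓝 0) := by
        rw [← hxT, ← nhdsWithin_Ioo_eq_nhdsLT h.pos]
        have := hx.continuousOn
        rw [Set.uIcc_of_le h.pos.le] at this
        exact (this T (Set.right_mem_Icc.2 h.pos.le)).tendsto.mono_left
          (nhdsWithin_mono _ Set.Ioo_subset_Icc_self)
      simpa using h1.abs.mul_const (K * (D / m))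
    refine squeeze_zero_norm' ?_ hxlim
    filter_upwards [Ioo_mem_nhdsLT h.pos] with s hs
    have hsI : s ∈ Set.Icc 0 T := ⟨hs.1.le, hs.2.le⟩
    have hc := h.c_pos ⟨hs.1.le, hs.2⟩
    have hK0 : 0 ≤ K := (abs_nonneg _).trans (hK s hsI)
    have h1 := h.abs_integral_mul_d_le hK hdD hsI
    rw [intervalIntegral.integral_symm, abs_neg] at h1
    rw [Real.norm_eq_abs, abs_mul, abs_mul, mul_assoc, abs_inv, abs_of_pos hc]
    refine mul_le_mul_of_nonneg_left ?_ (abs_nonneg _)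
    rw [inv_mul_le_iff₀ hc]
    calc |G s| ≤ K * D * (T - s) := h1
      _ = K * (D / m) * (m * (T - s)) := by field_simp
      _ ≤ K * (D / m) * c s := by have := hmc s hsI; gcongr
      _ = _ := by ring
  have hG0 : G 0 = -∫ t in (0 : ℝ)..T, y t * d t := intervalIntegral.integral_symm _ _
  have h1 := (tendsto_intervalIntegral_left h.pos hyx).neg
  have h2 := (tendsto_intervalIntegral_left h.pos hre).add
    (hbdry.sub_const (x 0 * (c 0)⁻¹ * G 0))
  rw [tendsto_nhds_unique h1 (h2.congr' ?_)]
  · rw [hG0]; ring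
  · filter_upwards [Ioo_mem_nhdsLT h.pos] with s hs
    exact (hlt s ⟨hs.1.le, hs.2⟩).symm

end

/-! ### Paths of feedback form: regularity up to the terminal time -/

section

variable (h : IsRiccatiKernel T ν c d) {g x : ℝ → ℝ} {a : ℝ}
  (hg : AEStronglyMeasurable g (volume.restrict (Set.uIoc 0 T)))
  (hg2 : IntervalIntegrable (fun t => (g t / c t) ^ 2) volume 0 T)
  (hx : ∀ t ∈ Set.Icc 0 T, x t = c t * (a - 1 / 2 * ∫ s in (0 : ℝ)..t, g s / c s ^ 2))

include h hg hg2

lemma intervalIntegrable_div : IntervalIntegrable (fun t => g t / c t) volume 0 T :=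
  intervalIntegrable_of_sq
    (hg.mul h.continuous_c.measurable.inv.aestronglyMeasurable) hg2

lemma intervalIntegrable_div_sq {s : ℝ} (hs : s ∈ Set.Ico 0 T) :
    IntervalIntegrable (fun t => g t / c t ^ 2) volume 0 s := by
  have h1 := intervalIntegrable_sub_left ⟨hs.1, hs.2.le⟩ (h.intervalIntegrable_div hg hg2)
  have h2 : ContinuousOn (fun t => (c t)⁻¹) (Set.uIcc 0 s) :=
    h.continuous_c.continuousOn.inv₀ fun _ ht => (h.c_pos (uIcc_subset hs ht)).ne'
  refine (h1.mul_continuousOn h2).congr fun t _ => ?_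
  simp only [div_eq_mul_inv, pow_two, mul_inv]
  ring

include hx

lemma absolutelyContinuous_feedback_lt {s : ℝ} (hs : s ∈ Set.Ico 0 T) :
    AbsolutelyContinuousOnInterval x 0 s := by
  have h1 := ((h.intervalIntegrable_div_sq hg hg2
    hs).absolutelyContinuousOnInterval_intervalIntegral Set.left_mem_uIcc).const_mul (1 / 2)
  have h2 : AbsolutelyContinuousOnInterval c 0 s :=
    h.contDiff_c.contDiffOn.absolutelyContinuousOnInterval
  refine absolutelyContinuousOnInterval_congr
    (h2.mul ((continuous_absolutelyContinuous_const a 0 s).sub h1)) fun t ht => ?_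
  have := uIcc_subset hs ht
  exact (hx t ⟨this.1, this.2.le⟩).symm

/-- Variation of constants: the excess of `x` is `c (x / c)'`, and here `x / c` is a primitive of
`-g / (2 c²)`. Integrability of `g / c²` is available only away from `T`, so the claim is proved on
`(0, T - T / (n + 1))` for each `n`. -/
lemma excess_feedback :
    ∀ᵐ t, t ∈ Set.uIoc 0 T → excess c d x t = -(1 / 2) * (g t / c t) := by
  have key : ∀ n : ℕ, ∀ᵐ t, t ∈ Set.Ioo 0 (T - T / (n + 1)) →
      excess c d x t = -(1 / 2) * (g t / c t) := by
    intro n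
    have hpos : 0 < T / ((n : ℝ) + 1) := div_pos h.pos (by positivity)
    rcases lt_or_ge (T - T / (n + 1)) 0 with hneg | hnn
    · exact Eventually.of_forall fun t ht => absurd (ht.1.trans ht.2) (not_lt.2 hneg.le)
    have hs : T - T / ((n : ℝ) + 1) ∈ Set.Ico 0 T := ⟨hnn, by linarith⟩
    filter_upwards [(h.intervalIntegrable_div_sq hg hg2 hs).ae_hasDerivAt_integral] with t ht hmem
    have hmem' : t ∈ Set.uIcc 0 (T - T / ((n : ℝ) + 1)) := by
      rw [Set.uIcc_of_le hnn]; exact ⟨hmem.1.le, hmem.2.le⟩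
    have htT : t ∈ Set.Ico 0 T := uIcc_subset hs hmem'
    have hc := (h.c_pos htT).ne'
    have hI := ht hmem' 0 Set.left_mem_uIcc
    have hev : x =ᶠ[𝓝 t] fun t => c t * (a - 1 / 2 * ∫ s in (0 : ℝ)..t, g s / c s ^ 2) := by
      filter_upwards [Ioo_mem_nhds hmem.1 htT.2] with u hu using hx u ⟨hu.1.le, hu.2.le⟩
    have hd := ((h.deriv_c t).mul ((hI.const_mul (1 / 2)).const_sub a)).deriv
    rw [excess, hev.deriv_eq]
    have hd' : deriv (fun t => c t * (a - 1 / 2 * ∫ s in (0 : ℝ)..t, g s / c s ^ 2)) t = _ := hd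
    rw [hd', hx t ⟨htT.1, htT.2.le⟩]
    field_simp
    ring
  have hT : ∀ᵐ t : ℝ, t ≠ T := by simp [ae_iff]
  filter_upwards [ae_all_iff.2 key, hT] with t ht htT hmem
  rw [Set.uIoc_of_le h.pos.le] at hmem
  have hlt : t < T := lt_of_le_of_ne hmem.2 htT
  obtain ⟨n, hn⟩ := exists_nat_gt (T / (T - t))
  refine ht n ⟨hmem.1, ?_⟩
  rw [div_lt_iff₀ (sub_pos.2 hlt)] at hn
  have : T / ((n : ℝ) + 1) < T - t := by
    rw [div_lt_iff₀ (by positivity)]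
    nlinarith
  linarith

lemma intervalIntegrable_deriv_feedback_sq_lt {s : ℝ} (hs : s ∈ Set.Ico 0 T) :
    IntervalIntegrable (fun t => deriv x t ^ 2) volume 0 s := by
  have hsI : s ∈ Set.Icc 0 T := ⟨hs.1, hs.2.le⟩
  have hcont : ContinuousOn (fun t => x t * (d t / c t)) (Set.uIcc 0 s) :=
    (h.absolutelyContinuous_feedback_lt hg hg2 hx hs).continuousOn.mul (h.continuousOn_div hs)
  have h1 := (((intervalIntegrable_sub_left hsI hg2).const_mul (1 / 4)).add
    ((intervalIntegrable_sub_left hsI (h.intervalIntegrable_div hg hg2)).mul_continuousOn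
      hcont)).add (hcont.pow 2).intervalIntegrable
  refine h1.congr_ae ?_
  rw [Filter.EventuallyEq, ae_restrict_iff' measurableSet_uIoc]
  filter_upwards [h.excess_feedback hg hg2 hx] with t ht hmem
  have h2 := ht (by
    rw [Set.uIoc_of_le hs.1] at hmem
    rw [Set.uIoc_of_le h.pos.le]
    exact ⟨hmem.1, hmem.2.trans hs.2.le⟩)
  have h3 : deriv x t = -(1 / 2) * (g t / c t) - x t * (d t / c t) := by
    rw [← h2, excess]; ring
  rw [h3, Pi.pow_apply]
  ring

/-- The right-hand side does not depend on `s`. The boundary term stays on the left because its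
boundedness is what later forces `x → 0` at `T`. -/
lemma energy_feedback_lt {s : ℝ} (hs : s ∈ Set.Ico 0 T) :
    (∫ t in (0 : ℝ)..s, deriv x t ^ 2) + x s ^ 2 * (d s / c s) ≤
      (∫ t in (0 : ℝ)..T, 1 / 4 * (g t / c t) ^ 2) + x 0 ^ 2 * (d 0 / c 0) := by
  have hsI : s ∈ Set.Icc 0 T := ⟨hs.1, hs.2.le⟩
  have hac := h.absolutelyContinuous_feedback_lt hg hg2 hx hs
  have hx2 := h.intervalIntegrable_deriv_feedback_sq_lt hg hg2 hx hs
  have h1 := h.energy_identity_lt hs hac hx2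
  have h2 : ∫ t in (0 : ℝ)..s, excess c d x t ^ 2 = ∫ t in (0 : ℝ)..s, 1 / 4 * (g t / c t) ^ 2 := by
    refine intervalIntegral.integral_congr_ae ?_
    filter_upwards [h.excess_feedback hg hg2 hx] with t ht hmem
    rw [ht (by
      rw [Set.uIoc_of_le hs.1] at hmem
      rw [Set.uIoc_of_le h.pos.le]
      exact ⟨hmem.1, hmem.2.trans hs.2.le⟩)]
    ring
  have h3 : ∫ t in (0 : ℝ)..s, 1 / 4 * (g t / c t) ^ 2 ≤ ∫ t in (0 : ℝ)..T, 1 / 4 * (g t / c t) ^ 2 :=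
    intervalIntegral.integral_mono_interval le_rfl hs.1 hs.2.le
      (Eventually.of_forall fun t => by positivity) (hg2.const_mul _)
  have h4 : ∫ t in (0 : ℝ)..s, deriv x t ^ 2 ≤
      ∫ t in (0 : ℝ)..s, (deriv x t ^ 2 + ν ^ 2 * x t ^ 2) :=
    intervalIntegral.integral_mono_on hs.1 hx2
      (hx2.add ((hac.continuousOn.pow 2).intervalIntegrable.const_mul _))
      fun t _ => le_add_of_nonneg_right (by positivity)
  linarith

lemma intervalIntegrable_deriv_feedback_sq :
    IntervalIntegrable (fun t => deriv x t ^ 2) volume 0 T :=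
  intervalIntegrable_of_forall_lt h.pos (fun _ => sq_nonneg _)
    (fun _ hs => h.intervalIntegrable_deriv_feedback_sq_lt hg hg2 hx hs) fun s hs =>
      le_trans (le_add_of_nonneg_right (mul_nonneg (sq_nonneg _)
        (div_nonneg (h.d_pos s).le (h.c_pos hs).le))) (h.energy_feedback_lt hg hg2 hx hs)

/-- Square integrability of `x'` gives `x` a limit at `T`. From `x² d / c ≤ C`, `d ≥ m` and `c → 0`,
that limit is `0`, which is the value of the formula at `T`. Hence `x` is the primitive of `x'` on
all of `[0, T]`. -/
lemma absolutelyContinuous_feedback : AbsolutelyContinuousOnInterval x 0 T := by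
  obtain ⟨m, hm, D, hD, hmd, hdD, hmc, hcD⟩ := h.exists_bounds
  have hx2 := h.intervalIntegrable_deriv_feedback_sq hg hg2 hx
  have hx1 : IntervalIntegrable (deriv x) volume 0 T :=
    intervalIntegrable_of_sq (measurable_deriv x).aestronglyMeasurable hx2
  set C := (∫ t in (0 : ℝ)..T, 1 / 4 * (g t / c t) ^ 2) + x 0 ^ 2 * (d 0 / c 0) with hC
  have hxs : ∀ s ∈ Set.Ico 0 T, x s = x 0 + ∫ t in (0 : ℝ)..s, deriv x t := by
    intro s hs
    rw [(h.absolutelyContinuous_feedback_lt hg hg2 hx hs).integral_deriv_eq_sub]; ring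
  have hlim1 : Tendsto x (𝓝[<] T) (𝓝 (x 0 + ∫ t in (0 : ℝ)..T, deriv x t)) := by
    refine ((tendsto_intervalIntegral_left h.pos hx1).const_add (x 0)).congr' ?_
    filter_upwards [Ioo_mem_nhdsLT h.pos] with s hs using (hxs s ⟨hs.1.le, hs.2⟩).symm
  have hlim2 : Tendsto (fun s => x s ^ 2) (𝓝[<] T) (𝓝 0) := by
    have hc0 : Tendsto (fun s => C / m * c s) (𝓝[<] T) (𝓝 0) := by
      have := (h.continuous_c.tendsto T).mono_left (nhdsWithin_le_nhds (s := Set.Iio T))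
      rw [h.c_finish] at this
      simpa using this.const_mul (C / m)
    refine tendsto_of_tendsto_of_tendsto_of_le_of_le' tendsto_const_nhds hc0
      (Eventually.of_forall fun _ => sq_nonneg _) ?_
    filter_upwards [Ioo_mem_nhdsLT h.pos] with s hs
    have hs' : s ∈ Set.Ico 0 T := ⟨hs.1.le, hs.2⟩
    have hc := h.c_pos hs'
    have h1 := h.energy_feedback_lt hg hg2 hx hs'
    have h2 : 0 ≤ ∫ t in (0 : ℝ)..s, deriv x t ^ 2 :=
      intervalIntegral.integral_nonneg hs.1.le fun _ _ => sq_nonneg _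
    have h3 : x s ^ 2 * (m / c s) ≤ C := by
      have : x s ^ 2 * (m / c s) ≤ x s ^ 2 * (d s / c s) := by
        have := hmd s
        gcongr
      linarith
    calc x s ^ 2 = x s ^ 2 * (m / c s) * (c s / m) := by field_simp
      _ ≤ C * (c s / m) := by gcongr
      _ = _ := by ring
  have hzero : x 0 + ∫ t in (0 : ℝ)..T, deriv x t = 0 := by
    have := tendsto_nhds_unique (hlim1.pow 2) hlim2
    exact pow_eq_zero_iff (two_ne_zero) |>.1 this
  have hxT : x T = 0 := by rw [hx T (Set.right_mem_Icc.2 h.pos.le), h.c_finish, zero_mul]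
  refine absolutelyContinuousOnInterval_congr
    ((continuous_absolutelyContinuous_const (x 0) 0 T).add
      (hx1.absolutelyContinuousOnInterval_intervalIntegral Set.left_mem_uIcc)) fun t ht => ?_
  rw [Set.uIcc_of_le h.pos.le] at ht
  rcases ht.2.eq_or_lt with rfl | hlt
  · rw [hxT]; exact hzero
  · exact (hxs t ⟨ht.1, hlt⟩).symm

end

/-- The difference has zero excess and vanishes at both ends, so the energy identity makes its
energy zero. -/
lemma eq_of_excess_eq (h : IsRiccatiKernel T ν c d) {x y : ℝ → ℝ}
    (hx : AbsolutelyContinuousOnInterval x 0 T) (hxT : x T = 0)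
    (hx2 : IntervalIntegrable (fun t => deriv x t ^ 2) volume 0 T)
    (hy : AbsolutelyContinuousOnInterval y 0 T) (hyT : y T = 0)
    (hy2 : IntervalIntegrable (fun t => deriv y t ^ 2) volume 0 T) (h0 : x 0 = y 0)
    (he : ∀ᵐ t, t ∈ Set.uIoc 0 T → excess c d x t = excess c d y t) :
    ∀ t ∈ Set.Icc 0 T, x t = y t := by
  have hu := hx.sub hy
  have hder : ∀ᵐ t, t ∈ Set.uIoc 0 T → deriv (x - y) t = deriv x t - deriv y t := by
    filter_upwards [hx.ae_differentiableAt, hy.ae_differentiableAt] with t h1 h2 hmem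
    have hm := Set.uIoc_subset_uIcc hmem
    exact deriv_sub (h1 hm) (h2 hm)
  have hu2 : IntervalIntegrable (fun t => deriv (x - y) t ^ 2) volume 0 T := by
    have h1 := intervalIntegrable_mul_of_sq (measurable_deriv x).aestronglyMeasurable
      (measurable_deriv y).aestronglyMeasurable hx2 hy2
    refine ((hx2.sub (h1.const_mul 2)).add hy2).congr_ae ?_
    rw [Filter.EventuallyEq, ae_restrict_iff' measurableSet_uIoc]
    filter_upwards [hder] with t ht hmem
    rw [ht hmem]; ring
  have hex : ∫ t in (0 : ℝ)..T, excess c d (x - y) t ^ 2 = 0 := by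
    refine (intervalIntegral.integral_congr_ae (g := fun _ => (0 : ℝ)) ?_).trans (by simp)
    filter_upwards [hder, he] with t h1 h2 hmem
    have h3 := h2 hmem
    simp only [excess] at h3
    simp only [excess, h1 hmem, Pi.sub_apply]
    have : deriv x t - deriv y t + (x t - y t) * (d t / c t) = 0 := by linear_combination h3
    rw [this]; ring
  have hen := h.energy_identity hu (by simp [hxT, hyT]) hu2
  rw [hex] at hen
  simp only [Pi.sub_apply, h0, sub_self, ne_eq, OfNat.ofNat_ne_zero, not_false_eq_true, zero_pow,
    zero_mul, add_zero] at hen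
  have hsq : IntervalIntegrable (fun t => ν ^ 2 * (x t - y t) ^ 2) volume 0 T :=
    ((hu.continuousOn.pow 2).intervalIntegrable.const_mul _)
  rw [intervalIntegral.integral_add hu2 hsq] at hen
  have hn : 0 ≤ ∫ t in (0 : ℝ)..T, ν ^ 2 * (x t - y t) ^ 2 :=
    intervalIntegral.integral_nonneg h.pos.le fun _ _ => by positivity
  intro t ht
  have hs := sq_le_of_finish hu (by simp [hxT, hyT]) hu2 ht
  have hle : ∫ u in t..T, deriv (x - y) u ^ 2 ≤ ∫ u in (0 : ℝ)..T, deriv (x - y) u ^ 2 :=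
    intervalIntegral.integral_mono_interval ht.1 ht.2 le_rfl
      (Eventually.of_forall fun _ => sq_nonneg _) hu2
  have hz : (x - y) t ^ 2 ≤ 0 := by
    refine hs.trans (mul_nonpos_of_nonneg_of_nonpos (sub_nonneg.2 ht.2) ?_)
    linarith
  have := pow_eq_zero_iff (two_ne_zero) |>.1 (le_antisymm hz (sq_nonneg _))
  simpa [sub_eq_zero] using this

end IsRiccatiKernel

/-! ### Reduction of the cost, path by path -/

section

variable {T : ℝ} (hT : 0 < T) {x s : ℝ → ℝ} {K : ℝ}
  (hs : AEStronglyMeasurable s (volume.restrict (Set.uIoc 0 T)))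
  (hK : ∀ t ∈ Set.Icc 0 T, |s t| ≤ K)
  (hx : AbsolutelyContinuousOnInterval x 0 T)
  (hx2 : IntervalIntegrable (fun t => deriv x t ^ 2) volume 0 T)

include hT hs hK hx hx2

lemma intervalIntegrable_cost (η γ : ℝ) : IntervalIntegrable
    (fun t => (s t + η * deriv x t + γ * (x t - x 0)) * deriv x t) volume 0 T := by
  have h1 : ContinuousOn (fun t => γ * (x t - x 0)) (Set.uIcc 0 T) :=
    (hx.continuousOn.sub continuousOn_const).const_mul γ |>.congr fun t _ => rfl
  refine ((intervalIntegrable_bounded_mul hT.le hs hK hx.intervalIntegrable_deriv).add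
    ((hx2.const_mul η).add (hx.intervalIntegrable_deriv.continuousOn_mul h1))).congr fun t _ => ?_
  ring

omit hx2 in
lemma intervalIntegrable_risk (γ lam : ℝ) : IntervalIntegrable
    (fun t => lam * x t * (s t + γ * x t)) volume 0 T := by
  refine (((intervalIntegrable_bounded_mul hT.le hs hK hx.continuousOn.intervalIntegrable).const_mul
    lam).add ((hx.continuousOn.pow 2).intervalIntegrable.const_mul (lam * γ))).congr fun t _ => ?_
  simp only [Pi.pow_apply]
  ring

lemma cost_eq {η γ lam ν : ℝ} (hη : η ≠ 0) (hν : ν ^ 2 = lam * γ / η) (hxT : x T = 0) {y : ℝ → ℝ}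
    (hy : ∀ t ∈ Set.Icc 0 T, y t = -(1 / η) * (s t - s 0) + lam / η * ∫ u in (0 : ℝ)..t, s u) :
    (∫ t in (0 : ℝ)..T, (s t + η * deriv x t + γ * (x t - x 0)) * deriv x t) +
      ∫ t in (0 : ℝ)..T, lam * x t * (s t + γ * x t) =
    γ / 2 * x 0 ^ 2 - x 0 * s 0 +
      η * ((∫ t in (0 : ℝ)..T, (deriv x t ^ 2 + ν ^ 2 * x t ^ 2)) +
        -∫ t in (0 : ℝ)..T, y t * deriv x t) := by
  have hsi : IntervalIntegrable s volume 0 T := by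
    simpa using intervalIntegrable_bounded_mul hT.le hs hK
      (intervalIntegrable_const (c := (1 : ℝ)))
  set A : ℝ → ℝ := fun t => ∫ u in (0 : ℝ)..t, s u with hA
  have hAac : AbsolutelyContinuousOnInterval A 0 T :=
    hsi.absolutelyContinuousOnInterval_intervalIntegral Set.left_mem_uIcc
  have hsq : AbsolutelyContinuousOnInterval (fun t => x t * x t) 0 T := hx.mul hx
  have hxA := hx.mul hAac
  -- The two integrands differ by `F' + 2 s(0) x'`: the permanent impact is the derivative of a
  -- quadratic in `x`, and `lam x s + lam A x'` is `lam (x A)'`.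
  set F : ℝ → ℝ := fun t => γ / 2 * (x t * x t) - (γ * x 0 + s 0) * x t + lam * (x t * A t) with hF
  have hFac : AbsolutelyContinuousOnInterval F 0 T :=
    ((hsq.const_mul (γ / 2)).sub (hx.const_mul (γ * x 0 + s 0))).add (hxA.const_mul lam)
  have hFT : ∫ t in (0 : ℝ)..T, deriv F t = γ / 2 * x 0 ^ 2 + x 0 * s 0 := by
    rw [hFac.integral_deriv_eq_sub]
    simp only [hF, hxT, hA, intervalIntegral.integral_same]
    ring
  have hyx : IntervalIntegrable (fun t => y t * deriv x t) volume 0 T := by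
    have h1 : ContinuousOn (fun t => 1 / η * s 0 + lam / η * A t) (Set.uIcc 0 T) :=
      continuousOn_const.add (hAac.continuousOn.const_mul _ |>.congr fun t _ => rfl)
    refine (((intervalIntegrable_bounded_mul hT.le hs hK hx.intervalIntegrable_deriv).const_mul
      (-(1 / η))).add (hx.intervalIntegrable_deriv.continuousOn_mul h1)).congr fun t ht => ?_
    rw [Set.uIoc_of_le hT.le] at ht
    simp only [hy t ⟨ht.1.le, ht.2⟩, hA]
    ring
  have hq : IntervalIntegrable (fun t => deriv x t ^ 2 + ν ^ 2 * x t ^ 2) volume 0 T :=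
    hx2.add ((hx.continuousOn.pow 2).intervalIntegrable.const_mul _)
  have hyn : IntervalIntegrable (fun t => -(y t * deriv x t)) volume 0 T := hyx.neg
  rw [← intervalIntegral.integral_neg, ← intervalIntegral.integral_add hq hyn,
    ← intervalIntegral.integral_const_mul,
    ← intervalIntegral.integral_add (intervalIntegrable_cost hT hs hK hx hx2 η γ)
      (intervalIntegrable_risk hT hs hK hx γ lam)]
  have key : ∫ t in (0 : ℝ)..T, ((s t + η * deriv x t + γ * (x t - x 0)) * deriv x t +
      lam * x t * (s t + γ * x t)) = ∫ t in (0 : ℝ)..T, (η * (deriv x t ^ 2 + ν ^ 2 * x t ^ 2 +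
        -(y t * deriv x t)) + (deriv F t + 2 * s 0 * deriv x t)) := by
    refine intervalIntegral.integral_congr_ae ?_
    filter_upwards [hx.ae_differentiableAt, hsi.ae_hasDerivAt_integral] with t ht hAt hmem
    have hmem' := Set.uIoc_subset_uIcc hmem
    have hx' := (ht hmem').hasDerivAt
    have hA' : HasDerivAt A (s t) t := hAt hmem' 0 Set.left_mem_uIcc
    have hd : deriv F t = _ := ((((hx'.mul hx').const_mul (γ / 2)).sub
      (hx'.const_mul (γ * x 0 + s 0))).add ((hx'.mul hA').const_mul lam)).deriv
    rw [Set.uIcc_of_le hT.le] at hmem'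
    rw [hd, hy t hmem', hν]
    simp only [hA]
    field_simp
    ring
  rw [key, intervalIntegral.integral_add ((hq.add hyn).const_mul η)
    (hFac.intervalIntegrable_deriv.add (hx.intervalIntegrable_deriv.const_mul _)),
    intervalIntegral.integral_add hFac.intervalIntegrable_deriv
      (hx.intervalIntegrable_deriv.const_mul _), hFT,
    intervalIntegral.integral_const_mul (2 * s 0), hx.integral_deriv_eq_sub, hxT]
  ring

end

end

section

/-! ### Measurability of processes and of their time integrals -/

section

variable {Ω : Type*}

lemma measurable_of_ae_eq_of_complete {m mΩ : MeasurableSpace Ω} {P : Measure Ω}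
    (hc : ∀ A : Set Ω, P A = 0 → MeasurableSet[m] A) {f g : Ω → ℝ} (hg : Measurable[m] g)
    (hfg : f =ᵐ[P] g) : Measurable[m] f := by
  intro B hB
  have h0 : P {ω | f ω ≠ g ω} = 0 := hfg
  have heq : f ⁻¹' B = (g ⁻¹' B \ {ω | f ω ≠ g ω}) ∪ (f ⁻¹' B ∩ {ω | f ω ≠ g ω}) := by
    ext ω
    by_cases h : f ω = g ω <;> simp [h]
  rw [heq]
  exact ((hg hB).diff (hc _ h0)).union (hc _ (measure_mono_null Set.inter_subset_right h0))

/-- Time is rounded up to the next grid point strictly to the right. The rounded process takes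
countably many time values, hence is jointly measurable, and right-continuity gives pointwise
convergence. -/
lemma measurable_uncurry_of_rightContinuous [MeasurableSpace Ω] {Z : ℝ → Ω → ℝ}
    (hZ : ∀ t, Measurable (Z t))
    (hr : ∀ ω t, ContinuousWithinAt (fun s => Z s ω) (Set.Ioi t) t) :
    Measurable (Function.uncurry Z) := by
  refine measurable_of_tendsto_metrizable (f := fun (n : ℕ) (p : ℝ × Ω) =>
    Z ((⌊p.1 * (n + 1)⌋ + 1) / (n + 1)) p.2) (fun n => ?_) ?_
  · have h1 : Measurable fun q : ℤ × Ω => Z ((q.1 + 1) / (n + 1)) q.2 :=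
      measurable_from_prod_countable_right fun k => hZ ((k + 1) / (n + 1))
    have h2 : Measurable fun p : ℝ × Ω => ((⌊p.1 * (n + 1)⌋, p.2) : ℤ × Ω) :=
      (Int.measurable_floor.comp (measurable_fst.mul_const _)).prodMk measurable_snd
    exact h1.comp h2
  · rw [tendsto_pi_nhds]
    rintro ⟨t, ω⟩
    refine (hr ω t).tendsto.comp (tendsto_nhdsWithin_iff.2 ⟨?_, Eventually.of_forall fun n => ?_⟩)
    · have hlim : Tendsto (fun n : ℕ => t + 1 / ((n : ℝ) + 1)) atTop (𝓝 t) := by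
        simpa using (tendsto_one_div_add_atTop_nhds_zero_nat (𝕜 := ℝ)).const_add t
      refine tendsto_of_tendsto_of_tendsto_of_le_of_le tendsto_const_nhds hlim (fun n => ?_)
        fun n => ?_
      · show t ≤ _
        rw [le_div_iff₀ (by positivity)]
        exact (Int.lt_floor_add_one _).le
      · show _ ≤ t + 1 / ((n : ℝ) + 1)
        rw [div_le_iff₀ (by positivity), add_mul, one_div_mul_cancel (by positivity)]
        linarith [Int.floor_le (t * ((n : ℝ) + 1))]
    · show t < _
      rw [lt_div_iff₀ (by positivity)]
      exact Int.lt_floor_add_one _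

lemma measurable_intervalIntegral [MeasurableSpace Ω] {Z : ℝ → Ω → ℝ}
    (hZ : Measurable (Function.uncurry Z)) {φ : ℝ → ℝ} (hφ : Measurable φ) (a b : ℝ) :
    Measurable fun ω => ∫ s in a..b, Z s ω * φ s := by
  have h : Measurable fun p : Ω × ℝ => Z p.2 p.1 * φ p.2 :=
    (hZ.comp measurable_swap).mul (hφ.comp measurable_snd)
  exact (h.stronglyMeasurable.integral_prod_right'.measurable).sub
    h.stronglyMeasurable.integral_prod_right'.measurable

/-- The process `Z`, stopped at `T`, on the event `A`, with real time. -/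
def regularize (A : Set Ω) (T : ℝ≥0) (Z : ℝ≥0 → Ω → ℝ) (t : ℝ) : Ω → ℝ :=
  A.indicator (Z (min t.toNNReal T))

lemma regularize_eq {A : Set Ω} {T : ℝ≥0} {Z : ℝ≥0 → Ω → ℝ} {ω : Ω} (hω : ω ∈ A) {t : ℝ}
    (ht : t ≤ T) : regularize A T Z t ω = path Z ω t := by
  rw [regularize, Set.indicator_of_mem hω, path, min_eq_left (Real.toNNReal_le_iff_le_coe.2 ht)]

lemma measurable_regularize {m : MeasurableSpace Ω} {A : Set Ω} (hA : MeasurableSet[m] A)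
    {T : ℝ≥0} {Z : ℝ≥0 → Ω → ℝ} (t : ℝ) (hZ : Measurable[m] (Z (min t.toNNReal T))) :
    Measurable[m] (regularize A T Z t) :=
  hZ.indicator hA

lemma rightContinuous_regularize {A : Set Ω} {T : ℝ≥0} {Z : ℝ≥0 → Ω → ℝ}
    (hA : ∀ ω ∈ A, ∀ t < T, ContinuousWithinAt (fun s => Z s ω) (Set.Ioi t) t) (ω : Ω) (t : ℝ) :
    ContinuousWithinAt (fun s => regularize A T Z s ω) (Set.Ioi t) t := by
  by_cases hω : ω ∈ A
  · simp only [regularize, Set.indicator_of_mem hω]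
    rw [continuousWithinAt_Ioi_iff_Ici]
    rcases lt_or_ge t.toNNReal T with h | h
    · have h1 := continuousWithinAt_Ioi_iff_Ici.1 (hA ω hω _ h)
      have hm : Monotone fun s : ℝ => min s.toNNReal T := fun a b hab =>
        min_le_min (Real.toNNReal_mono hab) le_rfl
      have he : min t.toNNReal T = t.toNNReal := min_eq_left h.le
      rw [← he] at h1
      exact ContinuousWithinAt.comp (f := fun s : ℝ => min s.toNNReal T) h1
        (by fun_prop : Continuous fun s : ℝ => min s.toNNReal T).continuousWithinAt
        fun s hs => hm hs
    · refine (continuousWithinAt_const (b := Z T ω)).congr (fun s hs => ?_) ?_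
      · rw [min_eq_right (h.trans (Real.toNNReal_mono hs))]
      · rw [min_eq_right h]
  · simp only [regularize, Set.indicator_of_notMem hω]
    exact continuousWithinAt_const

end

section

variable {Ω : Type*} {mΩ : MeasurableSpace Ω} {P : Measure Ω} {𝓕 : Filtration ℝ≥0 mΩ}

lemma UsualConditions.measurableSet_of_null (h𝓕 : UsualConditions 𝓕 P) (t : ℝ≥0) (A : Set Ω)
    (hA : P A = 0) : MeasurableSet[𝓕 t] A :=
  𝓕.mono zero_le A (h𝓕.complete A hA)

lemma UsualConditions.measurableSet_of_ae (h𝓕 : UsualConditions 𝓕 P) (t : ℝ≥0) {A : Set Ω}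
    (hA : ∀ᵐ ω ∂P, ω ∈ A) : MeasurableSet[𝓕 t] A := by
  have := (h𝓕.measurableSet_of_null t Aᶜ hA).compl
  rwa [compl_compl] at this

lemma UsualConditions.measurable_of_ae_eq (h𝓕 : UsualConditions 𝓕 P) {t : ℝ≥0} {f g : Ω → ℝ}
    (hg : Measurable[𝓕 t] g) (hfg : f =ᵐ[P] g) : Measurable[𝓕 t] f :=
  measurable_of_ae_eq_of_complete (h𝓕.measurableSet_of_null t) hg hfg

/-- A right-continuous adapted process has a jointly measurable version. -/
lemma UsualConditions.exists_measurable_version (h𝓕 : UsualConditions 𝓕 P) {T : ℝ≥0}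
    {Z : ℝ≥0 → Ω → ℝ} (hZ : ∀ t ≤ T, Measurable[𝓕 t] (Z t))
    (hr : ∀ᵐ ω ∂P, ∀ t < T, ContinuousWithinAt (fun s => Z s ω) (Set.Ioi t) t) :
    ∃ Z' : ℝ → Ω → ℝ, Measurable[borel ℝ |>.prod (𝓕 T)] (Function.uncurry Z') ∧
      (∀ t : ℝ, t ≤ T → Measurable[𝓕 t.toNNReal] (Z' t)) ∧
      ∀ᵐ ω ∂P, ∀ t : ℝ, t ≤ T → Z' t ω = path Z ω t := by
  set A : Set Ω := {ω | ∀ t < T, ContinuousWithinAt (fun s => Z s ω) (Set.Ioi t) t} with hA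
  refine ⟨regularize A T Z, ?_, fun t ht => ?_, ?_⟩
  · rw [← BorelSpace.measurable_eq (α := ℝ)]
    exact @measurable_uncurry_of_rightContinuous Ω (𝓕 T) _
      (fun t => measurable_regularize (h𝓕.measurableSet_of_ae T hr) t
        ((hZ _ (min_le_right _ _)).mono (𝓕.mono (min_le_right _ _)) le_rfl))
      (rightContinuous_regularize fun ω hω => hω)
  · have h : t.toNNReal ≤ T := Real.toNNReal_le_iff_le_coe.2 ht
    refine measurable_regularize (h𝓕.measurableSet_of_ae _ hr) t ?_
    rw [min_eq_left h]
    exact hZ _ h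
  · filter_upwards [hr] with ω hω t ht using regularize_eq (A := A) hω ht

/-- The version regularized on `[0, t]` is jointly measurable with respect to `𝓕 t`, so the partial
integral is `𝓕 t`-measurable. The null set where the version fails belongs to `𝓕 t` by completeness.
-/
lemma UsualConditions.measurable_integral (h𝓕 : UsualConditions 𝓕 P) {t : ℝ≥0}
    {Z : ℝ≥0 → Ω → ℝ} (hZ : ∀ s ≤ t, Measurable[𝓕 s] (Z s))
    (hr : ∀ᵐ ω ∂P, ∀ s < t, ContinuousWithinAt (fun s => Z s ω) (Set.Ioi s) s) {φ : ℝ → ℝ}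
    (hφ : Measurable φ) : Measurable[𝓕 t] fun ω => ∫ s in (0 : ℝ)..t, path Z ω s * φ s := by
  obtain ⟨Z', hZ', -, heq⟩ := h𝓕.exists_measurable_version hZ hr
  rw [← BorelSpace.measurable_eq (α := ℝ)] at hZ'
  refine h𝓕.measurable_of_ae_eq (@measurable_intervalIntegral Ω (𝓕 t) Z' hZ' φ hφ 0 t) ?_
  filter_upwards [heq] with ω hω
  refine intervalIntegral.integral_congr fun s hs => ?_
  rw [Set.uIcc_of_le t.coe_nonneg] at hs
  simp only [hω s hs.2]

end

/-! ### Drivers with square-integrable supremum -/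

section

variable {Ω : Type*} {mΩ : MeasurableSpace Ω}

/-- The uncountable supremum is replaced by a measurable one over a dense sequence, and
right-continuity carries the bound to all times. The endpoint `T` is added by hand, having no right
neighbourhood inside `[0, T]`. -/
lemma exists_sup_bound {P : Measure Ω} {S : ℝ≥0 → Ω → ℝ} {T : ℝ≥0} (hSm : ∀ t, Measurable (S t))
    (hS : ∀ᵐ ω ∂P, ∀ t < T, ContinuousWithinAt (fun s => S s ω) (Set.Ioi t) t)
    (hS2 : ∫⁻ ω, (⨆ t ∈ Set.Icc 0 T, ‖S t ω‖ₑ) ^ 2 ∂P < ⊤) :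
    ∃ B : Ω → ℝ, MemLp B 2 P ∧ ∀ᵐ ω ∂P, ∀ t ≤ T, |S t ω| ≤ B ω := by
  set q : ℕ → ℝ≥0 := TopologicalSpace.denseSeq ℝ≥0 with hq
  set M : Ω → ℝ≥0∞ := fun ω => max (⨆ n, ‖S (min (q n) T) ω‖ₑ) ‖S T ω‖ₑ with hM
  have hMm : Measurable M := (Measurable.iSup fun n => (hSm _).enorm).max (hSm T).enorm
  have hle : ∀ ω, M ω ≤ ⨆ t ∈ Set.Icc 0 T, ‖S t ω‖ₑ := by
    have h1 : ∀ ω, ∀ t ≤ T, ‖S t ω‖ₑ ≤ ⨆ t ∈ Set.Icc 0 T, ‖S t ω‖ₑ := fun ω t ht =>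
      le_iSup₂ (f := fun t (_ : t ∈ Set.Icc 0 T) => ‖S t ω‖ₑ) t ⟨zero_le, ht⟩
    exact fun ω => max_le (iSup_le fun n => h1 ω _ (min_le_right _ _)) (h1 ω T le_rfl)
  have hM2 : ∫⁻ ω, M ω ^ 2 ∂P < ⊤ :=
    (lintegral_mono fun ω => pow_le_pow_left' (hle ω) 2).trans_lt hS2
  have hfin : ∀ᵐ ω ∂P, M ω < ⊤ := by
    filter_upwards [ae_lt_top (hMm.pow_const 2) hM2.ne] with ω hω
    exact lt_of_not_ge fun h => by simp [top_le_iff.1 h] at hω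
  refine ⟨fun ω => (M ω).toReal, ⟨hMm.ennreal_toReal.aestronglyMeasurable, ?_⟩, ?_⟩
  · rw [eLpNorm_lt_top_iff_lintegral_rpow_enorm_lt_top (by norm_num) (by norm_num)]
    refine (lintegral_mono fun ω => ?_).trans_lt hM2
    simp only [ENNReal.toReal_ofNat, ENNReal.rpow_ofNat]
    gcongr
    rw [← ofReal_norm, Real.norm_of_nonneg ENNReal.toReal_nonneg]
    exact ENNReal.ofReal_toReal_le
  · filter_upwards [hS, hfin] with ω hr hω t ht
    have key : ‖S t ω‖ₑ ≤ M ω := by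
      rcases ht.eq_or_lt with rfl | hlt
      · exact le_max_right _ _
      by_contra! hcon
      have hev : ∀ᶠ s in 𝓝[>] t, M ω < ‖S s ω‖ₑ := (hr t hlt).enorm.eventually (Ioi_mem_nhds hcon)
      obtain ⟨u, hu, hsub⟩ := (mem_nhdsGT_iff_exists_Ioo_subset).1 hev
      obtain ⟨v, ⟨n, rfl⟩, hv⟩ := (TopologicalSpace.denseRange_denseSeq ℝ≥0).exists_between
        (lt_min hu hlt)
      have h1 : M ω < ‖S (q n) ω‖ₑ := hsub ⟨hv.1, hv.2.trans_le (min_le_left _ _)⟩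
      have h2 : min (q n) T = q n := min_eq_left (hv.2.le.trans (min_le_right _ _))
      refine absurd h1 (not_lt.2 (le_max_of_le_left ?_))
      have := le_iSup (fun n => ‖S (min (q n) T) ω‖ₑ) n
      rwa [h2] at this
    rw [← Real.norm_eq_abs, ← toReal_enorm]
    exact ENNReal.toReal_mono hω.ne key

/-- An adapted right-continuous process, null at `0`, whose supremum on `[0, T]` is dominated by the
square-integrable random variable `B`. -/
structure IsBoundedDriver (𝓕 : Filtration ℝ≥0 mΩ) (P : Measure Ω) (T : ℝ≥0) (Y : ℝ≥0 → Ω → ℝ)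
    (B : Ω → ℝ) : Prop where
  adapted : ∀ t ≤ T, Measurable[𝓕 t] (Y t)
  start : ∀ ω, Y 0 ω = 0
  memLp : MemLp B 2 P
  bound : ∀ᵐ ω ∂P, ∀ t ≤ T, |Y t ω| ≤ B ω
  rightContinuous : ∀ᵐ ω ∂P, ∀ t < T, ContinuousWithinAt (fun s => Y s ω) (Set.Ioi t) t

variable {P : Measure Ω} {𝓕 : Filtration ℝ≥0 mΩ}

lemma aestronglyMeasurable_path {Z : ℝ≥0 → Ω → ℝ} {ω : Ω} {T : ℝ≥0}
    (hr : ∀ t < T, ContinuousWithinAt (fun s => Z s ω) (Set.Ioi t) t) :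
    AEStronglyMeasurable (path Z ω) (volume.restrict (Set.uIoc 0 (T : ℝ))) := by
  have h1 := measurable_uncurry_of_rightContinuous (Ω := Unit)
    (Z := fun t _ => regularize {ω} T Z t ω) (fun t => measurable_const)
    (fun _ => rightContinuous_regularize (A := {ω}) (fun ω' h t ht => by
      rw [Set.mem_singleton_iff.1 h]; exact hr t ht) ω)
  have h2 : Measurable fun t => regularize {ω} T Z t ω :=
    h1.comp (measurable_id.prodMk (measurable_const (a := ())))
  refine h2.aestronglyMeasurable.congr ?_
  refine (ae_restrict_mem measurableSet_uIoc).mono fun t ht => ?_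
  rw [Set.uIoc_of_le T.coe_nonneg] at ht
  exact regularize_eq (Set.mem_singleton ω) ht.2

lemma rightContinuous_primitive {f : ℝ → ℝ} {T t : ℝ≥0} (hf : IntervalIntegrable f volume 0 T)
    (ht : t < T) :
    ContinuousWithinAt (fun s : ℝ≥0 => ∫ u in (0 : ℝ)..s, f u) (Set.Ioi t) t := by
  have hcont := intervalIntegral.continuousOn_primitive_interval
    (by rwa [Set.uIcc_of_le T.coe_nonneg, integrableOn_Icc_iff_integrableOn_Ioc,
      ← intervalIntegrable_iff_integrableOn_Ioc_of_le T.coe_nonneg] :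
      IntegrableOn f (Set.uIcc 0 (T : ℝ)) volume)
  rw [Set.uIcc_of_le T.coe_nonneg] at hcont
  have h1 : ContinuousWithinAt (fun s : ℝ≥0 => ∫ u in (0 : ℝ)..s, f u) (Set.Icc 0 T) t :=
    (hcont t ⟨t.coe_nonneg, by exact_mod_cast ht.le⟩).comp
      NNReal.continuous_coe.continuousWithinAt
      fun s hs => ⟨s.coe_nonneg, by exact_mod_cast hs.2⟩
  refine h1.mono_of_mem_nhdsWithin ?_
  exact mem_of_superset (Ioo_mem_nhdsGT ht) fun s hs => ⟨zero_le, hs.2.le⟩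

lemma abs_path_le {Z : ℝ≥0 → Ω → ℝ} {ω : Ω} {T : ℝ≥0} {K : ℝ} (h : ∀ t ≤ T, |Z t ω| ≤ K) :
    ∀ t ∈ Set.Icc 0 (T : ℝ), |path Z ω t| ≤ K :=
  fun _ ht => h _ (Real.toNNReal_le_iff_le_coe.2 ht.2)

lemma path_coe (Z : ℝ≥0 → Ω → ℝ) (ω : Ω) (t : ℝ≥0) : path Z ω t = Z t ω := by simp [path]

lemma path_zero (Z : ℝ≥0 → Ω → ℝ) (ω : Ω) : path Z ω 0 = Z 0 ω := by simp [path]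

/-- `∫_0^t c dY`, after partial integration. -/
def partsIntegral (c d : ℝ → ℝ) (Y : ℝ≥0 → Ω → ℝ) (t : ℝ≥0) (ω : Ω) : ℝ :=
  c t * Y t ω + ∫ u in (0 : ℝ)..t, path Y ω u * d u

namespace IsBoundedDriver

variable {T : ℝ≥0} {Y : ℝ≥0 → Ω → ℝ} {B : Ω → ℝ} {ν : ℝ} {c d : ℝ → ℝ}

section

variable (hY : IsBoundedDriver 𝓕 P T Y B) (hk : IsRiccatiKernel T ν c d)

include hY hk

lemma isStochIntegral [IsProbabilityMeasure P] {t : ℝ≥0} (ht : t ≤ T) :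
    IsStochIntegral P c Y t (partsIntegral c d Y t) := by
  refine isStochIntegral_of_paths hk.deriv_c hk.continuous_d (fun s hs =>
    ((hY.adapted s (hs.trans ht)).mono (𝓕.le s) le_rfl).aestronglyMeasurable) ?_
  filter_upwards [hY.bound, hY.rightContinuous] with ω hb hr
  exact ⟨hY.start ω, ⟨B ω, fun s hs => hb s (hs.trans ht)⟩, fun s hs => hr s (hs.trans_le ht)⟩

lemma stochIntegral_ae_eq [IsProbabilityMeasure P] {t : ℝ≥0} (ht : t ≤ T) :
    stochIntegral P c Y t =ᵐ[P] partsIntegral c d Y t :=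
  OptimalExecution.stochIntegral_ae_eq (hY.isStochIntegral hk ht)

lemma measurable_partsIntegral (h𝓕 : UsualConditions 𝓕 P) {t : ℝ≥0} (ht : t ≤ T) :
    Measurable[𝓕 t] (partsIntegral c d Y t) :=
  ((hY.adapted t ht).const_mul (c t)).add
    (h𝓕.measurable_integral (fun s hs => hY.adapted s (hs.trans ht))
      (hY.rightContinuous.mono fun _ hω s hs => hω s (hs.trans_le ht)) hk.continuous_d.measurable)

lemma remainder_ae_eq :
    ∀ᵐ ω ∂P, ∀ t ≤ T, IsRiccatiKernel.remainder T c d (path Y ω) t =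
      partsIntegral c d Y T ω - partsIntegral c d Y t ω := by
  filter_upwards [hY.bound, hY.rightContinuous] with ω hb hr t ht
  have hi := hk.intervalIntegrable_mul_d (aestronglyMeasurable_path hr) (abs_path_le hb)
  have ht' : (t : ℝ) ∈ Set.Icc 0 (T : ℝ) := ⟨t.coe_nonneg, by exact_mod_cast ht⟩
  have := intervalIntegral.integral_add_adjacent_intervals
    (intervalIntegrable_sub_left ht' hi) (intervalIntegrable_sub_right ht' hi)
  simp only [IsRiccatiKernel.remainder, partsIntegral, hk.c_finish, path_coe]
  linarith

lemma memLp_remainder_div (h𝓕 : UsualConditions 𝓕 P) : ∃ C : ℝ, 0 ≤ C ∧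
    (∀ᵐ ω ∂P, ∀ t ∈ Set.Icc 0 (T : ℝ),
      |IsRiccatiKernel.remainder T c d (path Y ω) t / c t| ≤ C * B ω) ∧
    ∀ t ≤ T, MemLp (fun ω => IsRiccatiKernel.remainder T c d (path Y ω) t / c t) 2 P := by
  obtain ⟨m, hm, D, hD, hmd, hdD, hmc, hcD⟩ := hk.exists_bounds
  have hb : ∀ᵐ ω ∂P, ∀ t ∈ Set.Icc 0 (T : ℝ),
      |IsRiccatiKernel.remainder T c d (path Y ω) t / c t| ≤ (1 + D / m) * B ω := by
    filter_upwards [hY.bound] with ω hω t ht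
    exact hk.abs_remainder_div_le (abs_path_le hω) hm hdD hmc ht
  refine ⟨1 + D / m, by positivity, hb, fun t ht => ?_⟩
  refine (hY.memLp.const_mul (1 + D / m)).mono' ?_ ?_
  · have hmeas : Measurable fun ω => (partsIntegral c d Y T ω - partsIntegral c d Y t ω) / c t :=
      (((hY.measurable_partsIntegral hk h𝓕 le_rfl).mono (𝓕.le T) le_rfl).sub
        ((hY.measurable_partsIntegral hk h𝓕 ht).mono (𝓕.le t) le_rfl)).div_const _
    refine hmeas.aestronglyMeasurable.congr ?_
    filter_upwards [hY.remainder_ae_eq hk] with ω hω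
    rw [hω t ht]
  · filter_upwards [hb] with ω hω
    exact hω t ⟨t.coe_nonneg, by exact_mod_cast ht⟩

lemma memLp_remainder (h𝓕 : UsualConditions 𝓕 P) {t : ℝ≥0} (ht : t ≤ T) :
    MemLp (fun ω => IsRiccatiKernel.remainder T c d (path Y ω) t) 2 P := by
  obtain ⟨C, -, -, h⟩ := hY.memLp_remainder_div hk h𝓕
  rcases ht.eq_or_lt with rfl | hlt
  · have : (fun ω => IsRiccatiKernel.remainder t c d (path Y ω) t) = fun _ => (0 : ℝ) := by
      funext ω
      simp [IsRiccatiKernel.remainder, hk.c_finish]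
    rw [this]
    exact MemLp.zero
  · have hc := (hk.c_pos ⟨t.coe_nonneg, by exact_mod_cast hlt⟩).ne'
    convert (h t ht).const_mul (c t) using 2 with ω
    field_simp

/-- The integral over `(0, t]` is the difference of the remainders at `0` and at `t`, since `Y 0 =
0`. -/
lemma memLp_partsIntegral (h𝓕 : UsualConditions 𝓕 P) {t : ℝ≥0} (ht : t ≤ T) :
    MemLp (partsIntegral c d Y t) 2 P := by
  have h0 := hY.memLp_remainder hk h𝓕 (t := 0) zero_le
  have h1 := hY.memLp_remainder hk h𝓕 ht
  refine (h0.sub h1).ae_eq ?_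
  filter_upwards [hY.remainder_ae_eq hk] with ω hω
  simp only [Pi.sub_apply, hω 0 zero_le, hω t ht]
  simp [partsIntegral, hY.start ω]

lemma condTail_ae_eq [IsProbabilityMeasure P] {t : ℝ≥0} (ht : t ≤ T) :
    condTail 𝓕 P c Y T t =ᵐ[P]
      P[fun ω => IsRiccatiKernel.remainder T c d (path Y ω) t | 𝓕 t] := by
  refine condExp_congr_ae ?_
  filter_upwards [hY.remainder_ae_eq hk, hY.stochIntegral_ae_eq hk ht,
    hY.stochIntegral_ae_eq hk le_rfl] with ω h1 h2 h3
  rw [Pi.sub_apply, h2, h3, h1 t ht]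

lemma rightContinuous_partsIntegral : ∀ᵐ ω ∂P, ∀ t < T,
    ContinuousWithinAt (fun s => partsIntegral c d Y s ω) (Set.Ioi t) t := by
  filter_upwards [hY.bound, hY.rightContinuous] with ω hb hr t ht
  have hi := hk.intervalIntegrable_mul_d (aestronglyMeasurable_path hr) (abs_path_le hb)
  exact ((hk.continuous_c.comp NNReal.continuous_coe).continuousWithinAt.mul (hr t ht)).add
    (rightContinuous_primitive hi ht)

/-- The conditional tail is the closed martingale of `∫_0^T c dY` minus the integral up to `t`,
which is adapted and already right-continuous. Only the martingale needs regularizing. -/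
lemma exists_rightContVersion [IsProbabilityMeasure P] (h𝓕 : UsualConditions 𝓕 P) :
    ∃ H, IsRightContVersion P T (condTail 𝓕 P c Y T) H := by
  have hI : Integrable (partsIntegral c d Y T) P :=
    (hY.memLp_partsIntegral hk h𝓕 le_rfl).integrable one_le_two
  refine ⟨fun t ω => rightLimitMartingale P 𝓕 (partsIntegral c d Y T) t ω - partsIntegral c d Y t ω,
    fun t ht => ?_, ?_⟩
  · have hIt := hY.memLp_partsIntegral hk h𝓕 ht
    have h1 : P[fun ω => IsRiccatiKernel.remainder T c d (path Y ω) t | 𝓕 t] =ᵐ[P]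
        P[partsIntegral c d Y T - partsIntegral c d Y t | 𝓕 t] := by
      refine condExp_congr_ae ?_
      filter_upwards [hY.remainder_ae_eq hk] with ω hω using hω t ht
    have h2 := condExp_sub (m := 𝓕 t) hI (hIt.integrable one_le_two)
    have h3 := condExp_of_stronglyMeasurable (𝓕.le t)
      (hY.measurable_partsIntegral hk h𝓕 ht).stronglyMeasurable (hIt.integrable one_le_two)
    rw [h3] at h2
    filter_upwards [hY.condTail_ae_eq hk ht, h1, h2,
      rightLimitMartingale_ae_eq h𝓕.rightContinuous hI t] with ω e1 e2 e3 e4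
    rw [e1, e2, e3, Pi.sub_apply, e4]
  · filter_upwards [ae_rightContinuous_rightLimitMartingale (𝓕 := 𝓕) hI,
      hY.rightContinuous_partsIntegral hk] with ω h1 h2 t ht
    exact (h1 t).sub (h2 t ht)

end

end IsBoundedDriver

end

end

section

variable {Ω : Type*} {mΩ : MeasurableSpace Ω} {P : Measure Ω} {𝓕 : Filtration ℝ≥0 mΩ}

/-! ### Processes as functions on the product space -/

/-- The product of `P` and the Lebesgue measure on `(0, T]`. -/
def timeProd (P : Measure Ω) (T : ℝ≥0) : Measure (Ω × ℝ) :=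
  P.prod (volume.restrict (Set.Ioc 0 (T : ℝ)))

lemma lintegral_enorm_sq_eq (f : Ω → ℝ) : ∫⁻ ω, ‖f ω‖ₑ ^ 2 ∂P = eLpNorm f 2 P ^ 2 := by
  have := eLpNorm_nnreal_pow_eq_lintegral (μ := P) (f := f) (p := 2) (by norm_num)
  simpa using this.symm

lemma memLp_two_iff_lintegral {α : Type*} {mα : MeasurableSpace α} {μ : Measure α} {f : α → ℝ}
    (hf : AEStronglyMeasurable f μ) : MemLp f 2 μ ↔ ∫⁻ x, ‖f x‖ₑ ^ 2 ∂μ < ⊤ := by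
  rw [lintegral_enorm_sq_eq]
  simp [MemLp, hf]

lemma memLp_timeProd [IsProbabilityMeasure P] {T : ℝ≥0} {f : ℝ → Ω → ℝ}
    (hf : Measurable (Function.uncurry f)) {C : ℝ≥0∞} (hC : C ≠ ⊤)
    (hle : ∀ t ∈ Set.Ioc 0 (T : ℝ), eLpNorm (f t) 2 P ≤ C) :
    MemLp (fun p : Ω × ℝ => f p.2 p.1) 2 (timeProd P T) := by
  have hm : Measurable fun p : Ω × ℝ => f p.2 p.1 := hf.comp measurable_swap
  rw [memLp_two_iff_lintegral hm.aestronglyMeasurable, timeProd,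
    lintegral_prod_symm _ (hm.enorm.pow_const 2).aemeasurable]
  calc ∫⁻ t in Set.Ioc 0 (T : ℝ), ∫⁻ ω, ‖f t ω‖ₑ ^ 2 ∂P
      ≤ ∫⁻ _ in Set.Ioc 0 (T : ℝ), C ^ 2 := by
        refine setLIntegral_mono measurable_const fun t ht => ?_
        rw [lintegral_enorm_sq_eq]
        exact pow_le_pow_left' (hle t ht) 2
    _ < ⊤ := by
        rw [lintegral_const]
        exact ENNReal.mul_lt_top (by simpa using hC.lt_top) (by simp)

lemma integral_timeProd [IsProbabilityMeasure P] {T : ℝ≥0} {f : Ω × ℝ → ℝ}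
    (hf : Integrable f (timeProd P T)) :
    ∫ p, f p ∂(timeProd P T) = ∫ ω, (∫ t in (0 : ℝ)..T, f (ω, t)) ∂P := by
  simp_rw [intervalIntegral.integral_of_le T.coe_nonneg]
  exact integral_prod f hf

lemma integrable_integral_timeProd {T : ℝ≥0} {f : Ω × ℝ → ℝ}
    (hf : Integrable f (timeProd P T)) :
    Integrable (fun ω => ∫ t in (0 : ℝ)..T, f (ω, t)) P := by
  simp_rw [intervalIntegral.integral_of_le T.coe_nonneg]
  exact hf.integral_prod_left

lemma intervalIntegrable_timeProd [IsProbabilityMeasure P] {T : ℝ≥0} {f : Ω × ℝ → ℝ}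
    (hf : Integrable f (timeProd P T)) :
    ∀ᵐ ω ∂P, IntervalIntegrable (fun t => f (ω, t)) volume 0 T := by
  simp_rw [intervalIntegrable_iff_integrableOn_Ioc_of_le T.coe_nonneg]
  exact hf.prod_right_ae

/-- An adapted integrand does not distinguish a process from its conditional expectations. -/
lemma integral_mul_eq_of_condExp [IsProbabilityMeasure P] {T : ℝ≥0} {R H w : ℝ → Ω → ℝ}
    (hR : MemLp (fun p : Ω × ℝ => R p.2 p.1) 2 (timeProd P T))
    (hH : MemLp (fun p : Ω × ℝ => H p.2 p.1) 2 (timeProd P T))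
    (hw : MemLp (fun p : Ω × ℝ => w p.2 p.1) 2 (timeProd P T))
    (hwa : ∀ t ∈ Set.Ioc 0 (T : ℝ), Measurable[𝓕 t.toNNReal] (w t))
    (hRi : ∀ t ∈ Set.Ioc 0 (T : ℝ), Integrable (R t) P)
    (hRH : ∀ t ∈ Set.Ioc 0 (T : ℝ), H t =ᵐ[P] P[R t | 𝓕 t.toNNReal]) :
    ∫ p, w p.2 p.1 * R p.2 p.1 ∂(timeProd P T) = ∫ p, w p.2 p.1 * H p.2 p.1 ∂(timeProd P T) := by
  have h1 : Integrable (fun p : Ω × ℝ => w p.2 p.1 * R p.2 p.1) (timeProd P T) :=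
    hw.integrable_mul hR
  have h2 : Integrable (fun p : Ω × ℝ => w p.2 p.1 * H p.2 p.1) (timeProd P T) :=
    hw.integrable_mul hH
  rw [timeProd] at h1 h2 ⊢
  rw [integral_prod_symm _ h1, integral_prod_symm _ h2]
  refine integral_congr_ae ?_
  filter_upwards [h1.prod_left_ae, ae_restrict_mem measurableSet_Ioc] with t ht hmem
  have h3 := condExp_mul_of_stronglyMeasurable_left (hwa t hmem).stronglyMeasurable
    (show Integrable (w t * R t) P from ht) (hRi t hmem)
  calc ∫ ω, w t ω * R t ω ∂P = ∫ ω, (P[w t * R t | 𝓕 t.toNNReal]) ω ∂P :=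
        (integral_condExp (𝓕.le _)).symm
    _ = ∫ ω, w t ω * H t ω ∂P := by
        refine integral_congr_ae ?_
        filter_upwards [h3, hRH t hmem] with ω e1 e2
        rw [e1, Pi.mul_apply, e2]

/-! ### The conditional tail process -/

lemma IsRightContVersion.measurable {T : ℝ≥0} {ξ : ℝ → ℝ} {Y H : ℝ≥0 → Ω → ℝ}
    (hH : IsRightContVersion P T (condTail 𝓕 P ξ Y T) H) (h𝓕 : UsualConditions 𝓕 P) {t : ℝ≥0}
    (ht : t ≤ T) : Measurable[𝓕 t] (H t) :=
  h𝓕.measurable_of_ae_eq stronglyMeasurable_condExp.measurable (hH.version t ht)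

namespace IsBoundedDriver

variable {T : ℝ≥0} {Y : ℝ≥0 → Ω → ℝ} {B : Ω → ℝ} {ν : ℝ} {c d : ℝ → ℝ} {H : ℝ≥0 → Ω → ℝ}
  [IsProbabilityMeasure P]

variable (hY : IsBoundedDriver 𝓕 P T Y B) (hk : IsRiccatiKernel T ν c d)
  (h𝓕 : UsualConditions 𝓕 P)

include hY hk h𝓕

lemma exists_remainder_version : ∃ R : ℝ → Ω → ℝ,
    (∀ᵐ ω ∂P, ∀ t ∈ Set.Icc 0 (T : ℝ),
      R t ω = IsRiccatiKernel.remainder T c d (path Y ω) t / c t) ∧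
    (∀ t ∈ Set.Ioc 0 (T : ℝ), Integrable (R t) P) ∧
    MemLp (fun p : Ω × ℝ => R p.2 p.1) 2 (timeProd P T) := by
  obtain ⟨I, hI, -, hIeq⟩ := h𝓕.exists_measurable_version
    (fun t ht => hY.measurable_partsIntegral hk h𝓕 ht) (hY.rightContinuous_partsIntegral hk)
  obtain ⟨C, hC, hbd, hL⟩ := hY.memLp_remainder_div hk h𝓕
  rw [← BorelSpace.measurable_eq (α := ℝ)] at hI
  have hI' : Measurable (Function.uncurry I) :=
    hI.mono (sup_le_sup le_rfl (MeasurableSpace.comap_mono (𝓕.le T))) le_rfl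
  have hIT := (hY.measurable_partsIntegral hk h𝓕 le_rfl).mono (𝓕.le T) le_rfl
  have heq : ∀ᵐ ω ∂P, ∀ t ∈ Set.Icc 0 (T : ℝ), (partsIntegral c d Y T ω - I t ω) / c t =
      IsRiccatiKernel.remainder T c d (path Y ω) t / c t := by
    filter_upwards [hIeq, hY.remainder_ae_eq hk] with ω h1 h2 t ht
    have h3 := h2 t.toNNReal (Real.toNNReal_le_iff_le_coe.2 ht.2)
    rw [Real.coe_toNNReal _ ht.1] at h3
    rw [h3, h1 t ht.2, path]
  have hmeas : Measurable (Function.uncurry fun t ω => (partsIntegral c d Y T ω - I t ω) / c t) :=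
    ((hIT.comp measurable_snd).sub hI').div (hk.continuous_c.measurable.comp measurable_fst)
  have hLp : ∀ t ∈ Set.Ioc 0 (T : ℝ),
      eLpNorm (fun ω => (partsIntegral c d Y T ω - I t ω) / c t) 2 P ≤
        eLpNorm (fun ω => C * B ω) 2 P := by
    intro t ht
    refine eLpNorm_mono_ae ?_
    filter_upwards [heq, hbd] with ω h1 h2
    rw [h1 t ⟨ht.1.le, ht.2⟩, Real.norm_eq_abs, Real.norm_eq_abs]
    exact (h2 t ⟨ht.1.le, ht.2⟩).trans (le_abs_self _)
  have hCB : MemLp (fun ω => C * B ω) 2 P := hY.memLp.const_mul C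
  refine ⟨fun t ω => (partsIntegral c d Y T ω - I t ω) / c t, heq, fun t ht => ?_,
    memLp_timeProd hmeas hCB.2.ne hLp⟩
  exact MemLp.integrable (q := 2) one_le_two
    ⟨(hmeas.comp measurable_prodMk_left).aestronglyMeasurable, (hLp t ht).trans_lt hCB.2⟩

/-- Division by the deterministic `c t` commutes with conditioning, and conditioning contracts `L²`.
The bound on `R` that is uniform in time thus passes to `K / c`, up to `T`. -/
lemma exists_tail_version (hH : IsRightContVersion P T (condTail 𝓕 P c Y T) H) {R : ℝ → Ω → ℝ}
    (hR : ∀ᵐ ω ∂P, ∀ t ∈ Set.Icc 0 (T : ℝ),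
      R t ω = IsRiccatiKernel.remainder T c d (path Y ω) t / c t) : ∃ h : ℝ → Ω → ℝ,
    Measurable (Function.uncurry h) ∧
    (∀ᵐ ω ∂P, ∀ t ≤ (T : ℝ), h t ω = path H ω t / c t) ∧
    (∀ t ∈ Set.Ioc 0 (T : ℝ), h t =ᵐ[P] P[R t | 𝓕 t.toNNReal]) ∧
    MemLp (fun p : Ω × ℝ => h p.2 p.1) 2 (timeProd P T) := by
  obtain ⟨H', hH', -, heq⟩ := h𝓕.exists_measurable_version
    (fun t ht => hH.measurable h𝓕 ht) hH.rightContinuous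
  obtain ⟨C, hC, hbd, hL⟩ := hY.memLp_remainder_div hk h𝓕
  rw [← BorelSpace.measurable_eq (α := ℝ)] at hH'
  have hHm : Measurable (Function.uncurry H') :=
    hH'.mono (sup_le_sup le_rfl (MeasurableSpace.comap_mono (𝓕.le T))) le_rfl
  have hmeas : Measurable (Function.uncurry fun t ω => H' t ω / c t) :=
    hHm.div (hk.continuous_c.measurable.comp measurable_fst)
  have hcond : ∀ t ∈ Set.Ioc 0 (T : ℝ),
      (fun ω => H' t ω / c t) =ᵐ[P] P[R t | 𝓕 t.toNNReal] := by
    intro t ht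
    have htT : t.toNNReal ≤ T := Real.toNNReal_le_iff_le_coe.2 ht.2
    have htc : ((t.toNNReal : ℝ≥0) : ℝ) = t := Real.coe_toNNReal _ ht.1.le
    have h1 : R t =ᵐ[P] (c t)⁻¹ • fun ω =>
        IsRiccatiKernel.remainder T c d (path Y ω) (t.toNNReal : ℝ) := by
      filter_upwards [hR] with ω hω
      rw [hω t ⟨ht.1.le, ht.2⟩, Pi.smul_apply, smul_eq_mul, htc, div_eq_inv_mul]
    have h2 := condExp_smul (μ := P) (c t)⁻¹ (fun ω =>
        IsRiccatiKernel.remainder T c d (path Y ω) (t.toNNReal : ℝ)) (𝓕 t.toNNReal)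
    filter_upwards [heq, hH.version _ htT, hY.condTail_ae_eq hk htT,
      condExp_congr_ae (m := 𝓕 t.toNNReal) h1, h2] with ω e1 e2 e3 e4 e5
    rw [e1 t ht.2, path, e2, e3, e4, e5, Pi.smul_apply, smul_eq_mul, div_eq_inv_mul]
  have hCB : MemLp (fun ω => C * B ω) 2 P := hY.memLp.const_mul C
  refine ⟨fun t ω => H' t ω / c t, hmeas, ?_, hcond, memLp_timeProd hmeas hCB.2.ne fun t ht => ?_⟩
  · filter_upwards [heq] with ω hω t ht
    rw [hω t ht]
  · refine (eLpNorm_congr_ae (hcond t ht)).trans_le ?_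
    refine (eLpNorm_condExp_le_eLpNorm _ one_le_two).trans (eLpNorm_mono_ae ?_)
    filter_upwards [hR, hbd] with ω h1 h2
    rw [h1 t ⟨ht.1.le, ht.2⟩, Real.norm_eq_abs, Real.norm_eq_abs]
    exact (h2 t ⟨ht.1.le, ht.2⟩).trans (le_abs_self _)

end IsBoundedDriver

/-! ### Admissible strategies -/

namespace IsAdmissible

variable {T : ℝ≥0} {X : ℝ} {x : ℝ≥0 → Ω → ℝ}

/-- The time derivative of an admissible strategy has an adapted and jointly measurable version. -/
lemma exists_deriv_version (hx : IsAdmissible 𝓕 P T X x) (h𝓕 : UsualConditions 𝓕 P) :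
    ∃ x' g : ℝ → Ω → ℝ,
      Measurable (Function.uncurry x') ∧ Measurable (Function.uncurry g) ∧
      (∀ t ∈ Set.Ioc 0 (T : ℝ), Measurable[𝓕 t.toNNReal] (x' t)) ∧
      (∀ t ∈ Set.Ioc 0 (T : ℝ), Measurable[𝓕 t.toNNReal] (g t)) ∧
      (∀ᵐ ω ∂P, ∀ t ≤ (T : ℝ), x' t ω = path x ω t) ∧
      ∀ᵐ ω ∂P, ∀ᵐ t, t ∈ Set.uIoc 0 (T : ℝ) → g t ω = deriv (path x ω) t := by
  set A : Set Ω := {ω | AbsolutelyContinuousOnInterval (path x ω) 0 T} with hA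
  have hAae : ∀ᵐ ω ∂P, ω ∈ A := hx.absolutelyContinuous
  set x' := regularize A T x with hx'
  have had : ∀ s t : ℝ, s ≤ t → t ≤ T → Measurable[𝓕 t.toNNReal] (x' s) := by
    intro s t hst ht
    have hle : min s.toNNReal T ≤ t.toNNReal :=
      (min_le_left _ _).trans (Real.toNNReal_mono hst)
    exact measurable_regularize (h𝓕.measurableSet_of_ae _ hAae) s
      (((hx.adapted _ (min_le_right _ _)).measurable).mono (𝓕.mono hle) le_rfl)
  have hmeas : ∀ t, Measurable (x' t) := fun t =>
    measurable_regularize (𝓕.le 0 _ (h𝓕.measurableSet_of_ae 0 hAae)) t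
      (((hx.adapted _ (min_le_right _ _)).measurable).mono (𝓕.le _) le_rfl)
  have hcont : ∀ ω, Continuous fun t => x' t ω := by
    intro ω
    by_cases hω : ω ∈ A
    · have h1 : ContinuousOn (path x ω) (Set.Icc 0 (T : ℝ)) := by
        have := AbsolutelyContinuousOnInterval.continuousOn (show
          AbsolutelyContinuousOnInterval (path x ω) 0 T from hω)
        rwa [Set.uIcc_of_le T.coe_nonneg] at this
      have h2 : (fun t => x' t ω) = fun t : ℝ => path x ω (min t.toNNReal T : ℝ≥0) := by
        funext t
        rw [hx', regularize, Set.indicator_of_mem hω, path_coe]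
      rw [h2]
      exact h1.comp_continuous (by fun_prop) fun t =>
        ⟨NNReal.coe_nonneg _, by exact_mod_cast min_le_right _ _⟩
    · have h2 : (fun t => x' t ω) = fun _ => 0 := by
        funext t
        rw [hx', regularize, Set.indicator_of_notMem hω]
      rw [h2]
      exact continuous_const
  have hjoint : Measurable (Function.uncurry x') :=
    measurable_uncurry_of_continuous_of_measurable hcont hmeas
  -- Difference quotients from the left see only the past, which makes the derivative adapted; the
  -- limsup is measurable even where no limit exists.
  refine ⟨x', fun t ω => limsup (fun n : ℕ =>
    (x' (t - 1 / (n + 1)) ω - x' t ω) / (t - 1 / (n + 1) - t)) atTop, hjoint, ?_,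
    fun t ht => had t t le_rfl ht.2, fun t ht => ?_, ?_, ?_⟩
  · refine Measurable.limsup fun n => ?_
    refine Measurable.div (Measurable.sub ?_ hjoint) (by fun_prop)
    exact hjoint.comp ((measurable_fst.sub_const (1 / ((n : ℝ) + 1))).prodMk measurable_snd)
  · refine Measurable.limsup fun n => ?_
    have hpos : (0 : ℝ) < 1 / (n + 1) := by positivity
    exact ((had _ t (by linarith) ht.2).sub (had t t le_rfl ht.2)).div_const _
  · filter_upwards [hAae] with ω hω t ht using regularize_eq hω ht
  · filter_upwards [hAae] with ω hω
    have hac : AbsolutelyContinuousOnInterval (path x ω) 0 T := hω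
    filter_upwards [hac.ae_differentiableAt] with t ht hmem
    have hd := (ht (Set.uIoc_subset_uIcc hmem)).hasDerivAt
    rw [Set.uIoc_of_le T.coe_nonneg] at hmem
    have hseq : Tendsto (fun n : ℕ => t - 1 / ((n : ℝ) + 1)) atTop (𝓝[≠] t) := by
      refine tendsto_nhdsWithin_iff.2 ⟨?_, Eventually.of_forall fun n => ?_⟩
      · simpa using (tendsto_one_div_add_atTop_nhds_zero_nat (𝕜 := ℝ)).const_sub t
      · have hpos : (0 : ℝ) < 1 / (n + 1) := by positivity
        exact fun h => by
          have : t - 1 / ((n : ℝ) + 1) = t := h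
          linarith
    refine ((hd.tendsto_slope.comp hseq).congr fun n => ?_).limsup_eq
    have hpos : (0 : ℝ) < 1 / (n + 1) := by positivity
    rw [Function.comp_apply, slope_def_field, hx', regularize_eq hω hmem.2,
      regularize_eq hω (by linarith [hmem.2])]

lemma lintegral_deriv_eq {f : ℝ → ℝ} (T : ℝ≥0) :
    ∫⁻ t in Set.Ioo (0 : ℝ) T, ENNReal.ofReal (f t ^ 2) =
      ∫⁻ t in Set.Ioc (0 : ℝ) T, ‖f t‖ₑ ^ 2 := by
  rw [Measure.restrict_congr_set Ioo_ae_eq_Ioc]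
  refine lintegral_congr fun t => ?_
  rw [← sq_abs, ENNReal.ofReal_pow (abs_nonneg _), ← Real.norm_eq_abs, ofReal_norm]

lemma ae_paths (hx : IsAdmissible 𝓕 P T X x) (h𝓕 : UsualConditions 𝓕 P) :
    ∀ᵐ ω ∂P, AbsolutelyContinuousOnInterval (path x ω) 0 T ∧ path x ω 0 = X ∧ path x ω T = 0 ∧
      IntervalIntegrable (fun t => deriv (path x ω) t ^ 2) volume 0 T := by
  obtain ⟨x', g, -, hg, -, -, -, hgd⟩ := hx.exists_deriv_version h𝓕
  have hgm : Measurable fun p : Ω × ℝ => ‖g p.2 p.1‖ₑ ^ 2 :=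
    (hg.comp measurable_swap).enorm.pow_const 2
  have heq : ∀ᵐ ω ∂P, ∫⁻ t in Set.Ioo (0 : ℝ) T, ENNReal.ofReal (deriv (path x ω) t ^ 2) =
      ∫⁻ t in Set.Ioc (0 : ℝ) T, ‖g t ω‖ₑ ^ 2 := by
    filter_upwards [hgd] with ω hω
    rw [lintegral_deriv_eq]
    refine lintegral_congr_ae ?_
    rw [Filter.EventuallyEq, ae_restrict_iff' measurableSet_Ioc]
    rw [Set.uIoc_of_le T.coe_nonneg] at hω
    filter_upwards [hω] with t ht hmem
    rw [ht hmem]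
  -- Passing from finite expectation to almost sure finiteness uses measurability in `ω`, which the
  -- jointly measurable `g` provides.
  have hfin : ∀ᵐ ω ∂P, ∫⁻ t in Set.Ioc (0 : ℝ) T, ‖g t ω‖ₑ ^ 2 < ⊤ := by
    refine ae_lt_top (hgm.lintegral_prod_right'
      (ν := volume.restrict (Set.Ioc (0 : ℝ) T))) ?_
    rw [← lintegral_congr_ae heq]
    exact hx.finite_energy.ne
  filter_upwards [hx.absolutelyContinuous, hx.start, hx.finish, heq, hfin] with ω h1 h2 h3 h4 h5
  refine ⟨h1, by rw [path_zero, h2], by rw [path_coe, h3], ?_⟩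
  rw [intervalIntegrable_iff_integrableOn_Ioc_of_le T.coe_nonneg, IntegrableOn,
    ← memLp_two_iff_integrable_sq (measurable_deriv _).aestronglyMeasurable,
    memLp_two_iff_lintegral (measurable_deriv _).aestronglyMeasurable, ← lintegral_deriv_eq, h4]
  exact h5

variable {ν : ℝ} {c d : ℝ → ℝ}

lemma exists_excess_version [IsProbabilityMeasure P] (hx : IsAdmissible 𝓕 P T X x)
    (h𝓕 : UsualConditions 𝓕 P) (hk : IsRiccatiKernel T ν c d) : ∃ w : ℝ → Ω → ℝ,
    Measurable (Function.uncurry w) ∧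
    (∀ t ∈ Set.Ioc 0 (T : ℝ), Measurable[𝓕 t.toNNReal] (w t)) ∧
    (∀ᵐ ω ∂P, ∀ᵐ t, t ∈ Set.uIoc 0 (T : ℝ) →
      w t ω = IsRiccatiKernel.excess c d (path x ω) t) ∧
    MemLp (fun p : Ω × ℝ => w p.2 p.1) 2 (timeProd P T) := by
  obtain ⟨x', g, hx', hg, hxa, hga, hxe, hge⟩ := hx.exists_deriv_version h𝓕
  have hm : Measurable (Function.uncurry fun t ω => g t ω + x' t ω * (d t / c t)) :=
    hg.add (hx'.mul ((hk.continuous_d.measurable.div hk.continuous_c.measurable).comp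
      measurable_fst))
  have heq : ∀ᵐ ω ∂P, ∀ᵐ t, t ∈ Set.uIoc 0 (T : ℝ) →
      g t ω + x' t ω * (d t / c t) = IsRiccatiKernel.excess c d (path x ω) t := by
    filter_upwards [hxe, hge] with ω h1 h2
    filter_upwards [h2] with t ht hmem
    have hmem' := hmem
    rw [Set.uIoc_of_le T.coe_nonneg] at hmem'
    rw [ht hmem, h1 t hmem'.2, IsRiccatiKernel.excess]
  refine ⟨_, hm, fun t ht => (hga t ht).add ((hxa t ht).mul_const _), heq, ?_⟩
  have hm' : Measurable fun p : Ω × ℝ => g p.2 p.1 + x' p.2 p.1 * (d p.2 / c p.2) :=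
    hm.comp measurable_swap
  rw [memLp_two_iff_lintegral hm'.aestronglyMeasurable, timeProd,
    lintegral_prod _ (hm'.enorm.pow_const 2).aemeasurable]
  have hT := hk.pos
  -- By the energy identity `∫ excess² ≤ ∫ (x'² + ν² x²)`, and `∫ x² ≤ T² ∫ x'²` because `x` ends at
  -- `0`.
  set K : ℝ := 1 + ν ^ 2 * T ^ 2 with hK
  have hbound : ∀ᵐ ω ∂P, ∫⁻ t in Set.Ioc (0 : ℝ) T, ‖g t ω + x' t ω * (d t / c t)‖ₑ ^ 2 ≤
      ENNReal.ofReal K *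
        ∫⁻ t in Set.Ioo (0 : ℝ) T, ENNReal.ofReal (deriv (path x ω) t ^ 2) := by
    filter_upwards [heq, hx.ae_paths h𝓕] with ω h1 ⟨hac, _, hfin, hsq⟩
    have e1 : ∫⁻ t in Set.Ioc (0 : ℝ) T, ‖g t ω + x' t ω * (d t / c t)‖ₑ ^ 2 =
        ∫⁻ t in Set.Ioc (0 : ℝ) T, ENNReal.ofReal
          (IsRiccatiKernel.excess c d (path x ω) t ^ 2) := by
      refine lintegral_congr_ae ?_
      rw [Filter.EventuallyEq, ae_restrict_iff' measurableSet_Ioc]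
      rw [Set.uIoc_of_le T.coe_nonneg] at h1
      filter_upwards [h1] with t ht hmem
      rw [ht hmem, ← sq_abs, ENNReal.ofReal_pow (abs_nonneg _), ← Real.norm_eq_abs, ofReal_norm]
    have hex := hk.intervalIntegrable_excess_sq hac hfin hsq
    have e2 := hk.energy_identity hac hfin hsq
    have e3 : ∫ t in (0 : ℝ)..T, path x ω t ^ 2 ≤ T ^ 2 * ∫ t in (0 : ℝ)..T, deriv (path x ω) t ^ 2 := by
      have hI : 0 ≤ ∫ t in (0 : ℝ)..T, deriv (path x ω) t ^ 2 :=
        intervalIntegral.integral_nonneg hT.le fun _ _ => sq_nonneg _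
      have := intervalIntegral.integral_mono_on hT.le (hac.continuousOn.pow 2).intervalIntegrable
        (intervalIntegrable_const (μ := volume)
          (c := T * ∫ t in (0 : ℝ)..T, deriv (path x ω) t ^ 2)) fun t ht => by
          refine (sq_le_of_finish hac hfin hsq ht).trans ?_
          refine mul_le_mul (by linarith [ht.1]) (intervalIntegral.integral_mono_interval ht.1 ht.2
            le_rfl (Eventually.of_forall fun _ => sq_nonneg _) hsq)
            (intervalIntegral.integral_nonneg ht.2 fun _ _ => sq_nonneg _) hT.le
      rw [intervalIntegral.integral_const, smul_eq_mul, sub_zero] at this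
      calc _ ≤ _ := this
        _ = _ := by ring
    have e4 : 0 ≤ path x ω 0 ^ 2 * (d 0 / c 0) :=
      mul_nonneg (sq_nonneg _) (div_nonneg (hk.d_pos 0).le (hk.c_pos ⟨le_rfl, hT⟩).le)
    have hx2 : IntervalIntegrable (fun t => path x ω t ^ 2) volume 0 T :=
      (hac.continuousOn.pow 2).intervalIntegrable
    rw [intervalIntegral.integral_add hsq (hx2.const_mul (ν ^ 2)),
      intervalIntegral.integral_const_mul] at e2
    have e5 : ∫ t in (0 : ℝ)..T, IsRiccatiKernel.excess c d (path x ω) t ^ 2 ≤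
        K * ∫ t in (0 : ℝ)..T, deriv (path x ω) t ^ 2 := by
      have := mul_le_mul_of_nonneg_left e3 (sq_nonneg ν)
      rw [hK]
      linarith
    rw [e1, Measure.restrict_congr_set Ioo_ae_eq_Ioc,
      ← ofReal_integral_eq_lintegral_ofReal
        ((intervalIntegrable_iff_integrableOn_Ioc_of_le hT.le).1 hex)
        (Eventually.of_forall fun _ => sq_nonneg _),
      ← ofReal_integral_eq_lintegral_ofReal
        ((intervalIntegrable_iff_integrableOn_Ioc_of_le hT.le).1 hsq)
        (Eventually.of_forall fun _ => sq_nonneg _),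
      ← ENNReal.ofReal_mul (by positivity), ← intervalIntegral.integral_of_le hT.le,
      ← intervalIntegral.integral_of_le hT.le]
    exact ENNReal.ofReal_le_ofReal e5
  refine (lintegral_mono_ae hbound).trans_lt ?_
  rw [lintegral_const_mul' _ _ ENNReal.ofReal_ne_top]
  exact ENNReal.mul_lt_top ENNReal.ofReal_lt_top hx.finite_energy

end IsAdmissible

end

section

variable {Ω : Type*} {mΩ : MeasurableSpace Ω} {P : Measure Ω} {𝓕 : Filtration ℝ≥0 mΩ}

/-! ### The driver of the liquidation problem -/

/-- An adapted right-continuous price process whose supremum on `[0, T]` is dominated by the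
square-integrable random variable `B`. -/
structure IsBoundedPrice (𝓕 : Filtration ℝ≥0 mΩ) (P : Measure Ω) (T : ℝ≥0) (S : ℝ≥0 → Ω → ℝ)
    (B : Ω → ℝ) : Prop where
  adapted : ∀ t, Measurable[𝓕 t] (S t)
  memLp : MemLp B 2 P
  bound : ∀ᵐ ω ∂P, ∀ t ≤ T, |S t ω| ≤ B ω
  rightContinuous : ∀ᵐ ω ∂P, ∀ t < T, ContinuousWithinAt (fun s => S s ω) (Set.Ioi t) t

namespace IsBoundedPrice

variable {T : ℝ≥0} {S : ℝ≥0 → Ω → ℝ} {B : Ω → ℝ}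

lemma ae_intervalIntegrable (hS : IsBoundedPrice 𝓕 P T S B) :
    ∀ᵐ ω ∂P, IntervalIntegrable (path S ω) volume 0 T := by
  filter_upwards [hS.bound, hS.rightContinuous] with ω hb hr
  simpa using intervalIntegrable_bounded_mul T.coe_nonneg (aestronglyMeasurable_path hr)
    (abs_path_le hb) (intervalIntegrable_const (c := (1 : ℝ)))

lemma isBoundedDriver (hS : IsBoundedPrice 𝓕 P T S B) (h𝓕 : UsualConditions 𝓕 P) (η lam : ℝ) :
    IsBoundedDriver 𝓕 P T (driver S η lam)
      (fun ω => (|1 / η| * 2 + |lam / η| * T) * B ω) where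
  adapted t ht := by
    have h1 : Measurable[𝓕 t] fun ω => ∫ s in (0 : ℝ)..t, path S ω s * 1 :=
      h𝓕.measurable_integral (φ := fun _ => 1) (fun s _ => hS.adapted s)
        (hS.rightContinuous.mono fun _ hω s hs => hω s (hs.trans_le ht)) measurable_const
    simp only [mul_one] at h1
    exact (((hS.adapted t).sub ((hS.adapted 0).mono (𝓕.mono zero_le) le_rfl)).const_mul _).add
      (h1.const_mul _)
  start ω := by simp [driver]
  memLp := hS.memLp.const_mul _
  bound := by
    filter_upwards [hS.bound] with ω hb t ht
    have hB : 0 ≤ B ω := (abs_nonneg _).trans (hb 0 zero_le)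
    have h1 : |S t ω - S 0 ω| ≤ 2 * B ω := by
      calc |S t ω - S 0 ω| ≤ |S t ω| + |S 0 ω| := abs_sub _ _
        _ ≤ 2 * B ω := by linarith [hb t ht, hb 0 zero_le]
    have h2 : |∫ s in (0 : ℝ)..t, path S ω s| ≤ T * B ω := by
      have := intervalIntegral.norm_integral_le_of_norm_le_const (a := 0) (b := t)
        (f := path S ω) (C := B ω) fun u hu => by
          rw [Set.uIoc_of_le t.coe_nonneg] at hu
          exact abs_path_le (fun s hs => hb s (hs.trans ht)) u ⟨hu.1.le, hu.2⟩
      rw [Real.norm_eq_abs, sub_zero, abs_of_nonneg t.coe_nonneg, mul_comm] at this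
      exact this.trans (mul_le_mul_of_nonneg_right (by exact_mod_cast ht) hB)
    calc |driver S η lam t ω| ≤ |-(1 / η) * (S t ω - S 0 ω)| +
          |lam / η * ∫ s in (0 : ℝ)..t, path S ω s| := abs_add_le _ _
      _ = |1 / η| * |S t ω - S 0 ω| + |lam / η| * |∫ s in (0 : ℝ)..t, path S ω s| := by
          rw [abs_mul, abs_mul, abs_neg]
      _ ≤ |1 / η| * (2 * B ω) + |lam / η| * (T * B ω) := by gcongr
      _ = _ := by ring
  rightContinuous := by
    filter_upwards [hS.rightContinuous, hS.ae_intervalIntegrable] with ω hr hi t ht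
    exact (((hr t ht).sub continuousWithinAt_const).const_mul _).add
      ((rightContinuous_primitive hi ht).const_mul _)

variable {X η γ lam ν : ℝ} {c d : ℝ → ℝ} {x : ℝ≥0 → Ω → ℝ}

/-! ### The cost of an admissible strategy as a complete square -/

section

variable (hS : IsBoundedPrice 𝓕 P T S B) (h𝓕 : UsualConditions 𝓕 P)
  (hk : IsRiccatiKernel T ν c d) (hx : IsAdmissible 𝓕 P T X x)

include hS h𝓕 hk hx

lemma ae_intervalIntegrable_rates :
    ∀ᵐ ω ∂P, IntervalIntegrable (costRate S η γ x ω) volume 0 T ∧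
      IntervalIntegrable (riskRate S γ lam x ω) volume 0 T := by
  filter_upwards [hS.bound, hS.rightContinuous, hx.ae_paths h𝓕] with ω hb hr ⟨hac, _, _, hsq⟩
  refine ⟨?_, intervalIntegrable_risk hk.pos (aestronglyMeasurable_path hr) (abs_path_le hb) hac
    γ lam⟩
  have := intervalIntegrable_cost hk.pos (aestronglyMeasurable_path hr) (abs_path_le hb) hac hsq η γ
  simp only [path_zero] at this
  exact this

/-- The cost of an admissible strategy after completion of the square. -/
lemma costPlusRisk_ae_eq (hη : 0 < η) (hν2 : ν ^ 2 = lam * γ / η) {R w : ℝ → Ω → ℝ}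
    (hR : ∀ᵐ ω ∂P, ∀ t ∈ Set.Icc 0 (T : ℝ),
      R t ω = IsRiccatiKernel.remainder T c d (path (driver S η lam) ω) t / c t)
    (hw : ∀ᵐ ω ∂P, ∀ᵐ t, t ∈ Set.uIoc 0 (T : ℝ) →
      w t ω = IsRiccatiKernel.excess c d (path x ω) t) :
    ∀ᵐ ω ∂P, costPlusRisk S T η γ lam x ω = γ / 2 * X ^ 2 - X * S 0 ω +
      η * (X ^ 2 * (d 0 / c 0) + X / c 0 * partsIntegral c d (driver S η lam) T ω +
        ∫ t in (0 : ℝ)..T, (w t ω ^ 2 + w t ω * R t ω)) := by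
  have hY := hS.isBoundedDriver h𝓕 η lam
  filter_upwards [hS.bound, hS.rightContinuous, hY.bound, hY.rightContinuous, hx.ae_paths h𝓕, hR,
    hw] with ω hb hr hYb hYr ⟨hac, h0, hT, hsq⟩ hRω hwω
  have hm := aestronglyMeasurable_path hr
  have hYm := aestronglyMeasurable_path hYr
  have e1 := cost_eq hk.pos hm (abs_path_le hb) hac hsq hη.ne' hν2 hT
    (y := path (driver S η lam) ω) fun t ht => by
      simp only [path, driver, Real.coe_toNNReal _ ht.1, Real.toNNReal_zero]
  have e2 := hk.energy_identity hac hT hsq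
  have e3 := hk.linear_identity hYm (abs_path_le hYb) hac hT hsq
  have e4 : ∫ t in (0 : ℝ)..T, (w t ω ^ 2 + w t ω * R t ω) =
      (∫ t in (0 : ℝ)..T, IsRiccatiKernel.excess c d (path x ω) t ^ 2) +
      ∫ t in (0 : ℝ)..T, IsRiccatiKernel.remainder T c d (path (driver S η lam) ω) t / c t *
        IsRiccatiKernel.excess c d (path x ω) t := by
    rw [← intervalIntegral.integral_add (hk.intervalIntegrable_excess_sq hac hT hsq)
      (hk.intervalIntegrable_remainder_mul_excess hYm (abs_path_le hYb) hac hT hsq)]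
    refine intervalIntegral.integral_congr_ae ?_
    filter_upwards [hwω] with t ht hmem
    have hmem' := hmem
    rw [Set.uIoc_of_le T.coe_nonneg] at hmem'
    rw [ht hmem, hRω t ⟨hmem'.1.le, hmem'.2⟩]
    ring
  have e5 : costPlusRisk S T η γ lam x ω = γ / 2 * x 0 ω ^ 2 - x 0 ω * S 0 ω +
      η * ((∫ t in (0 : ℝ)..T, (deriv (path x ω) t ^ 2 + ν ^ 2 * path x ω t ^ 2)) +
        -∫ t in (0 : ℝ)..T, path (driver S η lam) ω t * deriv (path x ω) t) := by
    simp only [path_zero] at e1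
    exact e1
  have e6 : partsIntegral c d (driver S η lam) T ω =
      ∫ t in (0 : ℝ)..T, path (driver S η lam) ω t * d t := by
    rw [partsIntegral, hk.c_finish, zero_mul, zero_add]
  rw [path_zero] at h0 e2 e3
  rw [e5, e4, e6, e2, e3, h0]
  ring

variable [IsProbabilityMeasure P]

lemma integrable_costPlusRisk (hη : 0 < η) (hν2 : ν ^ 2 = lam * γ / η) {R w : ℝ → Ω → ℝ}
    (hR : ∀ᵐ ω ∂P, ∀ t ∈ Set.Icc 0 (T : ℝ),
      R t ω = IsRiccatiKernel.remainder T c d (path (driver S η lam) ω) t / c t)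
    (hR2 : MemLp (fun p : Ω × ℝ => R p.2 p.1) 2 (timeProd P T))
    (hw : ∀ᵐ ω ∂P, ∀ᵐ t, t ∈ Set.uIoc 0 (T : ℝ) →
      w t ω = IsRiccatiKernel.excess c d (path x ω) t)
    (hw2 : MemLp (fun p : Ω × ℝ => w p.2 p.1) 2 (timeProd P T)) :
    Integrable (costPlusRisk S T η γ lam x) P ∧ objective P S T η γ lam x =
      γ / 2 * X ^ 2 - X * P[S 0] + η * (X ^ 2 * (d 0 / c 0) +
        X / c 0 * P[stochIntegral P c (driver S η lam) T] +
        ∫ p, (w p.2 p.1 ^ 2 + w p.2 p.1 * R p.2 p.1) ∂(timeProd P T)) := by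
  have hY := hS.isBoundedDriver h𝓕 η lam
  have hS0 : Integrable (S 0) P := by
    refine (hS.memLp.mono' ((hS.adapted 0).mono (𝓕.le 0) le_rfl).aestronglyMeasurable
      ?_).integrable one_le_two
    filter_upwards [hS.bound] with ω hω using hω 0 zero_le
  have hI : Integrable (partsIntegral c d (driver S η lam) T) P :=
    (hY.memLp_partsIntegral hk h𝓕 le_rfl).integrable one_le_two
  have hI' : P[stochIntegral P c (driver S η lam) T] = P[partsIntegral c d (driver S η lam) T] :=
    integral_congr_ae (hY.stochIntegral_ae_eq hk le_rfl)
  have hq : Integrable (fun p : Ω × ℝ => w p.2 p.1 ^ 2 + w p.2 p.1 * R p.2 p.1) (timeProd P T) :=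
    hw2.integrable_sq.add (hw2.integrable_mul hR2)
  have hq' : Integrable (fun ω => ∫ t in (0 : ℝ)..T, (w t ω ^ 2 + w t ω * R t ω)) P :=
    integrable_integral_timeProd hq
  have hq2 : ∫ p, (w p.2 p.1 ^ 2 + w p.2 p.1 * R p.2 p.1) ∂(timeProd P T) =
      ∫ ω, (∫ t in (0 : ℝ)..T, (w t ω ^ 2 + w t ω * R t ω)) ∂P := integral_timeProd hq
  have heq := hS.costPlusRisk_ae_eq h𝓕 hk hx hη hν2 hR hw
  have h1 : Integrable (fun ω => X ^ 2 * (d 0 / c 0) +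
      X / c 0 * partsIntegral c d (driver S η lam) T ω) P :=
    (integrable_const _).add (hI.const_mul _)
  have h2 : Integrable (fun ω => γ / 2 * X ^ 2 - X * S 0 ω) P :=
    (integrable_const _).sub (hS0.const_mul _)
  have h3 : Integrable (fun ω => η * (X ^ 2 * (d 0 / c 0) +
      X / c 0 * partsIntegral c d (driver S η lam) T ω +
      ∫ t in (0 : ℝ)..T, (w t ω ^ 2 + w t ω * R t ω))) P := (h1.add hq').const_mul η
  refine ⟨(h2.add h3).congr (heq.mono fun ω h => h.symm), ?_⟩
  rw [objective, integral_congr_ae heq, integral_add h2 h3,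
    integral_sub (integrable_const _) (hS0.const_mul _), integral_const_mul X,
    integral_const_mul η,
    integral_add h1 hq', integral_add (integrable_const _) (hI.const_mul _),
    integral_const_mul (X / c 0),
    hq2, hI']
  simp

/-- Because `w` is adapted, `R` may be replaced by its conditional expectation `h`; then `w² + w h =
(w + h / 2)² - h² / 4`. Only the square still depends on the strategy. -/
lemma objective_eq (hη : 0 < η) (hν2 : ν ^ 2 = lam * γ / η) {R h w : ℝ → Ω → ℝ}
    (hR : ∀ᵐ ω ∂P, ∀ t ∈ Set.Icc 0 (T : ℝ),
      R t ω = IsRiccatiKernel.remainder T c d (path (driver S η lam) ω) t / c t)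
    (hRi : ∀ t ∈ Set.Ioc 0 (T : ℝ), Integrable (R t) P)
    (hR2 : MemLp (fun p : Ω × ℝ => R p.2 p.1) 2 (timeProd P T))
    (hh : ∀ t ∈ Set.Ioc 0 (T : ℝ), h t =ᵐ[P] P[R t | 𝓕 t.toNNReal])
    (hh2 : MemLp (fun p : Ω × ℝ => h p.2 p.1) 2 (timeProd P T))
    (hwa : ∀ t ∈ Set.Ioc 0 (T : ℝ), Measurable[𝓕 t.toNNReal] (w t))
    (hw : ∀ᵐ ω ∂P, ∀ᵐ t, t ∈ Set.uIoc 0 (T : ℝ) →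
      w t ω = IsRiccatiKernel.excess c d (path x ω) t)
    (hw2 : MemLp (fun p : Ω × ℝ => w p.2 p.1) 2 (timeProd P T)) :
    objective P S T η γ lam x =
      γ / 2 * X ^ 2 - X * P[S 0] + η * (X ^ 2 * (d 0 / c 0) +
        X / c 0 * P[stochIntegral P c (driver S η lam) T] -
        1 / 4 * ∫ p, h p.2 p.1 ^ 2 ∂(timeProd P T)) +
      η * ∫ p, (w p.2 p.1 + 1 / 2 * h p.2 p.1) ^ 2 ∂(timeProd P T) := by
  have i1 : Integrable (fun p : Ω × ℝ => w p.2 p.1 ^ 2) (timeProd P T) := hw2.integrable_sq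
  have i2 : Integrable (fun p : Ω × ℝ => w p.2 p.1 * R p.2 p.1) (timeProd P T) :=
    hw2.integrable_mul hR2
  have i3 : Integrable (fun p : Ω × ℝ => w p.2 p.1 * h p.2 p.1) (timeProd P T) :=
    hw2.integrable_mul hh2
  have i4 : Integrable (fun p : Ω × ℝ => h p.2 p.1 ^ 2) (timeProd P T) := hh2.integrable_sq
  have e : ∫ p, (w p.2 p.1 + 1 / 2 * h p.2 p.1) ^ 2 ∂(timeProd P T) =
      ∫ p, (w p.2 p.1 ^ 2 + w p.2 p.1 * h p.2 p.1 + 1 / 4 * h p.2 p.1 ^ 2) ∂(timeProd P T) :=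
    integral_congr_ae (Eventually.of_forall fun p => by ring)
  rw [(hS.integrable_costPlusRisk h𝓕 hk hx hη hν2 hR hR2 hw hw2).2, e,
    integral_add (f := fun p : Ω × ℝ => w p.2 p.1 ^ 2 + w p.2 p.1 * h p.2 p.1) (i1.add i3)
      (i4.const_mul _), integral_add i1 i3, integral_add i1 i2, integral_const_mul,
    integral_mul_eq_of_condExp hR2 hh2 hw2 hwa hRi hh]
  ring

end

/-! ### The optimal strategy -/

/-- The strategy with feedback part governed by `c` and forcing term `H`. -/
def feedbackStrategy (c : ℝ → ℝ) (X : ℝ) (H : ℝ≥0 → Ω → ℝ) (t : ℝ≥0) (ω : Ω) : ℝ :=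
  c t * (X / c 0 - 1 / 2 * ∫ s in (0 : ℝ)..t, path H ω s / c s ^ 2)

lemma path_feedbackStrategy (c : ℝ → ℝ) (X : ℝ) (H : ℝ≥0 → Ω → ℝ) (ω : Ω) {T : ℝ} :
    ∀ t ∈ Set.Icc 0 T, path (feedbackStrategy c X H) ω t =
      c t * (X / c 0 - 1 / 2 * ∫ s in (0 : ℝ)..t, path H ω s / c s ^ 2) := by
  intro t ht
  rw [path, feedbackStrategy, Real.coe_toNNReal _ ht.1]

/-- The minimal value of the cost functional. -/
def minimalValue (P : Measure Ω) (S : ℝ≥0 → Ω → ℝ) (T : ℝ≥0) (X η γ lam : ℝ) (c d : ℝ → ℝ)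
    (H : ℝ≥0 → Ω → ℝ) : ℝ :=
  γ / 2 * X ^ 2 - X * P[S 0] + η * (X ^ 2 * (d 0 / c 0) +
    X / c 0 * P[stochIntegral P c (driver S η lam) T] -
    1 / 4 * ∫ ω, (∫ t in (0 : ℝ)..T, (path H ω t / c t) ^ 2) ∂P)

section

variable [IsProbabilityMeasure P] (hS : IsBoundedPrice 𝓕 P T S B) (h𝓕 : UsualConditions 𝓕 P)
  (hk : IsRiccatiKernel T ν c d) {H : ℝ≥0 → Ω → ℝ}
  (hH : IsRightContVersion P T (condTail 𝓕 P c (driver S η lam) T) H)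

include hS h𝓕 hk hH

lemma tail_integrable :
    (∀ᵐ ω ∂P, (∀ t < T, IntervalIntegrable (fun s => path H ω s / c s ^ 2) volume 0 (t : ℝ)) ∧
      IntervalIntegrable (fun t => (path H ω t / c t) ^ 2) volume 0 T) ∧
    Integrable (fun ω => ∫ t in (0 : ℝ)..T, (path H ω t / c t) ^ 2) P := by
  have hY := hS.isBoundedDriver h𝓕 η lam
  obtain ⟨R, hR, -, -⟩ := hY.exists_remainder_version hk h𝓕
  obtain ⟨h, -, hh, -, hh2⟩ := hY.exists_tail_version hk h𝓕 hH hR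
  have hsq := hh2.integrable_sq
  have heq : ∀ᵐ ω ∂P, Set.EqOn (fun t => h t ω ^ 2) (fun t => (path H ω t / c t) ^ 2)
      (Set.uIcc 0 (T : ℝ)) := by
    filter_upwards [hh] with ω hω t ht
    rw [Set.uIcc_of_le T.coe_nonneg] at ht
    simp only [hω t ht.2]
  constructor
  · filter_upwards [intervalIntegrable_timeProd hsq, heq, hH.rightContinuous] with ω h1 h2 hr
    have h3 : IntervalIntegrable (fun t => (path H ω t / c t) ^ 2) volume 0 T :=
      h1.congr fun t ht => h2 (Set.uIoc_subset_uIcc ht)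
    exact ⟨fun t ht => hk.intervalIntegrable_div_sq (aestronglyMeasurable_path hr) h3
      ⟨t.coe_nonneg, by exact_mod_cast ht⟩, h3⟩
  · refine (integrable_integral_timeProd hsq).congr ?_
    filter_upwards [heq] with ω hω using intervalIntegral.integral_congr hω

/-- The excess of this strategy is `-K / (2c)`, so the energy identity bounds `∫ x'²` by `1 / 4 ∫ (K
/ c)² + X² d(0) / c(0)`, which is integrable. -/
lemma feedback_mem_admissible : feedbackStrategy c X H ∈ admissible 𝓕 P T X := by
  have hT := hk.pos
  have hti := hS.tail_integrable h𝓕 hk hH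
  have hc0 : c 0 ≠ 0 := (hk.c_pos ⟨le_rfl, hT⟩).ne'
  have h0 : ∀ ω, feedbackStrategy c X H 0 ω = X := fun ω => by
    simp [feedbackStrategy, mul_div_cancel₀ X hc0]
  have hfin : ∀ ω, feedbackStrategy c X H T ω = 0 := fun ω => by
    simp [feedbackStrategy, hk.c_finish]
  refine ⟨fun t ht => ?_, ?_, Eventually.of_forall h0, Eventually.of_forall hfin, ?_⟩
  · have h1 := h𝓕.measurable_integral (t := t) (φ := fun s => (c s ^ 2)⁻¹)
      (fun s hs => hH.measurable h𝓕 (hs.trans ht))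
      (hH.rightContinuous.mono fun _ hω s hs => hω s (hs.trans_le ht))
      (hk.continuous_c.measurable.pow_const 2).inv
    exact ((h1.const_mul _).const_sub _ |>.const_mul _).stronglyMeasurable
  · filter_upwards [hti.1, hH.rightContinuous] with ω h1 hr
    exact hk.absolutelyContinuous_feedback (aestronglyMeasurable_path hr) h1.2
      (path_feedbackStrategy c X H ω)
  · set Φ : Ω → ℝ := fun ω => 1 / 4 * (∫ t in (0 : ℝ)..T, (path H ω t / c t) ^ 2) +
      X ^ 2 * (d 0 / c 0) with hΦ
    have hΦi : Integrable Φ P := (hti.2.const_mul _).add (integrable_const _)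
    refine lt_of_le_of_lt (lintegral_mono_ae (g := fun ω => ENNReal.ofReal (Φ ω)) ?_)
      hΦi.lintegral_lt_top
    filter_upwards [hti.1, hH.rightContinuous] with ω h1 hr
    have hm := aestronglyMeasurable_path hr
    have hp := path_feedbackStrategy c X H ω (T := (T : ℝ))
    have hac := hk.absolutelyContinuous_feedback hm h1.2 hp
    have hsq := hk.intervalIntegrable_deriv_feedback_sq hm h1.2 hp
    have hen := hk.energy_identity hac (by rw [path_coe, hfin]) hsq
    have hex : ∫ t in (0 : ℝ)..T,
        IsRiccatiKernel.excess c d (path (feedbackStrategy c X H) ω) t ^ 2 =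
        1 / 4 * ∫ t in (0 : ℝ)..T, (path H ω t / c t) ^ 2 := by
      rw [← intervalIntegral.integral_const_mul]
      refine intervalIntegral.integral_congr_ae ?_
      filter_upwards [hk.excess_feedback hm h1.2 hp] with t ht hmem
      rw [ht hmem]
      ring
    have hle : ∫ t in (0 : ℝ)..T, deriv (path (feedbackStrategy c X H) ω) t ^ 2 ≤
        ∫ t in (0 : ℝ)..T, (deriv (path (feedbackStrategy c X H) ω) t ^ 2 +
          ν ^ 2 * path (feedbackStrategy c X H) ω t ^ 2) :=
      intervalIntegral.integral_mono_on hT.le hsq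
        (hsq.add ((hac.continuousOn.pow 2).intervalIntegrable.const_mul _))
        fun t _ => le_add_of_nonneg_right (by positivity)
    rw [Measure.restrict_congr_set Ioo_ae_eq_Ioc, ← ofReal_integral_eq_lintegral_ofReal
        ((intervalIntegrable_iff_integrableOn_Ioc_of_le hT.le).1 hsq)
        (Eventually.of_forall fun _ => sq_nonneg _), ← intervalIntegral.integral_of_le hT.le]
    refine ENNReal.ofReal_le_ofReal ?_
    rw [hen, hex, path_zero, h0] at hle
    exact hle

/-- The feedback strategy is the unique minimizer. -/
lemma feedback_optimal (hη : 0 < η) (hν2 : ν ^ 2 = lam * γ / η) :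
    objective P S T η γ lam (feedbackStrategy c X H) = minimalValue P S T X η γ lam c d H ∧
    IsMinOn (objective P S T η γ lam) (admissible 𝓕 P T X) (feedbackStrategy c X H) ∧
    ∀ y ∈ admissible 𝓕 P T X, IsMinOn (objective P S T η γ lam) (admissible 𝓕 P T X) y →
      ∀ᵐ ω ∂P, ∀ t ≤ T, y t ω = feedbackStrategy c X H t ω := by
  have hY := hS.isBoundedDriver h𝓕 η lam
  have hmem := hS.feedback_mem_admissible (X := X) h𝓕 hk hH
  have hti := hS.tail_integrable h𝓕 hk hH
  obtain ⟨R, hR, hRi, hR2⟩ := hY.exists_remainder_version hk h𝓕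
  obtain ⟨h, hhm, hh, hhc, hh2⟩ := hY.exists_tail_version hk h𝓕 hH hR
  have hval : minimalValue P S T X η γ lam c d H =
      γ / 2 * X ^ 2 - X * P[S 0] + η * (X ^ 2 * (d 0 / c 0) +
        X / c 0 * P[stochIntegral P c (driver S η lam) T] -
        1 / 4 * ∫ p, h p.2 p.1 ^ 2 ∂(timeProd P T)) := by
    rw [minimalValue, integral_timeProd hh2.integrable_sq]
    congr 4
    refine integral_congr_ae ?_
    filter_upwards [hh] with ω hω
    refine intervalIntegral.integral_congr fun t ht => ?_
    rw [Set.uIcc_of_le T.coe_nonneg] at ht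
    simp only [hω t ht.2]
  have hobj : ∀ y ∈ admissible 𝓕 P T X, ∃ w : ℝ → Ω → ℝ, Measurable (Function.uncurry w) ∧
      (∀ᵐ ω ∂P, ∀ᵐ t, t ∈ Set.uIoc 0 (T : ℝ) →
        w t ω = IsRiccatiKernel.excess c d (path y ω) t) ∧
      MemLp (fun p : Ω × ℝ => w p.2 p.1) 2 (timeProd P T) ∧
      objective P S T η γ lam y = minimalValue P S T X η γ lam c d H +
        η * ∫ p, (w p.2 p.1 + 1 / 2 * h p.2 p.1) ^ 2 ∂(timeProd P T) := by
    intro y hy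
    obtain ⟨w, hwm, hwa, hwe, hw2⟩ := IsAdmissible.exists_excess_version hy h𝓕 hk
    exact ⟨w, hwm, hwe, hw2, by
      rw [hval, hS.objective_eq h𝓕 hk hy hη hν2 hR hRi hR2 hhc hh2 hwa hwe hw2]⟩
  -- The feedback strategy is built so that the completed square vanishes.
  have hexc : ∀ᵐ ω ∂P, ∀ᵐ t, t ∈ Set.uIoc 0 (T : ℝ) →
      IsRiccatiKernel.excess c d (path (feedbackStrategy c X H) ω) t = -(1 / 2) * h t ω := by
    filter_upwards [hti.1, hH.rightContinuous, hh] with ω h1 hr hω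
    filter_upwards [hk.excess_feedback (aestronglyMeasurable_path hr) h1.2
      (path_feedbackStrategy c X H ω)] with t ht htm
    have htm' := htm
    rw [Set.uIoc_of_le T.coe_nonneg] at htm'
    rw [ht htm, hω t htm'.2]
  have hopt : objective P S T η γ lam (feedbackStrategy c X H) =
      minimalValue P S T X η γ lam c d H := by
    obtain ⟨w, hwm, hwe, -, hwo⟩ := hobj _ hmem
    have hzero : ∫ p, (w p.2 p.1 + 1 / 2 * h p.2 p.1) ^ 2 ∂(timeProd P T) = 0 := by
      refine integral_eq_zero_of_ae ?_
      have hms : MeasurableSet {p : Ω × ℝ | (w p.2 p.1 + 1 / 2 * h p.2 p.1) ^ 2 = 0} :=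
        measurableSet_eq_fun ((((hwm.comp measurable_swap).add
          ((hhm.comp measurable_swap).const_mul (1 / 2)))).pow_const 2) measurable_const
      refine (Measure.ae_prod_iff_ae_ae hms).2 ?_
      filter_upwards [hwe, hexc] with ω h1 h2
      rw [ae_restrict_iff' measurableSet_Ioc, ← Set.uIoc_of_le T.coe_nonneg]
      filter_upwards [h1, h2] with t h3 h4 htm
      rw [h3 htm, h4 htm]
      ring
    rw [hwo, hzero, mul_zero, add_zero]
  refine ⟨hopt, fun y hy => ?_, fun y hy hmin => ?_⟩
  · obtain ⟨w, -, -, -, hwo⟩ := hobj y hy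
    show objective P S T η γ lam (feedbackStrategy c X H) ≤ objective P S T η γ lam y
    rw [hopt, hwo]
    exact le_add_of_nonneg_right (mul_nonneg hη.le (integral_nonneg fun _ => sq_nonneg _))
  · obtain ⟨w, -, hwe, hw2, hwo⟩ := hobj y hy
    have hle : objective P S T η γ lam y ≤ objective P S T η γ lam (feedbackStrategy c X H) :=
      hmin hmem
    rw [hopt, hwo] at hle
    have hi : Integrable (fun p : Ω × ℝ => (w p.2 p.1 + 1 / 2 * h p.2 p.1) ^ 2) (timeProd P T) :=
      (hw2.add (hh2.const_mul (1 / 2))).integrable_sq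
    have hnn : 0 ≤ ∫ p, (w p.2 p.1 + 1 / 2 * h p.2 p.1) ^ 2 ∂(timeProd P T) :=
      integral_nonneg fun _ => sq_nonneg _
    have hz : ∫ p, (w p.2 p.1 + 1 / 2 * h p.2 p.1) ^ 2 ∂(timeProd P T) = 0 := by
      have := mul_nonneg hη.le hnn
      have h1 : η * ∫ p, (w p.2 p.1 + 1 / 2 * h p.2 p.1) ^ 2 ∂(timeProd P T) = 0 := by linarith
      exact (mul_eq_zero.1 h1).resolve_left hη.ne'
    -- For any other minimizer the square vanishes almost everywhere on the product space. On almost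
    -- every path its excess thus agrees with that of the feedback strategy, and `eq_of_excess_eq`
    -- applies.
    have hae := (integral_eq_zero_iff_of_nonneg (fun _ => sq_nonneg _) hi).1 hz
    have hae' := Measure.ae_ae_of_ae_prod hae
    filter_upwards [hae', hwe, hexc, IsAdmissible.ae_paths hy h𝓕, IsAdmissible.ae_paths hmem h𝓕]
      with ω h1 h2 h3 ⟨hac, h0, hT, hsq⟩ ⟨hac', h0', hT', hsq'⟩ t ht
    rw [ae_restrict_iff' measurableSet_Ioc, ← Set.uIoc_of_le T.coe_nonneg] at h1
    have := hk.eq_of_excess_eq hac hT hsq hac' hT' hsq' (h0.trans h0'.symm) (by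
      filter_upwards [h1, h2, h3] with t h4 h5 h6 htm
      have h7 := pow_eq_zero_iff (two_ne_zero) |>.1 (h4 htm)
      rw [← h5 htm, h6 htm]
      linarith) t ⟨t.coe_nonneg, by exact_mod_cast ht⟩
    simpa only [path_coe] using this

end

end IsBoundedPrice

end

section

variable {Ω : Type*} {mΩ : MeasurableSpace Ω} {P : Measure Ω} {𝓕 : Filtration ℝ≥0 mΩ}
  [IsProbabilityMeasure P] {T : ℝ≥0}

lemma IsBoundedDriver.stochIntegral_spec {Y : ℝ≥0 → Ω → ℝ} {B : Ω → ℝ} {c d : ℝ → ℝ} {ν : ℝ}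
    (hY : IsBoundedDriver 𝓕 P T Y B) (hk : IsRiccatiKernel T ν c d) (h𝓕 : UsualConditions 𝓕 P)
    {t : ℝ≥0} (ht : t ≤ T) :
    IsStochIntegral P c Y t (stochIntegral P c Y t) ∧ MemLp (stochIntegral P c Y t) 2 P :=
  ⟨isStochIntegral_stochIntegral (hY.isStochIntegral hk ht),
    (hY.memLp_partsIntegral hk h𝓕 ht).ae_eq (hY.stochIntegral_ae_eq hk ht).symm⟩

lemma IsBoundedPrice.integrable_costPlusRisk_of_admissible {S : ℝ≥0 → Ω → ℝ} {B : Ω → ℝ}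
    {x : ℝ≥0 → Ω → ℝ} {c d : ℝ → ℝ} {X η γ lam ν : ℝ} (hS : IsBoundedPrice 𝓕 P T S B)
    (h𝓕 : UsualConditions 𝓕 P) (hk : IsRiccatiKernel T ν c d) (hx : IsAdmissible 𝓕 P T X x)
    (hη : 0 < η) (hν2 : ν ^ 2 = lam * γ / η) : Integrable (costPlusRisk S T η γ lam x) P := by
  obtain ⟨R, hR, -, hR2⟩ := (hS.isBoundedDriver h𝓕 η lam).exists_remainder_version hk h𝓕
  obtain ⟨w, -, -, hw, hw2⟩ := hx.exists_excess_version h𝓕 hk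
  exact (hS.integrable_costPlusRisk h𝓕 hk hx hη hν2 hR hR2 hw hw2).1

/-! ### The kernels -/

lemma isRiccatiKernel_sinh {T ν : ℝ} (hT : 0 < T) (hν : 0 < ν) :
    IsRiccatiKernel T ν (fun u => Real.sinh (ν * (T - u))) (fun u => ν * Real.cosh (ν * (T - u))) := by
  have hl (t : ℝ) : HasDerivAt (fun u => ν * (T - u)) (-ν) t := by
    simpa using ((hasDerivAt_id t).const_sub T).const_mul ν
  refine ⟨hT, fun t => ?_, fun t => ?_, by simp, ν, hν, fun t =>
    le_mul_of_one_le_right hν.le (Real.one_le_cosh _)⟩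
  · exact (hl t).sinh.congr_deriv (by ring)
  · exact ((hl t).cosh.const_mul ν).congr_deriv (by ring)

lemma isRiccatiKernel_sub {T : ℝ} (hT : 0 < T) :
    IsRiccatiKernel T 0 (fun u => T - u) (fun _ => 1) := by
  refine ⟨hT, fun t => ?_, fun t => ?_, sub_self T, 1, one_pos, fun _ => le_rfl⟩
  · exact (hasDerivAt_id t).const_sub T
  · simpa using hasDerivAt_const t (1 : ℝ)

variable (T) (X : ℝ) (H : ℝ≥0 → Ω → ℝ)

lemma optimalStrategy_eq_feedbackStrategy (ν : ℝ) : optimalStrategy T X ν H =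
    IsBoundedPrice.feedbackStrategy (fun u => Real.sinh (ν * (T - u))) X H := by
  ext t ω
  simp only [optimalStrategy, IsBoundedPrice.feedbackStrategy, sub_zero]

lemma optimalStrategyZero_eq_feedbackStrategy (hT : 0 < T) : optimalStrategyZero T X H =
    IsBoundedPrice.feedbackStrategy (fun u => (T : ℝ) - u) X H := by
  have hT' : (T : ℝ) ≠ 0 := by exact_mod_cast hT.ne'
  ext t ω
  have h : ∫ s in (0 : ℝ)..t, T / ((T : ℝ) - s) ^ 2 * path H ω s =
      T * ∫ s in (0 : ℝ)..t, path H ω s / ((T : ℝ) - s) ^ 2 := by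
    rw [← intervalIntegral.integral_const_mul]
    exact intervalIntegral.integral_congr fun s _ => by ring
  simp only [optimalStrategyZero, IsBoundedPrice.feedbackStrategy, sub_zero, h]
  field_simp

end

end

end OptimalExecution

/-! ### The theorem: specialization to the two kernels -/

open OptimalExecution in
theorem theorem2 {Ω : Type*} [mΩ : MeasurableSpace Ω] (P : Measure Ω) [IsProbabilityMeasure P]
    (𝓕 : Filtration ℝ≥0 mΩ) (h𝓕 : UsualConditions 𝓕 P) (h𝓕0 : TrivialAtZero 𝓕 P)
    (T : ℝ≥0) (hT : 0 < T) (X : ℝ) (hX : 0 ≤ X)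
    (η γ lam ν : ℝ) (hη : 0 < η) (hγ : 0 ≤ γ) (hlam : 0 < lam)
    (hν : 0 ≤ ν) (hν2 : ν ^ 2 = lam * γ / η)
    (S : ℝ≥0 → Ω → ℝ) (hS : IsSemimartingale 𝓕 P S)
    (hS2 : ∫⁻ ω, (⨆ t ∈ Set.Icc 0 T, ‖S t ω‖ₑ) ^ 2 ∂P < ⊤) :
    -- the cost functional is well-defined and finite on the class of admissible strategies
    (∀ x ∈ admissible 𝓕 P T X,
      (∀ᵐ ω ∂P, IntervalIntegrable (costRate S η γ x ω) volume 0 T ∧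
        IntervalIntegrable (riskRate S γ lam x ω) volume 0 T) ∧
      Integrable (costPlusRisk S T η γ lam x) P) ∧
    -- existence and uniqueness (up to indistinguishability) of the minimizer
    (∃ x ∈ admissible 𝓕 P T X,
      IsMinOn (objective P S T η γ lam) (admissible 𝓕 P T X) x ∧
      ∀ y ∈ admissible 𝓕 P T X,
        IsMinOn (objective P S T η γ lam) (admissible 𝓕 P T X) y →
        ∀ᵐ ω ∂P, ∀ t ≤ T, y t ω = x t ω) ∧
    -- the minimizer and the minimal value in the case `ν > 0`
    (0 < ν →
      (∀ t ≤ T,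
        IsStochIntegral P (fun u => Real.sinh (ν * (T - u))) (driver S η lam) t
          (stochIntegral P (fun u => Real.sinh (ν * (T - u))) (driver S η lam) t) ∧
        MemLp (stochIntegral P (fun u => Real.sinh (ν * (T - u))) (driver S η lam) t) 2 P) ∧
      (∃ H, IsRightContVersion P T
        (condTail 𝓕 P (fun u => Real.sinh (ν * (T - u))) (driver S η lam) T) H) ∧
      ∀ H, IsRightContVersion P T
          (condTail 𝓕 P (fun u => Real.sinh (ν * (T - u))) (driver S η lam) T) H →
        (∀ᵐ ω ∂P,
          (∀ t < T, IntervalIntegrable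
            (fun s => path H ω s / Real.sinh (ν * (T - s)) ^ 2) volume 0 (t : ℝ)) ∧
          IntervalIntegrable
            (fun t => (path H ω t / Real.sinh (ν * (T - t))) ^ 2) volume 0 T) ∧
        Integrable
          (fun ω => ∫ t in (0 : ℝ)..T, (path H ω t / Real.sinh (ν * (T - t))) ^ 2) P ∧
        optimalStrategy T X ν H ∈ admissible 𝓕 P T X ∧
        IsMinOn (objective P S T η γ lam) (admissible 𝓕 P T X) (optimalStrategy T X ν H) ∧
        objective P S T η γ lam (optimalStrategy T X ν H) =
          γ / 2 * X ^ 2 - X * P[S 0] +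
            η * (ν * X ^ 2 * (Real.cosh (ν * T) / Real.sinh (ν * T)) +
              X / Real.sinh (ν * T) *
                P[stochIntegral P (fun u => Real.sinh (ν * (T - u))) (driver S η lam) T] -
              1 / 4 * ∫ ω, (∫ t in (0 : ℝ)..T,
                (path H ω t / Real.sinh (ν * (T - t))) ^ 2) ∂P)) ∧
    -- the minimizer and the minimal value in the case `ν = 0`
    (ν = 0 →
      (∀ t ≤ T,
        IsStochIntegral P (fun u => (T : ℝ) - u) (driver S η lam) t
          (stochIntegral P (fun u => (T : ℝ) - u) (driver S η lam) t) ∧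
        MemLp (stochIntegral P (fun u => (T : ℝ) - u) (driver S η lam) t) 2 P) ∧
      (∃ H, IsRightContVersion P T
        (condTail 𝓕 P (fun u => (T : ℝ) - u) (driver S η lam) T) H) ∧
      ∀ H, IsRightContVersion P T
          (condTail 𝓕 P (fun u => (T : ℝ) - u) (driver S η lam) T) H →
        (∀ᵐ ω ∂P,
          (∀ t < T, IntervalIntegrable
            (fun s => T / ((T : ℝ) - s) ^ 2 * path H ω s) volume 0 (t : ℝ)) ∧
          IntervalIntegrable
            (fun t => (path H ω t / ((T : ℝ) - t)) ^ 2) volume 0 T) ∧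
        Integrable
          (fun ω => ∫ t in (0 : ℝ)..T, (path H ω t / ((T : ℝ) - t)) ^ 2) P ∧
        optimalStrategyZero T X H ∈ admissible 𝓕 P T X ∧
        IsMinOn (objective P S T η γ lam) (admissible 𝓕 P T X) (optimalStrategyZero T X H) ∧
        objective P S T η γ lam (optimalStrategyZero T X H) =
          - X * P[S 0] +
            η * (X ^ 2 / T +
              X / T * P[stochIntegral P (fun u => (T : ℝ) - u) (driver S η lam) T] -
              1 / 4 * ∫ ω, (∫ t in (0 : ℝ)..T,
                (path H ω t / ((T : ℝ) - t)) ^ 2) ∂P)) := by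
  obtain ⟨B, hB, hBb⟩ := exists_sup_bound (fun t => ((hS.adapted t).mono (𝓕.le t)).measurable)
    (hS.cadlag.mono fun _ h t _ => (h t).1) hS2
  have hp : IsBoundedPrice 𝓕 P T S B :=
    ⟨fun t => (hS.adapted t).measurable, hB, hBb, hS.cadlag.mono fun _ h t _ => (h t).1⟩
  have hk1 (h : 0 < ν) := isRiccatiKernel_sinh (T := T) hT h
  have hk0 (h : ν = 0) : IsRiccatiKernel T ν (fun u => (T : ℝ) - u) (fun _ => 1) :=
    h ▸ isRiccatiKernel_sub hT
  -- Finiteness, existence and uniqueness need some kernel for the given `ν`, no matter which.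
  have hker : ∃ c d, IsRiccatiKernel T ν c d := by
    rcases hν.lt_or_eq with h | h
    exacts [⟨_, _, hk1 h⟩, ⟨_, _, hk0 h.symm⟩]
  obtain ⟨c, d, hk⟩ := hker
  refine ⟨fun x hx => ⟨hp.ae_intervalIntegrable_rates h𝓕 hk hx,
    hp.integrable_costPlusRisk_of_admissible h𝓕 hk hx hη hν2⟩, ?_, fun h => ?_, fun h => ?_⟩
  · obtain ⟨H, hH⟩ := (hp.isBoundedDriver h𝓕 η lam).exists_rightContVersion hk h𝓕
    exact ⟨_, hp.feedback_mem_admissible h𝓕 hk hH, (hp.feedback_optimal h𝓕 hk hH hη hν2).2⟩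
  · have hY := hp.isBoundedDriver h𝓕 η lam
    refine ⟨fun t ht => hY.stochIntegral_spec (hk1 h) h𝓕 ht,
      hY.exists_rightContVersion (hk1 h) h𝓕, fun H hH => ?_⟩
    have h1 := hp.tail_integrable h𝓕 (hk1 h) hH
    have h2 := hp.feedback_optimal (X := X) h𝓕 (hk1 h) hH hη hν2
    have h3 := hp.feedback_mem_admissible (X := X) h𝓕 (hk1 h) hH
    rw [← optimalStrategy_eq_feedbackStrategy T X H] at h2 h3
    refine ⟨h1.1, h1.2, h3, h2.2.1, h2.1.trans ?_⟩
    simp only [IsBoundedPrice.minimalValue, sub_zero]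
    ring
  · have hY := hp.isBoundedDriver h𝓕 η lam
    refine ⟨fun t ht => hY.stochIntegral_spec (hk0 h) h𝓕 ht,
      hY.exists_rightContVersion (hk0 h) h𝓕, fun H hH => ?_⟩
    have h1 := hp.tail_integrable h𝓕 (hk0 h) hH
    have h2 := hp.feedback_optimal (X := X) h𝓕 (hk0 h) hH hη hν2
    have h3 := hp.feedback_mem_admissible (X := X) h𝓕 (hk0 h) hH
    rw [← optimalStrategyZero_eq_feedbackStrategy T X H hT] at h2 h3
    -- `ν = 0` leaves only `γ = 0`, as `lam` and `η` are positive; this removes the term `γ / 2 * X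
    -- ^ 2`.
    have hγ0 : γ = 0 := by
      rw [h, zero_pow two_ne_zero, eq_comm, div_eq_zero_iff, mul_eq_zero] at hν2
      exact (hν2.resolve_right hη.ne').resolve_left hlam.ne'
    refine ⟨h1.1.mono fun ω hω => ⟨fun t ht => ?_, hω.2⟩, h1.2, h3, h2.2.1, h2.1.trans ?_⟩
    · exact ((hω.1 t ht).const_mul (T : ℝ)).congr fun s _ => by ring
    · simp only [IsBoundedPrice.minimalValue, sub_zero, hγ0]
      ring
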